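/- Let $p$ be a prime and let $R$ be a complete local $p$-ring, i.e. a complete discrete valuation ring with maximal ideal $pR$, equipped with a ring endomorphism $\phi:R\to R$ lifting the $p$-power Frobenius of $R/pR$ (for instance $R=\widehat{\mathbb Z_p^{ur}}$ with its Frobenius). For a tuple of variables $x$ let $\phi$ act on $R[x,x',x'',\dots]$ by extending $\phi$ on $R$ and $\phi(x^{(r)})=(x^{(r)})^p+p\,x^{(r+1)}$, and put $\delta F=(\phi(F)-F^p)/p$; define $\phi$ and $\delta$ on $R[[T,T',T'',\dots]]$ by the same formulas. For an affine $R$-scheme $X=\mathrm{Spec}\,R[x]/(f)$ the $p$-jet space of order $n$ is the $p$-adic formal scheme $$J^n(X)=\mathrm{Spf}\ \frac{R[x,x',\dots,x^{(n)}]\,\hat{}}{(f,\delta f,\dots,\delta^n f)},$$ and for a general $R$-scheme $X$ the formal scheme $J^n(X)$ is obtained by gluing the $J^n(U)$, $U\subset X$ affine open. It is functorial in $X$, and it has a canonical projection $J^n(X)\to\widehat X$ to the $p$-adic completion of $X$. ($p$-adic formal schemes over $R$ are identified with their functors of points on $R$-algebras in which $p$ is nilpotent.) **1)** Let $X/R$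 be a smooth scheme of relative dimension $d$. Then $X$ has a covering by affine open subschemes $X_i$ such that, for all $n\ge 0$ and all $i$, there is an isomorphism of $p$-adic formal schemes over $\widehat{X_i}$ $$J^n(X_i)\simeq \widehat{X_i}\times\widehat{\mathbb A^{nd}}.$$ **2)** Let $G/R$ be a smooth group scheme of relative dimension $d$. The formal completion of $G$ along its unit section admits formal coordinates $T=(T_1,\dots,T_d)$, i.e. an isomorphism with $\mathrm{Spf}\,R[[T]]$, and in any such coordinates the multiplication is given by a formal group law. Let $\mathcal F(T_1,T_2)\in R[[T_1,T_2]]^d$ ($T_1,T_2$ being $d$-tuples) be the formal group law of $G$ with respect to any such coordinates. Then: - the series obtained from $\delta^i\mathcal F\in R[[T_1,T_2,\dots,T_1^{(i)},T_2^{(i)}]]^d$ by setting $T_1=T_2=0$ are restricted (their coefficients tend to $0$ $p$-adically), for all $i\ge 0$; - for every $n\ge 0$ the kernel of $J^n(G)\to\widehat G$ is isomorphic, as a $p$-adic formal scheme, to $\widehat{\mathbb A^{nd}}$, in such a way that its composition law becomes the one given by $$\bigl(\delta\mathcal F,\dots,\delta^n\mathcal F\bigr)\big|_{T_1=T_2=0}$$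 in the coordinates $(T_1',\dots,T_1^{(n)})$ and $(T_2',\dots,T_2^{(n)})$ of the two factors. -/

import Mathlib

universe u

open CategoryTheory AlgebraicGeometry MonoidalCategory CartesianMonoidalCategory Opposite

noncomputable section

namespace PJet

/-! ### Fermat quotients, `p`-derivations on polynomial and power series rings -/

/-- The Fermat quotient operator `δ a = (Φ a - a ^ p) / p` attached to a ring endomorphism `Φ`.
It is only used on `p`-torsion free rings whose endomorphism `Φ` lifts the Frobenius, where the
quotient exists and is unique. -/
def fermatQuot (p : ℕ) {A : Type*} [CommRing A] (Φ : A →+* A) (a : A) : A :=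
  open Classical in if h : (p : A) ∣ Φ a - a ^ p then h.choose else 0

theorem mul_fermatQuot {p : ℕ} {A : Type*} [CommRing A] {Φ : A →+* A} {a : A}
    (h : (p : A) ∣ Φ a - a ^ p) : (p : A) * fermatQuot p Φ a = Φ a - a ^ p := by
  rw [fermatQuot, dif_pos h]
  exact h.choose_spec.symm

/-- The endomorphism `φ` of `R{x} = R[x, x', x'', …]`: it extends `φ` on `R` and sends
`x_s^{(r)}` to `(x_s^{(r)}) ^ p + p x_s^{(r+1)}`. The variable `x_s^{(r)}` is `X (r, s)`. -/
def polyPhi (p : ℕ) {R : Type*} [CommRing R] (φ : R →+* R) (σ : Type*) :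
    MvPolynomial (ℕ × σ) R →+* MvPolynomial (ℕ × σ) R :=
  MvPolynomial.eval₂Hom (MvPolynomial.C.comp φ)
    (fun v => MvPolynomial.X v ^ p +
      (p : MvPolynomial (ℕ × σ) R) * MvPolynomial.X (v.1 + 1, v.2))

/-- The `p`-derivation `δ` of `R{x}`. -/
def polyDelta (p : ℕ) {R : Type*} [CommRing R] (φ : R →+* R) {σ : Type*}
    (f : MvPolynomial (ℕ × σ) R) : MvPolynomial (ℕ × σ) R :=
  fermatQuot p (polyPhi p φ σ) f

theorem mul_polyDelta {p : ℕ} (hp : p.Prime) {R : Type*} [CommRing R] {φ : R →+* R}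
    (hφ : ∀ x, (p : R) ∣ φ x - x ^ p) {σ : Type*} (f : MvPolynomial (ℕ × σ) R) :
    (p : MvPolynomial (ℕ × σ) R) * polyDelta p φ f = polyPhi p φ σ f - f ^ p := by
  apply mul_fermatQuot
  induction f using MvPolynomial.induction_on with
  | C a =>
    obtain ⟨c, hc⟩ := hφ a
    refine ⟨MvPolynomial.C c, ?_⟩
    have h := congrArg (MvPolynomial.C (σ := ℕ × σ)) hc
    simpa [polyPhi] using h
  | add f g hf hg =>
    obtain ⟨r, hr⟩ := exists_add_pow_prime_eq hp f g
    obtain ⟨a, ha⟩ := hf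
    obtain ⟨b, hb⟩ := hg
    refine ⟨a + b - f * g * r, ?_⟩
    rw [map_add]
    linear_combination ha + hb - hr
  | mul_X f v hf =>
    obtain ⟨a, ha⟩ := hf
    have hv : polyPhi p φ σ (MvPolynomial.X v) = MvPolynomial.X v ^ p +
        (p : MvPolynomial (ℕ × σ) R) * MvPolynomial.X (v.1 + 1, v.2) := by
      simp [polyPhi]
    refine ⟨a * MvPolynomial.X v ^ p +
      polyPhi p φ σ f * MvPolynomial.X (v.1 + 1, v.2), ?_⟩
    rw [map_mul, hv]
    linear_combination MvPolynomial.X v ^ p * ha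

/-- The power series `(T_s^{(r)}) ^ p + p T_s^{(r+1)}`. -/
def psVar (p : ℕ) (R : Type*) [CommRing R] (σ : Type*) (v : ℕ × σ) :
    MvPowerSeries (ℕ × σ) R :=
  MvPowerSeries.X v ^ p + (p : MvPowerSeries (ℕ × σ) R) * MvPowerSeries.X (v.1 + 1, v.2)

theorem hasSubst_psVar {p : ℕ} (hp : p.Prime) (R : Type*) [CommRing R] (σ : Type*) :
    MvPowerSeries.HasSubst (psVar p R σ) := by
  refine (MvPowerSeries.HasSubst.X_pow hp.ne_zero).add
    (MvPowerSeries.HasSubst.mul_left (fun _ => (p : MvPowerSeries (ℕ × σ) R)) ?_)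
  refine ⟨fun v => by simp, fun e => ?_⟩
  have h := (MvPowerSeries.HasSubst.X (σ := ℕ × σ) (S := R)).coeff_zero e
  refine Set.Finite.subset (h.preimage (f := fun v : ℕ × σ => (v.1 + 1, v.2)) ?_) ?_
  · rintro ⟨a, b⟩ _ ⟨c, d⟩ _ h
    simpa using h
  · intro v hv
    exact hv

/-- The endomorphism `φ` of `R[[T, T', T'', …]]`: it acts as `φ` on the coefficients and sends
`T_s^{(r)}` to `(T_s^{(r)}) ^ p + p T_s^{(r+1)}`. The variable `T_s^{(r)}` is `X (r, s)`. -/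
def psPhi (p : ℕ) [hp : Fact p.Prime] {R : Type*} [CommRing R] (φ : R →+* R) (σ : Type*) :
    MvPowerSeries (ℕ × σ) R →+* MvPowerSeries (ℕ × σ) R :=
  (MvPowerSeries.substAlgHom (hasSubst_psVar hp.out R σ)).toRingHom.comp (MvPowerSeries.map φ)

/-- The `p`-derivation `δ` of `R[[T, T', T'', …]]`. -/
def psDelta (p : ℕ) [Fact p.Prime] {R : Type*} [CommRing R] (φ : R →+* R) {σ : Type*}
    (F : MvPowerSeries (ℕ × σ) R) : MvPowerSeries (ℕ × σ) R :=
  fermatQuot p (psPhi p φ σ) F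

theorem mul_psDelta (p : ℕ) [hp : Fact p.Prime] {R : Type*} [CommRing R] {φ : R →+* R}
    (hφ : ∀ x, (p : R) ∣ φ x - x ^ p) {σ : Type*} (F : MvPowerSeries (ℕ × σ) R) :
    (p : MvPowerSeries (ℕ × σ) R) * psDelta p φ F = psPhi p φ σ F - F ^ p := by
  apply mul_fermatQuot
  let q := Ideal.Quotient.mk (Ideal.span {(p : R)})
  have key : MvPowerSeries.map q (psPhi p φ σ F - F ^ p) = 0 := by
    rcases subsingleton_or_nontrivial (R ⧸ Ideal.span {(p : R)}) with hs | hn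
    · ext e
      exact Subsingleton.elim _ _
    have hpq : ((p : ℕ) : R ⧸ Ideal.span {(p : R)}) = 0 := by
      have : q (p : R) = 0 := Ideal.Quotient.eq_zero_iff_mem.mpr (Ideal.mem_span_singleton_self _)
      simpa using this
    have : CharP (R ⧸ Ideal.span {(p : R)}) p :=
      (CharP.charP_iff_prime_eq_zero hp.out).mpr hpq
    have hcomp : (q.comp φ) = (frobenius (R ⧸ Ideal.span {(p : R)}) p).comp q := by
      ext x
      have : q (φ x - x ^ p) = 0 :=
        Ideal.Quotient.eq_zero_iff_mem.mpr (Ideal.mem_span_singleton.mpr (hφ x))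
      rw [map_sub, sub_eq_zero] at this
      simp [frobenius_def, this]
    rw [map_sub, sub_eq_zero, map_pow,
      ← MvPowerSeries.map_frobenius_expand p hp.out.ne_zero]
    have h1 : MvPowerSeries.map q (psPhi p φ σ F) = MvPowerSeries.subst
        (fun v : ℕ × σ => (MvPowerSeries.X v ^ p :
          MvPowerSeries (ℕ × σ) (R ⧸ Ideal.span {(p : R)})))
        (MvPowerSeries.map q (MvPowerSeries.map φ F)) := by
      have h2 : psPhi p φ σ F = MvPowerSeries.subst (psVar p R σ) (MvPowerSeries.map φ F) := by
        simp [psPhi, MvPowerSeries.coe_substAlgHom]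
      rw [h2, MvPowerSeries.map_subst (hasSubst_psVar hp.out R σ)]
      congr 1
      funext v
      have : ((p : ℕ) : MvPowerSeries (ℕ × σ) (R ⧸ Ideal.span {(p : R)})) = 0 := by
        rw [← map_natCast (MvPowerSeries.C (σ := ℕ × σ)), hpq, map_zero]
      simp [psVar, this]
    have h3 : MvPowerSeries.map q (MvPowerSeries.map φ F) =
        MvPowerSeries.map (frobenius (R ⧸ Ideal.span {(p : R)}) p) (MvPowerSeries.map q F) := by
      ext e
      exact congrArg (fun g => g (MvPowerSeries.coeff e F)) hcomp
    rw [h1, h3, MvPowerSeries.map_expand, MvPowerSeries.expand, MvPowerSeries.substAlgHom_apply]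
  have hc : ∀ e, ∃ c : R, MvPowerSeries.coeff e (psPhi p φ σ F - F ^ p) = p * c := by
    intro e
    have := congrArg (MvPowerSeries.coeff e) key
    rw [MvPowerSeries.coeff_map, map_zero] at this
    exact Ideal.mem_span_singleton.mp (Ideal.Quotient.eq_zero_iff_mem.mp this)
  choose c hc using hc
  let G : MvPowerSeries (ℕ × σ) R := c
  refine ⟨G, ?_⟩
  ext e
  have hG : MvPowerSeries.coeff e G = c e := rfl
  rw [hc e, ← hG, ← nsmul_eq_mul, ← nsmul_eq_mul, map_nsmul]

/-! ### The rings of the jet spaces of affine schemes -/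

section JetAlg

variable (p : ℕ) {R : Type u} [CommRing R] (φ : R →+* R) (n : ℕ)

/-- For a ring homomorphism `ι : R → A` and a tuple `x` of elements of `A`, the ideal
`(f, δ f, …, δ^n f)` of `R[x, x', …, x^{(n)}]`, where `f` runs over all the polynomial relations
satisfied by the tuple `x`. The condition says that `δ^i f`, computed in `R{x}`, is the image of
`g` under the inclusion of `R[x, x', …, x^{(n)}]` into `R{x}`. -/
def jetIdeal {A : Type u} [CommRing A] (ι : R →+* A) {σ : Type u} (x : σ → A) :
    Ideal (MvPolynomial (Fin (n + 1) × σ) R) :=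
  Ideal.span {g | ∃ i ≤ n, ∃ f : MvPolynomial σ R, MvPolynomial.eval₂Hom ι x f = 0 ∧
    MvPolynomial.rename (fun v : Fin (n + 1) × σ => ((v.1 : ℕ), v.2)) g =
      (polyDelta p φ)^[i] (MvPolynomial.rename (fun s => (0, s)) f)}

/-- The ring `R[x, x', …, x^{(n)}] / (f, δ f, …, δ^n f)` attached to `A = R[x] / (f)`, presented
by the tautological tuple `x = (a)_{a ∈ A}` of all its elements, so that `f` runs over all
polynomial relations between elements of `A`. Any other presentation of `A` gives the same ring
up to a canonical isomorphism. Its `p`-adic completion is the ring `𝒪^n` of the affine jet space.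
The completion need not be carried out here, because only homomorphisms into rings in which `p`
is nilpotent are used, and these factor uniquely through the `p`-adic completion. -/
abbrev JetAlg {A : Type u} [CommRing A] (ι : R →+* A) : Type u :=
  MvPolynomial (Fin (n + 1) × A) R ⧸ jetIdeal p φ n ι (fun a : A => a)

/-- The element `δ^i a` (that is, the class of the variable `x_a^{(i)}`) of `JetAlg`. -/
def jetCoord {A : Type u} [CommRing A] (ι : R →+* A) (i : Fin (n + 1)) (a : A) :
    JetAlg p φ n ι :=
  Ideal.Quotient.mk _ (MvPolynomial.X (i, a))

end JetAlg

/-! ### `p`-adic formal schemes through their functors of points -/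

section Formal

variable (p : ℕ) (R : Type u) [CommRing R]

/-- The category of `R`-algebras in which `p` is nilpotent. A `p`-adic formal scheme `𝒳` over `R`
is identified with its functor of points `B ↦ Hom_R(Spec B, 𝒳)` on this category; this embeds
the category of `p`-adic formal schemes over `R` fully faithfully into the category of functors. -/
abbrev PNilAlg : Type (u + 1) :=
  ObjectProperty.FullSubcategory (fun B : CommAlgCat.{u} R => IsNilpotent (p : B))

/-- `B ↦ Spec B`, as a functor to schemes over `Spec R`. -/
abbrev pnilSpec : PNilAlg p R ⥤ (Over (Spec (CommRingCat.of R)))ᵒᵖ :=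
  ObjectProperty.ι _ ⋙ (algSpec (CommRingCat.of R)).rightOp

variable {R}

/-- The `p`-adic completion of a scheme `X` over `R`: its points with values in an `R`-algebra
in which `p` is nilpotent are those of `X`. -/
abbrev completion (X : Over (Spec (CommRingCat.of R))) : PNilAlg p R ⥤ Type u :=
  pnilSpec p R ⋙ yoneda.obj X

variable (R)

/-- The `p`-adic completion of the affine space over `R` with coordinates indexed by `I`. -/
def affineSpace (I : Type) : PNilAlg p R ⥤ Type u where
  obj B := I → B.obj
  map f := TypeCat.ofHom fun t i => f.hom.hom (t i)

end Formal

/-! ### Jet spaces of schemes -/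

section Jet

variable (p : ℕ) {R : Type u} [CommRing R] (φ : R →+* R) (n : ℕ)

/-- The structure homomorphism `R → Γ(X, U)` of a scheme `X` over `R`. -/
def structHom (X : Over (Spec (CommRingCat.of R))) (U : X.left.Opens) : R →+* Γ(X.left, U) :=
  ((Scheme.ΓSpecIso (CommRingCat.of R)).inv ≫ X.hom.appLE ⊤ U le_top).hom

/-- The points with values in `T` of the jet space `J^n(X)`, the formal scheme over `X` glued from
the affine pieces `J^n(U) = Spf 𝒪^n(U)`, for `U` affine open in `X`: such a point is a morphism
`f : T ⟶ X` over `R` together with compatible lifts of its restrictions `f⁻¹ U ⟶ U`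
to morphisms `f⁻¹ U ⟶ J^n(U)`, that is, with ring homomorphisms `𝒪^n(U) → Γ(T, f⁻¹ U)` that
extend the homomorphisms `Γ(X, U) → Γ(T, f⁻¹ U)` and are compatible with restrictions.
(`R`-linearity is a consequence of `θ_base`.) -/
structure JetPoint (X T : Over (Spec (CommRingCat.of R))) where
  base : T ⟶ X
  θ : ∀ U : X.left.affineOpens, JetAlg p φ n (structHom X U) →+* Γ(T.left, base.left ⁻¹ᵁ U)
  θ_base : ∀ (U : X.left.affineOpens) (a : Γ(X.left, U)),
    θ U (jetCoord p φ n (structHom X U) 0 a) = base.left.app U a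
  θ_res : ∀ (U U' : X.left.affineOpens) (h : (U' : X.left.Opens) ≤ U) (i : Fin (n + 1))
    (a : Γ(X.left, U)),
    T.left.presheaf.map (homOfLE (base.left.preimage_mono h)).op
        (θ U (jetCoord p φ n (structHom X U) i a)) =
      θ U' (jetCoord p φ n (structHom X U') i (X.left.presheaf.map (homOfLE h).op a))

variable {p φ n}

/-- The composition of a point of `J^n(X)` with a morphism `t : T' ⟶ T`. -/
def JetPoint.pullback {X T T' : Over (Spec (CommRingCat.of R))} (P : JetPoint p φ n X T)
    (t : T' ⟶ T) : JetPoint p φ n X T' where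
  base := t ≫ P.base
  θ U := (t.left.appLE (P.base.left ⁻¹ᵁ U) ((t ≫ P.base).left ⁻¹ᵁ U) (by simp)).hom.comp (P.θ U)
  θ_base U a := by
    rw [RingHom.comp_apply, P.θ_base, ← CommRingCat.comp_apply]
    congr 2
    exact (Scheme.Hom.comp_appLE t.left P.base.left U _ le_rfl).symm.trans
      (Scheme.Hom.appLE_eq_app _)
  θ_res U U' h i a := by
    rw [RingHom.comp_apply, RingHom.comp_apply, ← P.θ_res U U' h i a, ← CommRingCat.comp_apply,
      ← CommRingCat.comp_apply]
    congr 2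
    simp

theorem JetPoint.ext_of_base {X T : Over (Spec (CommRingCat.of R))} {P Q : JetPoint p φ n X T}
    (hb : P.base = Q.base)
    (hθ : ∀ (U : X.left.affineOpens) x, P.θ U x =
      T.left.presheaf.map (eqToHom (by rw [hb])).op (Q.θ U x)) : P = Q := by
  obtain ⟨b, θ, h1, h2⟩ := P
  obtain ⟨b', θ', h1', h2'⟩ := Q
  obtain rfl : b = b' := hb
  congr
  funext U
  refine RingHom.ext fun x => ?_
  simpa using hθ U x

theorem JetPoint.pullback_id {X T : Over (Spec (CommRingCat.of R))} (P : JetPoint p φ n X T) :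
    P.pullback (𝟙 T) = P := by
  refine JetPoint.ext_of_base (Category.id_comp P.base) fun U x => ?_
  change (Scheme.Hom.appLE (𝟙 T.left) _ _ _) (P.θ U x) = _
  congr 2

theorem JetPoint.pullback_comp {X T T' T'' : Over (Spec (CommRingCat.of R))}
    (P : JetPoint p φ n X T) (t : T' ⟶ T) (s : T'' ⟶ T') :
    P.pullback (s ≫ t) = (P.pullback t).pullback s := by
  refine JetPoint.ext_of_base (Category.assoc s t P.base) fun U x => ?_
  change (Scheme.Hom.appLE (s ≫ t).left _ _ _) (P.θ U x) = T''.left.presheaf.map _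
    (Scheme.Hom.appLE s.left _ _ _ (Scheme.Hom.appLE t.left _ _ _ (P.θ U x)))
  rw [← CommRingCat.comp_apply, ← CommRingCat.comp_apply]
  congr 2
  exact ((congrArg (_ ≫ ·) (Scheme.Hom.appLE_map s.left _ _)).trans
    (Scheme.Hom.appLE_comp_appLE s.left t.left _ _ _ _ _)).symm

variable (p φ n)

/-- The functor of points of the jet space `J^n(X)` on schemes over `R`. -/
def jetPresheaf (X : Over (Spec (CommRingCat.of R))) :
    (Over (Spec (CommRingCat.of R)))ᵒᵖ ⥤ Type u where
  obj T := JetPoint p φ n X T.unop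
  map t := TypeCat.ofHom fun P => P.pullback t.unop
  map_id T := by
    ext P
    exact JetPoint.pullback_id P
  map_comp t s := by
    ext P
    exact JetPoint.pullback_comp P t.unop s.unop

/-- The `p`-jet space `J^n(X)`, as a `p`-adic formal scheme over `R`. -/
abbrev jetSpace (X : Over (Spec (CommRingCat.of R))) : PNilAlg p R ⥤ Type u :=
  pnilSpec p R ⋙ jetPresheaf p φ n X

/-- The canonical projection from the jet space `J^n(X)` to the `p`-adic completion of `X`. -/
def jetProj (X : Over (Spec (CommRingCat.of R))) : jetSpace p φ n X ⟶ completion p X where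
  app B := TypeCat.ofHom fun P => P.base

variable {p φ n}

/-- `Q` is the image of the point `P` under the morphism `J^n(h) : J^n(X) ⟶ J^n(Y)` induced by
`h : X ⟶ Y`. On affine opens `U ⊆ X` and `V ⊆ Y` with `h(U) ⊆ V` the morphism `J^n(h)` is given
by the homomorphism `𝒪^n(V) → 𝒪^n(U)`, `δ^i a ↦ δ^i (h^* a)`. -/
def JetPoint.IsImage {X Y T : Over (Spec (CommRingCat.of R))} (h : X ⟶ Y)
    (P : JetPoint p φ n X T) (Q : JetPoint p φ n Y T) : Prop :=
  ∃ hb : P.base ≫ h = Q.base,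
    ∀ (V : Y.left.affineOpens) (U : X.left.affineOpens)
      (hUV : (U : X.left.Opens) ≤ h.left ⁻¹ᵁ V) (i : Fin (n + 1)) (a : Γ(Y.left, V)),
      T.left.presheaf.map (homOfLE (show P.base.left ⁻¹ᵁ (U : X.left.Opens) ≤ Q.base.left ⁻¹ᵁ V by
          rw [← hb]; exact P.base.left.preimage_mono hUV)).op
          (Q.θ V (jetCoord p φ n (structHom Y V) i a)) =
        P.θ U (jetCoord p φ n (structHom X U) i (h.left.appLE V U hUV a))

/-- The composition law of the formal group scheme `J^n(G)`, where `G` is a group scheme over `R`: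
it is the morphism `J^n(G) × J^n(G) = J^n(G × G) ⟶ J^n(G)` induced by the multiplication
`μ : G × G ⟶ G`. The proposition says that the product of the points `P` and `Q` is `S`. -/
def JetPoint.IsMul {G T : Over (Spec (CommRingCat.of R))} [GrpObj G]
    (P Q S : JetPoint p φ n G T) : Prop :=
  ∃ M : JetPoint p φ n (G ⊗ G) T,
    M.IsImage (fst G G) P ∧ M.IsImage (snd G G) Q ∧ M.IsImage (MonObj.mul (X := G)) S

variable (p φ n)

/-- The kernel of `J^n(G) ⟶ Ĝ`: the points of `J^n(G)` that lie over the unit section of `G`. -/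
def jetKernel (G : Over (Spec (CommRingCat.of R))) [GrpObj G] :
    Subfunctor (jetSpace p φ n G) where
  obj B := {P | (jetProj p φ n G).app B P = toUnit _ ≫ MonObj.one (X := G)}
  map {B B'} f P hP := by
    have hP' : P.base = toUnit _ ≫ MonObj.one (X := G) := hP
    change ((pnilSpec p R).map f).unop ≫ P.base = _
    rw [hP', ← Category.assoc]
    congr 1
    exact toUnit_unique _ _

end Jet

/-! ### Formal group laws -/

section FormalGroup

/-- The sum `∑ c_e y^e` of the power series `F = ∑ c_e T^e` at a tuple `y` of elements of an
`R`-algebra. It is only used where all but finitely many terms vanish. -/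
def evalSeries {R : Type*} [CommRing R] {B : Type*} [CommRing B] [Algebra R B] {τ : Type*}
    (F : MvPowerSeries τ R) (y : τ → B) : B :=
  ∑ᶠ e : τ →₀ ℕ, algebraMap R B (MvPowerSeries.coeff e F) * e.prod fun s k => y s ^ k

variable {R : Type u} [CommRing R]

/-- The formal completion of `G` along its unit section: the points `g` of `G` with values in an
`R`-algebra `B` whose restriction to `Spec (B_red)` is the unit. -/
def formalCompletion (G : Over (Spec (CommRingCat.of R))) [GrpObj G] :
    Subfunctor ((algSpec (CommRingCat.of R)).rightOp ⋙ yoneda.obj G) where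
  obj B := {g | (algSpec (CommRingCat.of R)).map
    (CommAlgCat.ofHom (Ideal.Quotient.mkₐ R (nilradical B))).op ≫ g =
      toUnit _ ≫ MonObj.one (X := G)}
  map {B B'} f g hg := by
    let q := CommAlgCat.ofHom (Ideal.Quotient.mkₐ R (nilradical B))
    let q' := CommAlgCat.ofHom (Ideal.Quotient.mkₐ R (nilradical B'))
    let fr : CommAlgCat.of R (B ⧸ nilradical B) ⟶ CommAlgCat.of R (B' ⧸ nilradical B') :=
      CommAlgCat.ofHom (Ideal.quotientMapₐ (nilradical B') f.hom fun x hx =>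
        mem_nilradical.mpr (IsNilpotent.map (mem_nilradical.mp hx) f.hom))
    have hq : f ≫ q' = q ≫ fr := rfl
    have hg' : (algSpec (CommRingCat.of R)).map q.op ≫ g = toUnit _ ≫ MonObj.one (X := G) := hg
    change (algSpec (CommRingCat.of R)).map q'.op ≫ (algSpec (CommRingCat.of R)).map f.op ≫ g = _
    rw [← Category.assoc, ← Functor.map_comp, ← op_comp, hq, op_comp, Functor.map_comp,
      Category.assoc, hg', ← Category.assoc]
    congr 1
    exact toUnit_unique _ _

variable (R) in
/-- The functor `B ↦ Nil(B)^d`, that is, the formal affine space `Spf R[[T_1, …, T_d]]`. -/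
def formalAffineSpace (d : ℕ) : CommAlgCat.{u} R ⥤ Type u where
  obj B := Fin d → nilradical B
  map f := TypeCat.ofHom fun t i => ⟨f.hom (t i), IsNilpotent.map (mem_nilradical.mp (t i).2) f.hom⟩

/-- `F ∈ R[[T_1, T_2]]^d` is the formal group law of `G` with respect to some system of formal
coordinates along the unit section, that is, some isomorphism `c` of the formal completion of `G`
along its unit section with `Spf R[[T]]`, `T` a `d`-tuple of variables: in these coordinates the
multiplication of `G` is given by `F`. The variables `inl j` and `inr j` are the `j`-th components
of `T_1` and `T_2`. -/
def IsFormalGroupLaw (G : Over (Spec (CommRingCat.of R))) [GrpObj G] {d : ℕ}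
    (F : Fin d → MvPowerSeries (Fin d ⊕ Fin d) R) : Prop :=
  ∃ c : (formalCompletion G).toFunctor ≅ formalAffineSpace R d,
    ∀ (B : CommAlgCat.{u} R) (g h k : (formalCompletion G).toFunctor.obj B),
      k.1 = lift g.1 h.1 ≫ MonObj.mul (X := G) →
      ∀ j, (c.hom.app B k j : B) =
        evalSeries (F j) (Sum.elim (fun a => (c.hom.app B g a : B)) (fun a => (c.hom.app B h a : B)))

variable (p : ℕ) [Fact p.Prime] (φ : R →+* R)

/-- The series `δ^i F_j ∈ R[[T_1, T_2, …, T_1^{(i)}, T_2^{(i)}]]` after setting `T_1 = T_2 = 0`.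
The variables `(r, inl j)` and `(r, inr j)` are the `j`-th components of `T_1^{(r)}` and
`T_2^{(r)}`. -/
def kernelSeries {d : ℕ} (F : Fin d → MvPowerSeries (Fin d ⊕ Fin d) R) (i : ℕ) (j : Fin d) :
    MvPowerSeries (ℕ × (Fin d ⊕ Fin d)) R := fun e =>
  open Classical in
  if ∀ s, e (0, s) = 0 then
    MvPowerSeries.coeff e
      ((psDelta p φ)^[i] (MvPowerSeries.rename (fun s : Fin d ⊕ Fin d => ((0 : ℕ), s)) (F j)))
  else 0

/-- A power series over `R` is restricted if its coefficients tend to `0` `p`-adically. -/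
def IsRestricted {τ : Type*} (F : MvPowerSeries τ R) : Prop :=
  ∀ m : ℕ, {e : τ →₀ ℕ | ¬ (p : R) ^ m ∣ MvPowerSeries.coeff e F}.Finite

/-- The values of the variables `T_1^{(r)}`, `T_2^{(r)}` at `t`, `s` with values in `B^{nd}`. The
components `t (r, j)` and `s (r, j)` are the values of the `j`-th components of `T_1^{(r+1)}` and
`T_2^{(r+1)}`. -/
def kernelPoint {B : Type*} [CommRing B] {n d : ℕ} (t s : Fin n × Fin d → B) :
    ℕ × (Fin d ⊕ Fin d) → B
  | (0, _) => 0
  | (r + 1, Sum.inl j) => if h : r < n then t (⟨r, h⟩, j) else 0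
  | (r + 1, Sum.inr j) => if h : r < n then s (⟨r, h⟩, j) else 0

end FormalGroup

end PJet

end

noncomputable section

namespace PJet

/-! ### Calculus of the `p`-derivation on polynomials -/

/-! The `n`-jets with coordinates in an `R`-algebra `B` form a ring, the analogue over `(R, φ)` of
Witt vectors of length `n + 1`: on `B^{n+1}` a polynomial `f` acts through the values of `f, δf, …,
δ^n f`. Since substitution commutes with `δ` (`prolong_polyDelta`), these operations compose
correctly (`JetRing.eval_aeval`), and the ring axioms follow formally. Ring homomorphisms `JetAlg →
B` compatible with `R` are then the same as `R`-linear homomorphisms `A → JetRing p φ n B`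
(`jetAlgLift`, `jetRingHom`). So a `B`-point of `J^n(X)` whose base lies in an affine open is a
point of `X` with values in the ring of jets (`JetPoint.Represents`).

The second ingredient is nilpotence: if `p ^ m = 0` in `B`, the kernel of `JetRing p φ n B → B` has
vanishing `(m + n)`-th power (`JetRing.ker_proj_pow_eq_bot`). Filter `R[[T, T', …]]` by the powers
of `(p, T)`. The endomorphism `φ` preserves the filtration and `δ` loses one step, while on
monomials free of `T` the filtration is plain `p`-divisibility. The same estimate shows that `δ^i F`
at `T = 0` is restricted, and that these series are the coordinates of `F` evaluated at jets over
zero (`JetRing.coord_evalSeries`).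

For 1), étale coordinates on an affine chart lift uniquely along the nilpotent thickening `JetRing →
B`: their order-zero components are forced by the base point, and those of orders `1, …, n` are free
(`JetPoint.existsUnique_of_etale`).

For 2), a point of the kernel is a point of the formal completion, with values in the ring of jets,
that projects to the unit. As `R` is reduced, any formal coordinates vanish at the unit, so they
turn such a point into `d` jets with zero order-zero component, that is, into an element of
`B^{nd}`. Multiplication is evaluation of `F` at jets. The existence of `F` comes from étale
coordinates near the unit section and from naturality of the group law on nilpotent tuples
(`exists_eq_evalSeries_of_natural`). -/

/-- `φ` is a lift of the `p`-power Frobenius of a `p`-torsion free ring. -/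
class IsFrobeniusLift (p : ℕ) {R : Type*} [CommRing R] (φ : R →+* R) : Prop where
  prime : p.Prime
  dvd : ∀ x, (p : R) ∣ φ x - x ^ p
  regular : ∀ x y : R, (p : R) * x = p * y → x = y

section PolyDelta

variable {p : ℕ} {R : Type*} [CommRing R] {φ : R →+* R} {σ τ : Type*}

@[simp]
theorem polyPhi_X (v : ℕ × σ) : polyPhi p φ σ (MvPolynomial.X v) =
    MvPolynomial.X v ^ p + (p : MvPolynomial (ℕ × σ) R) * MvPolynomial.X (v.1 + 1, v.2) := by
  simp [polyPhi]

@[simp]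
theorem polyPhi_C (r : R) : polyPhi p φ σ (MvPolynomial.C r) = MvPolynomial.C (φ r) := by
  simp [polyPhi]

variable (p φ) in
/-- The homomorphism `R{x} → R{y}` of rings with `p`-derivation that sends `x_s` to `g s`. -/
def prolong (g : σ → MvPolynomial (ℕ × τ) R) :
    MvPolynomial (ℕ × σ) R →ₐ[R] MvPolynomial (ℕ × τ) R :=
  MvPolynomial.aeval fun v => (polyDelta p φ)^[v.1] (g v.2)

variable (R) in
/-- The inclusion of `R[x]` into `R{x}`. -/
def orderZero : MvPolynomial σ R →ₐ[R] MvPolynomial (ℕ × σ) R :=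
  MvPolynomial.rename fun s => ((0 : ℕ), s)

theorem prolong_orderZero (g : σ → MvPolynomial τ R) (f : MvPolynomial σ R) :
    prolong p φ (fun s => orderZero R (g s)) (orderZero R f) =
      orderZero R (MvPolynomial.aeval g f) := by
  induction f using MvPolynomial.induction_on with
  | C a => simp [orderZero]
  | add f g hf hg => simp only [map_add, hf, hg]
  | mul_X f v hf =>
    simp only [map_mul, hf]
    congr 1
    simp [orderZero, prolong]

theorem mvPolynomial_natCast_mul_cancel (φ : R →+* R) [hφ : IsFrobeniusLift p φ]
    {f g : MvPolynomial σ R}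
    (h : (p : MvPolynomial σ R) * f = p * g) : f = g := by
  ext e
  have := congrArg (MvPolynomial.coeff e) h
  rw [← nsmul_eq_mul, ← nsmul_eq_mul, MvPolynomial.coeff_smul, MvPolynomial.coeff_smul,
    nsmul_eq_mul, nsmul_eq_mul] at this
  exact hφ.regular _ _ this

variable [hφ : IsFrobeniusLift p φ]

theorem natCast_mul_polyDelta (f : MvPolynomial (ℕ × σ) R) :
    (p : MvPolynomial (ℕ × σ) R) * polyDelta p φ f = polyPhi p φ σ f - f ^ p :=
  mul_polyDelta hφ.prime hφ.dvd f

theorem polyDelta_eq_of_mul_eq {f g : MvPolynomial (ℕ × σ) R}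
    (h : (p : MvPolynomial (ℕ × σ) R) * g = polyPhi p φ σ f - f ^ p) : polyDelta p φ f = g :=
  mvPolynomial_natCast_mul_cancel φ ((natCast_mul_polyDelta f).trans h.symm)

theorem polyDelta_X (v : ℕ × σ) :
    polyDelta p φ (MvPolynomial.X v : MvPolynomial (ℕ × σ) R) = MvPolynomial.X (v.1 + 1, v.2) := by
  apply polyDelta_eq_of_mul_eq
  simp

theorem iterate_polyDelta_X (i : ℕ) (v : ℕ × σ) :
    (polyDelta p φ)^[i] (MvPolynomial.X v : MvPolynomial (ℕ × σ) R) =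
      MvPolynomial.X (v.1 + i, v.2) := by
  induction i with
  | zero => rfl
  | succ i ih => rw [Function.iterate_succ_apply', ih, polyDelta_X]; rfl

/-- Only the variables need checking. There the image of `x^p + p x'` is `a^p + p δa` with `a = δ^r
(g s)`, which is `φ a` by the definition of `δ`. -/
theorem prolong_polyPhi (g : σ → MvPolynomial (ℕ × τ) R) (f : MvPolynomial (ℕ × σ) R) :
    prolong p φ g (polyPhi p φ σ f) = polyPhi p φ τ (prolong p φ g f) := by
  induction f using MvPolynomial.induction_on with
  | C a => simp [prolong]
  | add f g hf hg => simp only [map_add, hf, hg]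
  | mul_X f v hf =>
    simp only [map_mul, hf, polyPhi_X, map_add, map_pow, map_natCast]
    congr 1
    simp only [prolong, MvPolynomial.aeval_X, Function.iterate_succ_apply', natCast_mul_polyDelta]
    ring

theorem prolong_polyDelta (g : σ → MvPolynomial (ℕ × τ) R) (f : MvPolynomial (ℕ × σ) R) :
    prolong p φ g (polyDelta p φ f) = polyDelta p φ (prolong p φ g f) := by
  symm
  apply polyDelta_eq_of_mul_eq
  rw [← prolong_polyPhi, ← map_pow, ← map_sub, ← natCast_mul_polyDelta, map_mul, map_natCast]

theorem prolong_iterate_polyDelta (i : ℕ) (g : σ → MvPolynomial (ℕ × τ) R)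
    (f : MvPolynomial (ℕ × σ) R) :
    prolong p φ g ((polyDelta p φ)^[i] f) = (polyDelta p φ)^[i] (prolong p φ g f) := by
  induction i with
  | zero => rfl
  | succ i ih => rw [Function.iterate_succ_apply', prolong_polyDelta, ih,
      Function.iterate_succ_apply']

/-- The operator `δ` raises the order by at most one: `p δf = φ f - f ^ p` visibly does, and
division by the regular element `p` does not change which monomials occur. -/
theorem polyDelta_mem_supported {k : ℕ} {f : MvPolynomial (ℕ × σ) R}
    (hf : f ∈ MvPolynomial.supported R {v : ℕ × σ | v.1 ≤ k}) :
    polyDelta p φ f ∈ MvPolynomial.supported R {v : ℕ × σ | v.1 ≤ k + 1} := by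
  have hmono : MvPolynomial.supported R {v : ℕ × σ | v.1 ≤ k} ≤
      MvPolynomial.supported R {v : ℕ × σ | v.1 ≤ k + 1} :=
    MvPolynomial.supported_mono fun v (hv : v.1 ≤ k) => Nat.le_succ_of_le hv
  have hPhi : polyPhi p φ σ f ∈ MvPolynomial.supported R {v : ℕ × σ | v.1 ≤ k + 1} := by
    rw [MvPolynomial.supported] at hf
    induction hf using Algebra.adjoin_induction with
    | mem x hx =>
      obtain ⟨v, hv, rfl⟩ := hx
      have hv : v.1 ≤ k := hv
      rw [polyPhi_X]
      have h1 : v ∈ {v : ℕ × σ | v.1 ≤ k + 1} := Nat.le_succ_of_le hv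
      have h2 : (v.1 + 1, v.2) ∈ {v : ℕ × σ | v.1 ≤ k + 1} := Nat.succ_le_succ hv
      exact add_mem (pow_mem (Algebra.subset_adjoin (Set.mem_image_of_mem _ h1)) _)
        (mul_mem (natCast_mem _ _) (Algebra.subset_adjoin (Set.mem_image_of_mem _ h2)))
    | algebraMap r =>
      rw [MvPolynomial.algebraMap_eq, polyPhi_C]
      exact Subalgebra.algebraMap_mem _ _
    | add x y _ _ hx hy => rw [map_add]; exact add_mem hx hy
    | mul x y _ _ hx hy => rw [map_mul]; exact mul_mem hx hy
  have h : (p : MvPolynomial (ℕ × σ) R) * polyDelta p φ f ∈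
      MvPolynomial.supported R {v : ℕ × σ | v.1 ≤ k + 1} := by
    rw [natCast_mul_polyDelta]
    exact sub_mem hPhi (pow_mem (hmono hf) _)
  rw [MvPolynomial.mem_supported] at h ⊢
  refine subset_trans ?_ h
  intro v hv
  rw [Finset.mem_coe, MvPolynomial.mem_vars_iff_mem_support] at hv ⊢
  obtain ⟨e, he, hve⟩ := hv
  refine ⟨e, ?_, hve⟩
  rw [MvPolynomial.mem_support_iff] at he ⊢
  intro h0
  apply he
  apply hφ.regular
  rw [← nsmul_eq_mul, MvPolynomial.coeff_smul, nsmul_eq_mul] at h0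
  rw [h0, mul_zero]

theorem iterate_polyDelta_mem_supported (i : ℕ) (f : MvPolynomial σ R) :
    (polyDelta p φ)^[i] (orderZero R f) ∈ MvPolynomial.supported R {v : ℕ × σ | v.1 ≤ i} := by
  induction i with
  | zero =>
    rw [Function.iterate_zero_apply, MvPolynomial.mem_supported]
    intro v hv
    classical
    obtain ⟨s, -, rfl⟩ := Finset.mem_image.mp (MvPolynomial.vars_rename _ _ hv)
    exact Nat.le_refl 0
  | succ i ih =>
    rw [Function.iterate_succ_apply']
    exact polyDelta_mem_supported ih

/-- Makes the truncation harmless: `δ^i f` with `i ≤ n` never sees the coordinates of order above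
`n`, which `coords` sets to zero. -/
theorem aeval_iterate_polyDelta_congr {B : Type*} [CommRing B] [Algebra R B] {i : ℕ}
    {b c : ℕ × σ → B} (h : ∀ v : ℕ × σ, v.1 ≤ i → b v = c v) (f : MvPolynomial σ R) :
    MvPolynomial.aeval b ((polyDelta p φ)^[i] (orderZero R f)) =
      MvPolynomial.aeval c ((polyDelta p φ)^[i] (orderZero R f)) := by
  have hf := iterate_polyDelta_mem_supported (p := p) (φ := φ) i f
  rw [MvPolynomial.mem_supported] at hf
  rw [MvPolynomial.aeval_def, MvPolynomial.aeval_def]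
  refine MvPolynomial.eval₂Hom_congr' rfl (fun v hv _ => h v (hf hv)) rfl

end PolyDelta

/-! ### The ring of truncated jets -/

/-- The set of values in `B` of the coordinates `x, x', …, x^{(n)}` of an `n`-jet. -/
@[ext]
structure JetRing (p : ℕ) {R : Type*} [CommRing R] (φ : R →+* R) (n : ℕ) (B : Type*) where
  coord : Fin (n + 1) → B

namespace JetRing

variable {p : ℕ} {R : Type*} [CommRing R] {φ : R →+* R} {n : ℕ} {B : Type*}
  [CommRing B] [Algebra R B] {σ τ : Type*}

/-- The coordinates of a tuple of truncated jets, extended by zero. -/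
def coords (u : σ → JetRing p φ n B) (v : ℕ × σ) : B :=
  if h : v.1 < n + 1 then (u v.2).coord ⟨v.1, h⟩ else 0

/-- The jet with the coordinates `f(b), (δ f)(b), …, (δ^n f)(b)`. -/
def ofCoords (n : ℕ) (b : ℕ × σ → B) (f : MvPolynomial σ R) : JetRing p φ n B :=
  ⟨fun i => MvPolynomial.aeval b ((polyDelta p φ)^[i] (orderZero R f))⟩

/-- The value of a polynomial at a tuple of jets. -/
def eval (u : σ → JetRing p φ n B) (f : MvPolynomial σ R) : JetRing p φ n B :=
  ofCoords n (coords u) f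

variable [hφ : IsFrobeniusLift p φ]

theorem ofCoords_X (b : ℕ × σ → B) (s : σ) :
    ofCoords n b (MvPolynomial.X s : MvPolynomial σ R) =
      (⟨fun i => b (i, s)⟩ : JetRing p φ n B) := by
  ext i
  simp [ofCoords, orderZero, iterate_polyDelta_X]

theorem eval_X (u : σ → JetRing p φ n B) (s : σ) : eval u (MvPolynomial.X s) = u s := by
  rw [eval, ofCoords_X]
  ext i
  simp [coords, Nat.not_lt.mpr (Nat.le_of_lt_succ i.2), -not_lt]

/-- The composition law of polynomial operations on jets, which is the source of every ring axiom.
It is the commutation of `prolong` with `δ^i`, followed by evaluation at `coords u`. -/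
theorem eval_aeval (u : τ → JetRing p φ n B) (g : σ → MvPolynomial τ R) (f : MvPolynomial σ R) :
    eval u (MvPolynomial.aeval g f) = eval (fun s => eval u (g s)) f := by
  ext i
  change MvPolynomial.aeval (coords u) ((polyDelta p φ)^[i] (orderZero R _)) = _
  rw [← prolong_orderZero (p := p) (φ := φ), ← prolong_iterate_polyDelta, prolong,
    ← AlgHom.comp_apply, MvPolynomial.comp_aeval]
  apply aeval_iterate_polyDelta_congr
  intro v hv
  simp [coords, show v.1 < n + 1 by omega, eval, ofCoords]

section Ring

/-- Every operation, including multiples, powers and casts, is the value of its universal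
polynomial. Its compatibility with `eval`, which the transfer of the ring structure requires, is
then an instance of `eval_aeval`. -/
instance : Zero (JetRing p φ n B) := ⟨eval Empty.elim (0 : MvPolynomial Empty R)⟩
instance : One (JetRing p φ n B) := ⟨eval Empty.elim (1 : MvPolynomial Empty R)⟩
instance : Add (JetRing p φ n B) :=
  ⟨fun u v => eval ![u, v] (MvPolynomial.X 0 + MvPolynomial.X 1 : MvPolynomial (Fin 2) R)⟩
instance : Mul (JetRing p φ n B) :=
  ⟨fun u v => eval ![u, v] (MvPolynomial.X 0 * MvPolynomial.X 1 : MvPolynomial (Fin 2) R)⟩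
instance : Sub (JetRing p φ n B) :=
  ⟨fun u v => eval ![u, v] (MvPolynomial.X 0 - MvPolynomial.X 1 : MvPolynomial (Fin 2) R)⟩
instance : Neg (JetRing p φ n B) :=
  ⟨fun u => eval (fun _ => u) (- MvPolynomial.X () : MvPolynomial Unit R)⟩
instance : SMul ℕ (JetRing p φ n B) :=
  ⟨fun k u => eval (fun _ => u) (k • MvPolynomial.X () : MvPolynomial Unit R)⟩
instance : SMul ℤ (JetRing p φ n B) :=
  ⟨fun k u => eval (fun _ => u) (k • MvPolynomial.X () : MvPolynomial Unit R)⟩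
instance : Pow (JetRing p φ n B) ℕ :=
  ⟨fun u k => eval (fun _ => u) (MvPolynomial.X () ^ k : MvPolynomial Unit R)⟩
instance : NatCast (JetRing p φ n B) :=
  ⟨fun k => eval Empty.elim (k : MvPolynomial Empty R)⟩
instance : IntCast (JetRing p φ n B) :=
  ⟨fun k => eval Empty.elim (k : MvPolynomial Empty R)⟩

theorem eval_add_pair (u : σ → JetRing p φ n B) (f g : MvPolynomial σ R) :
    eval u (f + g) = eval u f + eval u g := by
  have h := eval_aeval u ![f, g] (MvPolynomial.X 0 + MvPolynomial.X 1)
  simp only [map_add, MvPolynomial.aeval_X, Matrix.cons_val_zero, Matrix.cons_val_one] at h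
  rw [h]
  change _ = eval _ _
  congr 1
  funext s
  fin_cases s <;> rfl

theorem eval_mul_pair (u : σ → JetRing p φ n B) (f g : MvPolynomial σ R) :
    eval u (f * g) = eval u f * eval u g := by
  have h := eval_aeval u ![f, g] (MvPolynomial.X 0 * MvPolynomial.X 1)
  simp only [map_mul, MvPolynomial.aeval_X, Matrix.cons_val_zero, Matrix.cons_val_one] at h
  rw [h]
  change _ = eval _ _
  congr 1
  funext s
  fin_cases s <;> rfl

theorem eval_sub_pair (u : σ → JetRing p φ n B) (f g : MvPolynomial σ R) :
    eval u (f - g) = eval u f - eval u g := by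
  have h := eval_aeval u ![f, g] (MvPolynomial.X 0 - MvPolynomial.X 1)
  simp only [map_sub, MvPolynomial.aeval_X, Matrix.cons_val_zero, Matrix.cons_val_one] at h
  rw [h]
  change _ = eval _ _
  congr 1
  funext s
  fin_cases s <;> rfl

theorem eval_zero_one (u : σ → JetRing p φ n B) : eval u (0 : MvPolynomial σ R) = 0 ∧
    eval u (1 : MvPolynomial σ R) = 1 ∧ (∀ k : ℕ, eval u (k : MvPolynomial σ R) = k) ∧
    ∀ k : ℤ, eval u (k : MvPolynomial σ R) = k := by
  have h := eval_aeval u (Empty.elim : Empty → MvPolynomial σ R)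
  have hE : (fun s => eval u (Empty.elim s)) = (Empty.elim : Empty → JetRing p φ n B) := by
    funext s
    exact s.elim
  rw [hE] at h
  refine ⟨?_, ?_, fun k => ?_, fun k => ?_⟩
  · have := h 0
    rw [map_zero] at this
    exact this
  · have := h 1
    rw [map_one] at this
    exact this
  · have := h k
    rw [map_natCast] at this
    exact this
  · have := h k
    rw [map_intCast] at this
    exact this

/-- The axioms are inherited from the polynomial ring with one variable for each jet, which maps
onto the jets by tautological evaluation. -/
instance instCommRing : CommRing (JetRing p φ n B) :=
  Function.Surjective.commRing (eval id : MvPolynomial (JetRing p φ n B) R → JetRing p φ n B)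
    (fun u => ⟨MvPolynomial.X u, eval_X _ _⟩) (eval_zero_one _).1 (eval_zero_one _).2.1
    (eval_add_pair _) (eval_mul_pair _)
    (fun f => by
      have h := eval_aeval id (fun _ : Unit => f) (-MvPolynomial.X () : MvPolynomial Unit R)
      rw [map_neg, MvPolynomial.aeval_X] at h
      exact h)
    (eval_sub_pair _)
    (fun k f => by
      have h := eval_aeval id (fun _ : Unit => f) (k • MvPolynomial.X () : MvPolynomial Unit R)
      rw [map_nsmul, MvPolynomial.aeval_X] at h
      exact h)
    (fun k f => by
      have h := eval_aeval id (fun _ : Unit => f) (k • MvPolynomial.X () : MvPolynomial Unit R)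
      rw [map_zsmul, MvPolynomial.aeval_X] at h
      exact h)
    (fun f k => by
      have h := eval_aeval id (fun _ : Unit => f) (MvPolynomial.X () ^ k : MvPolynomial Unit R)
      rw [map_pow, MvPolynomial.aeval_X] at h
      exact h)
    (eval_zero_one _).2.2.1 (eval_zero_one _).2.2.2

/-- Evaluation of polynomials at a tuple of jets, as a ring homomorphism. -/
def evalHom (u : σ → JetRing p φ n B) : MvPolynomial σ R →+* JetRing p φ n B where
  toFun := eval u
  map_zero' := (eval_zero_one u).1
  map_one' := (eval_zero_one u).2.1
  map_add' := eval_add_pair u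
  map_mul' := eval_mul_pair u

/-- A scalar `r` becomes the jet with coordinates the images of `r, δr, …, δ^n r`, not `(r, 0, …,
0)`. -/
instance instAlgebra : Algebra R (JetRing p φ n B) :=
  ((evalHom Empty.elim).comp (MvPolynomial.C (σ := Empty))).toAlgebra

theorem eval_eq_aeval (u : σ → JetRing p φ n B) (f : MvPolynomial σ R) :
    eval u f = MvPolynomial.aeval u f := by
  have h : evalHom u =
      (MvPolynomial.aeval u : MvPolynomial σ R →ₐ[R] JetRing p φ n B).toRingHom := by
    ext a : 2
    · change eval u (MvPolynomial.C a) = MvPolynomial.aeval u (MvPolynomial.C a)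
      rw [MvPolynomial.aeval_C]
      have h := eval_aeval u (Empty.elim : Empty → MvPolynomial σ R) (MvPolynomial.C a)
      rw [MvPolynomial.aeval_C, MvPolynomial.algebraMap_eq] at h
      rw [h]
      change _ = eval _ _
      congr 1
      funext s
      exact s.elim
    · exact congrArg coord ((eval_X u a).trans (MvPolynomial.aeval_X (R := R) u a).symm)
  exact congrArg (fun g : MvPolynomial σ R →+* JetRing p φ n B => g f) h

theorem coord_aeval (u : σ → JetRing p φ n B) (f : MvPolynomial σ R) (i : Fin (n + 1)) :
    (MvPolynomial.aeval u f : JetRing p φ n B).coord i =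
      MvPolynomial.aeval (coords u) ((polyDelta p φ)^[i] (orderZero R f)) := by
  rw [← eval_eq_aeval]
  rfl

/-- Compatibility with polynomial operations in at most two variables already contains all axioms of
an algebra homomorphism; constants are polynomials in no variables. -/
theorem exists_algHom_of_aeval {C : Type*} [CommRing C] [Algebra R C] (h : JetRing p φ n B → C)
    (H : ∀ {κ : Type} (u : κ → JetRing p φ n B) (f : MvPolynomial κ R),
      h (MvPolynomial.aeval u f) = MvPolynomial.aeval (fun s => h (u s)) f) :
    ∃ g : JetRing p φ n B →ₐ[R] C, ⇑g = h := by
  refine ⟨⟨⟨⟨⟨h, ?_⟩, ?_⟩, ?_, ?_⟩, ?_⟩, rfl⟩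
  · simpa using H Empty.elim 1
  · intro u v
    have := H ![u, v] (MvPolynomial.X 0 * MvPolynomial.X 1)
    simpa only [map_mul, MvPolynomial.aeval_X, Matrix.cons_val_zero, Matrix.cons_val_one] using this
  · simpa using H Empty.elim 0
  · intro u v
    have := H ![u, v] (MvPolynomial.X 0 + MvPolynomial.X 1)
    simpa only [map_add, MvPolynomial.aeval_X, Matrix.cons_val_zero, Matrix.cons_val_one] using this
  · intro r
    simpa using H Empty.elim (MvPolynomial.C r)

variable (p φ n) in
/-- The projection to the coordinate of order zero. -/
def proj (B : Type*) [CommRing B] [Algebra R B] : JetRing p φ n B →ₐ[R] B :=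
  (exists_algHom_of_aeval (fun u => u.coord 0) (fun u f => by
    rw [coord_aeval, Fin.val_zero, Function.iterate_zero_apply, orderZero,
      MvPolynomial.aeval_rename]
    rfl)).choose

@[simp]
theorem proj_apply (u : JetRing p φ n B) : proj p φ n B u = u.coord 0 := by
  rw [proj, Exists.choose_spec (p := fun g : JetRing p φ n B →ₐ[R] B => ⇑g = fun u => u.coord 0)]

theorem proj_surjective : Function.Surjective (proj p φ n B) := fun b =>
  ⟨⟨fun _ => b⟩, by simp⟩

variable {B' B'' : Type*} [CommRing B'] [Algebra R B'] [CommRing B''] [Algebra R B'']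

variable (p φ n) in
/-- The functoriality of the ring of jets. -/
def map (f : B →ₐ[R] B') : JetRing p φ n B →ₐ[R] JetRing p φ n B' :=
  (exists_algHom_of_aeval (C := JetRing p φ n B') (fun u => ⟨fun i => f (u.coord i)⟩)
    (fun u g => by
      ext i
      dsimp only
      rw [coord_aeval, coord_aeval, ← AlgHom.comp_apply, MvPolynomial.comp_aeval]
      congr 2
      funext v
      simp only [coords]
      split_ifs <;> simp)).choose

@[simp]
theorem map_coord (f : B →ₐ[R] B') (u : JetRing p φ n B) (i : Fin (n + 1)) :
    (map p φ n f u).coord i = f (u.coord i) := by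
  rw [map, Exists.choose_spec (p := fun g : JetRing p φ n B →ₐ[R] JetRing p φ n B' =>
    ⇑g = fun u => ⟨fun i => f (u.coord i)⟩)]

theorem map_comp (f : B →ₐ[R] B') (g : B' →ₐ[R] B'') :
    map p φ n (g.comp f) = (map p φ n g).comp (map p φ n f) := by
  refine AlgHom.ext fun u => ?_
  ext i
  simp

theorem proj_comp_map (f : B →ₐ[R] B') :
    (proj p φ n B').comp (map p φ n f) = f.comp (proj p φ n B) := by
  ext u
  simp

end Ring

end JetRing


/-! ### A filtration of the ring of power series -/

section Filtration

variable {p : ℕ} {R : Type*} [CommRing R] {σ : Type*}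

/-- The degree of a monomial in the variables of order zero. -/
def zeroWeight (σ : Type*) : (ℕ × σ →₀ ℕ) →+ ℕ :=
  Finsupp.weight fun v : ℕ × σ => if v.1 = 0 then 1 else 0

theorem zeroWeight_single (v : ℕ × σ) (k : ℕ) :
    zeroWeight σ (Finsupp.single v k) = if v.1 = 0 then k else 0 := by
  simp [zeroWeight, Finsupp.weight_single]

theorem zeroWeight_eq_sum (e : ℕ × σ →₀ ℕ) :
    zeroWeight σ e = ∑ v ∈ e.support, e v * if v.1 = 0 then 1 else 0 := by
  simp [zeroWeight, Finsupp.weight_apply, Finsupp.sum]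

theorem zeroWeight_eq_zero {e : ℕ × σ →₀ ℕ} (h : ∀ s, e (0, s) = 0) : zeroWeight σ e = 0 := by
  rw [zeroWeight_eq_sum]
  refine Finset.sum_eq_zero fun v _ => ?_
  obtain ⟨k, s⟩ := v
  split_ifs with hk
  · obtain rfl : k = 0 := hk
    simp [h]
  · simp

variable (p R σ) in
/-- The `N`-th power of the ideal generated by `p` and the variables of order zero
(if there are finitely many of the latter). -/
def jetFiltration (N : ℕ) : Ideal (MvPowerSeries (ℕ × σ) R) where
  carrier := {f | ∀ e, (p : R) ^ (N - zeroWeight σ e) ∣ MvPowerSeries.coeff e f}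
  add_mem' hf hg e := by rw [map_add]; exact dvd_add (hf e) (hg e)
  zero_mem' e := by simp
  smul_mem' c f hf e := by
    classical
    rw [smul_eq_mul, MvPowerSeries.coeff_mul]
    refine Finset.dvd_sum fun d hd => Dvd.dvd.mul_left ((pow_dvd_pow _ ?_).trans (hf d.2)) _
    rw [← Finset.HasAntidiagonal.mem_antidiagonal.mp hd, map_add]
    omega

theorem mul_mem_jetFiltration {N M : ℕ} {f g : MvPowerSeries (ℕ × σ) R}
    (hf : f ∈ jetFiltration p R σ N) (hg : g ∈ jetFiltration p R σ M) :
    f * g ∈ jetFiltration p R σ (N + M) := by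
  classical
  intro e
  rw [MvPowerSeries.coeff_mul]
  refine Finset.dvd_sum fun d hd => ?_
  refine Dvd.dvd.trans ?_ (mul_dvd_mul (hf d.1) (hg d.2))
  rw [← pow_add]
  apply pow_dvd_pow
  rw [← Finset.HasAntidiagonal.mem_antidiagonal.mp hd, map_add]
  omega

theorem mem_jetFiltration_zero (f : MvPowerSeries (ℕ × σ) R) : f ∈ jetFiltration p R σ 0 :=
  fun e => by simp

theorem pow_mem_jetFiltration {N : ℕ} {f : MvPowerSeries (ℕ × σ) R}
    (hf : f ∈ jetFiltration p R σ N) (k : ℕ) : f ^ k ∈ jetFiltration p R σ (k * N) := by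
  induction k with
  | zero => rw [zero_mul]; exact mem_jetFiltration_zero _
  | succ k ih =>
    rw [pow_succ, Nat.succ_mul]
    exact mul_mem_jetFiltration ih hf

theorem prod_mem_jetFiltration {ι : Type*} (s : Finset ι) (N : ι → ℕ)
    (f : ι → MvPowerSeries (ℕ × σ) R) (hf : ∀ i, f i ∈ jetFiltration p R σ (N i)) :
    ∏ i ∈ s, f i ∈ jetFiltration p R σ (∑ i ∈ s, N i) := by
  classical
  induction s using Finset.induction_on with
  | empty => exact mem_jetFiltration_zero _
  | insert i s hi ih =>
    rw [Finset.prod_insert hi, Finset.sum_insert hi]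
    exact mul_mem_jetFiltration (hf i) ih

theorem natCast_mul_mem_jetFiltration_one (f : MvPowerSeries (ℕ × σ) R) :
    (p : MvPowerSeries (ℕ × σ) R) * f ∈ jetFiltration p R σ 1 := by
  intro e
  rw [← nsmul_eq_mul, map_nsmul, nsmul_eq_mul]
  refine (pow_dvd_pow (p : R) (Nat.sub_le 1 _)).trans ?_
  rw [pow_one]
  exact dvd_mul_right _ _

theorem X_mem_jetFiltration_one (s : σ) :
    (MvPowerSeries.X (0, s) : MvPowerSeries (ℕ × σ) R) ∈ jetFiltration p R σ 1 := by
  classical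
  intro e
  rw [MvPowerSeries.coeff_X]
  split_ifs with he
  · rw [he, zeroWeight_single]
    simp
  · exact dvd_zero _

theorem psVar_mem_jetFiltration (hp : p.Prime) (v : ℕ × σ) :
    psVar p R σ v ∈ jetFiltration p R σ (if v.1 = 0 then 1 else 0) := by
  split_ifs with h
  · obtain ⟨k, s⟩ := v
    obtain rfl : k = 0 := h
    exact add_mem (Ideal.pow_mem_of_mem _ (X_mem_jetFiltration_one s) _ hp.pos)
      (natCast_mul_mem_jetFiltration_one _)
  · exact mem_jetFiltration_zero _

theorem psPhi_eq_subst [hp : Fact p.Prime] (φ : R →+* R) (F : MvPowerSeries (ℕ × σ) R) :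
    psPhi p φ σ F = MvPowerSeries.subst (psVar p R σ) (MvPowerSeries.map φ F) := by
  simp [psPhi, MvPowerSeries.coe_substAlgHom]

/-- Since `φ` fixes `p` and sends `T` to `T^p + p T'`, it maps both generators of `(p, T)` back into
that ideal. For a monomial of weight `w(d)` the coefficient contributes `N - w(d)` factors `p` and
the substituted monomial `w(d) - w(e)`. -/
theorem psPhi_mem_jetFiltration [hp : Fact p.Prime] (φ : R →+* R) {N : ℕ}
    {F : MvPowerSeries (ℕ × σ) R} (hF : F ∈ jetFiltration p R σ N) :
    psPhi p φ σ F ∈ jetFiltration p R σ N := by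
  intro e
  rw [psPhi_eq_subst, MvPowerSeries.coeff_subst (hasSubst_psVar hp.out R σ)]
  refine finsum_induction (fun x => (p : R) ^ (N - zeroWeight σ e) ∣ x) (dvd_zero _)
    (fun _ _ => dvd_add) fun d => ?_
  have h1 : (p : R) ^ (N - zeroWeight σ d) ∣ MvPowerSeries.coeff d (MvPowerSeries.map φ F) := by
    simpa using map_dvd φ (hF d)
  have h2 : (d.prod fun v k => psVar p R σ v ^ k) ∈ jetFiltration p R σ (zeroWeight σ d) := by
    rw [zeroWeight_eq_sum]
    exact prod_mem_jetFiltration _ _ _ fun v =>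
      pow_mem_jetFiltration (psVar_mem_jetFiltration hp.out v) _
  rw [smul_eq_mul]
  refine Dvd.dvd.trans ?_ (mul_dvd_mul h1 (h2 e))
  rw [← pow_add]
  exact pow_dvd_pow _ (by omega)

theorem mvPolynomial_coe_natCast (k : ℕ) :
    ((k : MvPolynomial σ R) : MvPowerSeries σ R) = k :=
  map_natCast MvPolynomial.coeToMvPowerSeries.ringHom k

theorem psPhi_coe (φ : R →+* R) [hp : Fact p.Prime] (f : MvPolynomial (ℕ × σ) R) :
    psPhi p φ σ (f : MvPowerSeries (ℕ × σ) R) = (polyPhi p φ σ f : MvPolynomial (ℕ × σ) R) := by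
  rw [psPhi_eq_subst]
  induction f using MvPolynomial.induction_on with
  | C a => simp
  | add f g hf hg =>
    simp only [MvPolynomial.coe_add, map_add, MvPowerSeries.subst_add (hasSubst_psVar hp.out R σ),
      hf, hg]
  | mul_X f v hf =>
    simp only [MvPolynomial.coe_mul, map_mul, MvPowerSeries.subst_mul (hasSubst_psVar hp.out R σ),
      mvPolynomial_coe_natCast,
      hf, MvPolynomial.coe_X, MvPowerSeries.map_X,
      MvPowerSeries.subst_X (hasSubst_psVar hp.out R σ), polyPhi_X, psVar, MvPolynomial.coe_add,
      MvPolynomial.coe_pow]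

theorem zeroWeight_embDomain (e : σ →₀ ℕ) (ι : σ ↪ ℕ × σ) (hι : ∀ s, ι s = (0, s)) :
    zeroWeight σ (e.embDomain ι) = e.degree := by
  rw [zeroWeight_eq_sum, Finsupp.support_embDomain, Finset.sum_map, Finsupp.degree]
  refine Finset.sum_congr rfl fun s _ => ?_
  rw [Finsupp.embDomain_apply_self, hι]
  simp

theorem rename_sub_orderZero_mem_jetFiltration [Finite σ] (p : ℕ) {N : ℕ} (F : MvPowerSeries σ R)
    (f : MvPolynomial σ R) (h : ∀ e : σ →₀ ℕ, e.degree < N → MvPowerSeries.coeff e F = f.coeff e) :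
    MvPowerSeries.rename (fun s : σ => ((0 : ℕ), s)) F - ((orderZero R f : MvPolynomial (ℕ × σ) R) : MvPowerSeries (ℕ × σ) R) ∈
      jetFiltration p R σ N := by
  have hinj : Function.Injective (fun s : σ => ((0 : ℕ), s)) := fun _ _ h => (Prod.ext_iff.mp h).2
  let ι : σ ↪ ℕ × σ := ⟨_, hinj⟩
  have hr : MvPowerSeries.rename (fun s : σ => ((0 : ℕ), s)) (f : MvPowerSeries σ R) =
      (orderZero R f : MvPolynomial (ℕ × σ) R) := MvPowerSeries.rename_coe _ f
  rw [← hr, ← map_sub]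
  intro e
  by_cases he : e ∈ Set.range (Finsupp.embDomain (M := ℕ) ι)
  · obtain ⟨e, rfl⟩ := he
    have := MvPowerSeries.coeff_embDomain_rename ι (F - (f : MvPowerSeries σ R)) e
    rw [zeroWeight_embDomain _ _ fun _ => rfl]
    change _ ∣ MvPowerSeries.coeff _ (MvPowerSeries.rename ι ((F : MvPowerSeries σ R) - (f : MvPowerSeries σ R)))
    rw [this]
    by_cases hN : e.degree < N
    · simp [h e hN]
    · simp [Nat.sub_eq_zero_of_le (not_lt.mp hN)]
  · rw [MvPowerSeries.coeff_rename_eq_zero]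
    · exact dvd_zero _
    · rintro ⟨d, hd⟩
      exact he ⟨d, by rw [← hd, Finsupp.embDomain_eq_mapDomain]; rfl⟩

variable {φ : R →+* R} [hφ : IsFrobeniusLift p φ]

theorem pow_dvd_of_pow_succ_dvd_natCast_mul (φ : R →+* R) [hφ : IsFrobeniusLift p φ] {k : ℕ} {c : R}
    (h : (p : R) ^ (k + 1) ∣ p * c) : (p : R) ^ k ∣ c := by
  obtain ⟨a, ha⟩ := h
  refine ⟨a, hφ.regular _ _ ?_⟩
  rw [ha]
  ring

/-- Cancelling one `p` costs one step of the filtration. If the weight of `e` is at least `N - 1`,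
the conclusion is empty and no cancellation is needed. -/
theorem mem_jetFiltration_of_natCast_mul_mem (φ : R →+* R) [hφ : IsFrobeniusLift p φ] {N : ℕ} {f : MvPowerSeries (ℕ × σ) R}
    (hf : (p : MvPowerSeries (ℕ × σ) R) * f ∈ jetFiltration p R σ N) :
    f ∈ jetFiltration p R σ (N - 1) := by
  intro e
  have h := hf e
  rw [← nsmul_eq_mul, map_nsmul, nsmul_eq_mul] at h
  by_cases hN : N - 1 ≤ zeroWeight σ e
  · simp [Nat.sub_eq_zero_of_le hN]
  · rw [show N - zeroWeight σ e = (N - 1 - zeroWeight σ e) + 1 by omega] at h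
    exact pow_dvd_of_pow_succ_dvd_natCast_mul φ h

theorem natCast_mul_psDelta [Fact p.Prime] (F : MvPowerSeries (ℕ × σ) R) :
    (p : MvPowerSeries (ℕ × σ) R) * psDelta p φ F = psPhi p φ σ F - F ^ p :=
  mul_psDelta p hφ.dvd F

/-- Although `δ` is not additive, `p (δF - δG) = φ(F - G) - (F^p - G^p)`. Both terms lie in step
`N`, because `F - G` divides `F^p - G^p`; then `p` is cancelled. -/
theorem psDelta_sub_mem_jetFiltration [Fact p.Prime] {N : ℕ} {F G : MvPowerSeries (ℕ × σ) R}
    (h : F - G ∈ jetFiltration p R σ N) :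
    psDelta p φ F - psDelta p φ G ∈ jetFiltration p R σ (N - 1) := by
  apply mem_jetFiltration_of_natCast_mul_mem φ
  rw [mul_sub, natCast_mul_psDelta, natCast_mul_psDelta, sub_sub_sub_comm, ← map_sub]
  refine sub_mem (psPhi_mem_jetFiltration φ h) ?_
  exact Ideal.mem_of_dvd _ (sub_dvd_pow_sub_pow F G p) h

theorem iterate_psDelta_sub_mem_jetFiltration [Fact p.Prime] {N : ℕ}
    {F G : MvPowerSeries (ℕ × σ) R} (h : F - G ∈ jetFiltration p R σ N) (i : ℕ) :
    (psDelta p φ)^[i] F - (psDelta p φ)^[i] G ∈ jetFiltration p R σ (N - i) := by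
  induction i with
  | zero => exact h
  | succ i ih =>
    rw [Function.iterate_succ_apply', Function.iterate_succ_apply']
    exact psDelta_sub_mem_jetFiltration ih

theorem psDelta_coe [Fact p.Prime] (f : MvPolynomial (ℕ × σ) R) :
    psDelta p φ (f : MvPowerSeries (ℕ × σ) R) = (polyDelta p φ f : MvPolynomial (ℕ × σ) R) := by
  have h : (p : MvPowerSeries (ℕ × σ) R) * psDelta p φ (f : MvPowerSeries (ℕ × σ) R) =
      (p : MvPowerSeries (ℕ × σ) R) * (polyDelta p φ f : MvPolynomial (ℕ × σ) R) := by
    rw [natCast_mul_psDelta, psPhi_coe, ← mvPolynomial_coe_natCast, ← MvPolynomial.coe_mul,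
      natCast_mul_polyDelta, eq_comm, ← MvPolynomial.coe_pow]
    exact (map_sub (MvPolynomial.coeToMvPowerSeries.ringHom (R := R) (σ := ℕ × σ)) _ _).symm
  ext e
  have h := congrArg (MvPowerSeries.coeff e) h
  rw [← nsmul_eq_mul, ← nsmul_eq_mul, map_nsmul, map_nsmul, nsmul_eq_mul, nsmul_eq_mul] at h
  exact hφ.regular _ _ h

theorem iterate_psDelta_coe [Fact p.Prime] (i : ℕ) (f : MvPolynomial (ℕ × σ) R) :
    (psDelta p φ)^[i] (f : MvPowerSeries (ℕ × σ) R) =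
      ((polyDelta p φ)^[i] f : MvPolynomial (ℕ × σ) R) := by
  induction i with
  | zero => rfl
  | succ i ih => rw [Function.iterate_succ_apply', Function.iterate_succ_apply', ih, psDelta_coe]

/-- The basic approximation: after `T = 0`, the series `δ^i F` modulo `p ^ (N - i)` depends only on
the terms of `F` of degree below `N`. Monomials free of `T` have weight zero, so there the
filtration is exactly divisibility. -/
theorem iterate_psDelta_coeff_sub_dvd [Finite σ] [Fact p.Prime] {N : ℕ} (F : MvPowerSeries σ R)
    (f : MvPolynomial σ R) (h : ∀ e : σ →₀ ℕ, e.degree < N → MvPowerSeries.coeff e F = f.coeff e)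
    (i : ℕ) {e : ℕ × σ →₀ ℕ} (he : ∀ s, e (0, s) = 0) :
    (p : R) ^ (N - i) ∣ MvPowerSeries.coeff e
        ((psDelta p φ)^[i] (MvPowerSeries.rename (fun s : σ => ((0 : ℕ), s)) F)) -
      ((polyDelta p φ)^[i] (orderZero R f)).coeff e := by
  have h2 := iterate_psDelta_sub_mem_jetFiltration (φ := φ)
    (rename_sub_orderZero_mem_jetFiltration p F f h) i e
  rwa [zeroWeight_eq_zero he, Nat.sub_zero, map_sub, iterate_psDelta_coe,
    MvPolynomial.coeff_coe] at h2

theorem iterate_polyDelta_zero (i : ℕ) :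
    (polyDelta p φ)^[i] (0 : MvPolynomial (ℕ × σ) R) = 0 := by
  induction i with
  | zero => rfl
  | succ i ih =>
    rw [Function.iterate_succ_apply', ih]
    apply polyDelta_eq_of_mul_eq
    simp [hφ.prime.ne_zero]

theorem iterate_polyDelta_coeff_dvd [Finite σ] {N : ℕ} (f : MvPolynomial σ R)
    (h : ∀ e : σ →₀ ℕ, e.degree < N → f.coeff e = 0) (i : ℕ) {e : ℕ × σ →₀ ℕ}
    (he : ∀ s, e (0, s) = 0) :
    (p : R) ^ (N - i) ∣ ((polyDelta p φ)^[i] (orderZero R f)).coeff e := by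
  have : Fact p.Prime := ⟨hφ.prime⟩
  have h' := iterate_psDelta_coeff_sub_dvd (p := p) (φ := φ) (N := N) (f : MvPowerSeries σ R) 0
    (fun e he => by simpa using h e he) i he
  rw [map_zero, iterate_polyDelta_zero, MvPolynomial.coeff_zero, sub_zero] at h'
  have hr : MvPowerSeries.rename (fun s : σ => ((0 : ℕ), s)) (f : MvPowerSeries σ R) =
      (orderZero R f : MvPolynomial (ℕ × σ) R) := MvPowerSeries.rename_coe _ f
  have hrw := iterate_psDelta_coe (p := p) (φ := φ) i (orderZero R f)
  rwa [hr, hrw, MvPolynomial.coeff_coe] at h'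

end Filtration

/-! ### Evaluation of power series at nilpotent jets -/

section EvalSeries

variable {R : Type*} [CommRing R] {B : Type*} [CommRing B] [Algebra R B] {σ : Type*}

theorem evalSeries_congr {F G : MvPowerSeries σ R} {y : σ → B}
    (h : ∀ e : σ →₀ ℕ, algebraMap R B (MvPowerSeries.coeff e F) * (e.prod fun s k => y s ^ k) =
      algebraMap R B (MvPowerSeries.coeff e G) * e.prod fun s k => y s ^ k) :
    evalSeries F y = evalSeries G y :=
  finsum_congr h

theorem evalSeries_coe (f : MvPolynomial σ R) (y : σ → B) :
    evalSeries (f : MvPowerSeries σ R) y = MvPolynomial.aeval y f := by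
  rw [evalSeries, finsum_eq_sum_of_support_subset (s := f.support)]
  · rw [MvPolynomial.aeval_def, MvPolynomial.eval₂_eq]
    rfl
  · intro e he
    rw [Finset.mem_coe, MvPolynomial.mem_support_iff]
    intro h
    apply he
    simp [h]

theorem prod_pow_eq_zero_of_ideal_pow_eq_bot {I : Ideal B} {N : ℕ} (hI : I ^ N = ⊥) {y : σ → B}
    (hy : ∀ s, y s ∈ I) {e : σ →₀ ℕ} (he : N ≤ e.degree) : (e.prod fun s k => y s ^ k) = 0 := by
  have h : (e.prod fun s k => y s ^ k) ∈ I ^ e.degree := by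
    rw [Finsupp.degree_apply, ← Finset.prod_pow_eq_pow_sum]
    exact Ideal.prod_mem_prod fun s _ => Ideal.pow_mem_pow (hy s) _
  simpa [hI] using Ideal.pow_le_pow_right he h

theorem evalSeries_eq_aeval_truncTotal [Finite σ] {I : Ideal B} {N : ℕ} (hI : I ^ N = ⊥)
    (F : MvPowerSeries σ R) {y : σ → B} (hy : ∀ s, y s ∈ I) :
    evalSeries F y = MvPolynomial.aeval y (F.truncTotal N) := by
  rw [← evalSeries_coe]
  refine evalSeries_congr fun e => ?_
  rw [MvPolynomial.coeff_coe]
  by_cases he : e.degree < N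
  · rw [MvPowerSeries.coeff_truncTotal _ he]
  · rw [prod_pow_eq_zero_of_ideal_pow_eq_bot hI hy (not_lt.mp he), mul_zero, mul_zero]

end EvalSeries

namespace JetRing

variable {p : ℕ} {R : Type*} [CommRing R] {φ : R →+* R} {n : ℕ}
  {B : Type*} [CommRing B] [Algebra R B] {σ : Type*}

variable (p φ) in
/-- The series `δ^i F` after setting the variables of order zero equal to zero. -/
def cutSeries [Fact p.Prime] [Finite σ] (F : MvPowerSeries σ R) (i : ℕ) :
    MvPowerSeries (ℕ × σ) R := fun e =>
  open Classical in
  if ∀ s, e (0, s) = 0 then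
    MvPowerSeries.coeff e
      ((psDelta p φ)^[i] (MvPowerSeries.rename (fun s : σ => ((0 : ℕ), s)) F))
  else 0

theorem coeff_cutSeries [Fact p.Prime] [Finite σ] (F : MvPowerSeries σ R) (i : ℕ)
    {e : ℕ × σ →₀ ℕ} (he : ∀ s, e (0, s) = 0) : MvPowerSeries.coeff e (cutSeries p φ F i) =
    MvPowerSeries.coeff e
      ((psDelta p φ)^[i] (MvPowerSeries.rename (fun s : σ => ((0 : ℕ), s)) F)) :=
  if_pos he

variable [hφ : IsFrobeniusLift p φ]

theorem coords_zero {u : σ → JetRing p φ n B} (hu : ∀ s, proj p φ n B (u s) = 0) (s : σ) :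
    coords u (0, s) = 0 := by
  simpa [coords] using hu s

theorem prod_pow_eq_zero_of_ne_zero {b : ℕ × σ → B} (hb : ∀ s, b (0, s) = 0)
    {e : ℕ × σ →₀ ℕ} {s : σ} (he : e (0, s) ≠ 0) : (e.prod fun v k => b v ^ k) = 0 :=
  Finset.prod_eq_zero (Finsupp.mem_support_iff.mpr he) (by simp [hb, he])

@[simp]
theorem coord_zero (i : Fin (n + 1)) : (0 : JetRing p φ n B).coord i = 0 := by
  have h := coord_aeval (Empty.elim : Empty → JetRing p φ n B) (0 : MvPolynomial Empty R) i
  rwa [map_zero, map_zero, iterate_polyDelta_zero, map_zero] at h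

/-- In each coordinate, monomials involving a variable of order zero vanish at `coords u`. The
remaining ones have coefficients divisible by `p ^ (N - i)` with `i ≤ n`, hence by `p ^ m`, which is
zero in `B`. -/
theorem aeval_eq_zero_of_coeff_degree_lt [Finite σ] {m N : ℕ} (hm : (p : B) ^ m = 0)
    (hN : m + n ≤ N) {u : σ → JetRing p φ n B} (hu : ∀ s, proj p φ n B (u s) = 0)
    {f : MvPolynomial σ R} (hf : ∀ e : σ →₀ ℕ, e.degree < N → f.coeff e = 0) :
    MvPolynomial.aeval u f = 0 := by
  have key : ∀ i : Fin (n + 1), MvPolynomial.aeval (coords u)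
      ((polyDelta p φ)^[i] (orderZero R f)) = 0 := by
    intro i
    rw [MvPolynomial.aeval_def, MvPolynomial.eval₂_eq]
    refine Finset.sum_eq_zero fun e _ => ?_
    by_cases he : ∀ s, e (0, s) = 0
    · have h : (p : R) ^ m ∣ _ := (pow_dvd_pow _ (by omega)).trans
        (iterate_polyDelta_coeff_dvd (p := p) (φ := φ) f hf i he)
      have h := map_dvd (algebraMap R B) h
      rw [map_pow, map_natCast, hm, zero_dvd_iff] at h
      rw [h, zero_mul]
    · push Not at he
      obtain ⟨s, hs⟩ := he
      have := prod_pow_eq_zero_of_ne_zero (coords_zero hu) hs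
      rw [Finsupp.prod] at this
      rw [this, mul_zero]
  ext i
  rw [coord_aeval, key, coord_zero]

/-- A product of `m + n` elements of the kernel is the value at them of the monomial `X_1 ⋯
X_{m+n}`, which has no term of smaller degree. -/
theorem ker_proj_pow_eq_bot {m : ℕ} (hm : (p : B) ^ m = 0) :
    RingHom.ker (proj p φ n B) ^ (m + n) = ⊥ := by
  rw [Submodule.pow_eq_span_pow_set, Submodule.span_eq_bot]
  intro x hx
  obtain ⟨f, rfl⟩ := Set.mem_pow.mp hx
  rw [List.prod_ofFn]
  have h := aeval_eq_zero_of_coeff_degree_lt (φ := φ) (n := n) hm le_rfl (σ := Fin (m + n))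
    (u := fun i => (f i : JetRing p φ n B)) (fun i => (f i).2)
    (f := ∏ i, MvPolynomial.X i) ?_
  · simpa using h
  · intro e he
    have : (∏ i : Fin (m + n), (MvPolynomial.X i : MvPolynomial (Fin (m + n)) R)) =
        MvPolynomial.monomial (∑ i, Finsupp.single i 1) 1 := by
      rw [MvPolynomial.monomial_sum_one]
      rfl
    rw [this, MvPolynomial.coeff_monomial, if_neg]
    rintro rfl
    simp [map_sum] at he

theorem isNilpotent_ker_proj (h : IsNilpotent (p : B)) :
    IsNilpotent (RingHom.ker (proj p φ n B)) := by
  obtain ⟨m, hm⟩ := h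
  exact ⟨m + n, ker_proj_pow_eq_bot hm⟩

/-- Modulo `p ^ m` the series agrees, on monomials free of order-zero variables, with `δ^i` of the
truncation of `F` below degree `m + i`, and the latter is a polynomial. -/
theorem isRestricted_cutSeries [Fact p.Prime] [Finite σ] (F : MvPowerSeries σ R) (i : ℕ) :
    IsRestricted p (cutSeries p φ F i) := by
  intro m
  refine Set.Finite.subset
    ((polyDelta p φ)^[i] (orderZero R (F.truncTotal (m + i)))).support.finite_toSet ?_
  intro e he
  rw [Finset.mem_coe, MvPolynomial.mem_support_iff]
  intro h
  apply he
  by_cases h0 : ∀ s, e (0, s) = 0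
  · have := iterate_psDelta_coeff_sub_dvd (p := p) (φ := φ) (N := m + i) F (F.truncTotal (m + i))
      (fun d hd => (MvPowerSeries.coeff_truncTotal _ hd).symm) i h0
    rwa [h, sub_zero, Nat.add_sub_cancel, ← coeff_cutSeries F i h0] at this
  · have : MvPowerSeries.coeff e (cutSeries p φ F i) = 0 := if_neg h0
    rw [this]
    exact dvd_zero _

/-- With `p ^ m = 0` in `B`, truncating `F` below degree `m + n` changes neither side: on the left
because the jets lie in an ideal with zero `(m + n)`-th power, on the right because the coefficients
change by multiples of `p ^ m`. For a polynomial the claim is the definition of evaluation at jets.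
-/
theorem coord_evalSeries [Fact p.Prime] [Finite σ] (hp : IsNilpotent (p : B))
    (F : MvPowerSeries σ R) {u : σ → JetRing p φ n B} (hu : ∀ s, proj p φ n B (u s) = 0)
    (i : Fin (n + 1)) :
    (evalSeries F u).coord i = evalSeries (cutSeries p φ F i) (coords u) := by
  obtain ⟨m, hm⟩ := hp
  rw [evalSeries_eq_aeval_truncTotal (ker_proj_pow_eq_bot (φ := φ) (n := n) hm) F hu, coord_aeval,
    ← evalSeries_coe]
  symm
  refine evalSeries_congr fun e => ?_
  by_cases h0 : ∀ s, e (0, s) = 0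
  · congr 1
    have := iterate_psDelta_coeff_sub_dvd (p := p) (φ := φ) (N := m + n) F (F.truncTotal (m + n))
      (fun d hd => (MvPowerSeries.coeff_truncTotal _ hd).symm) i h0
    rw [← coeff_cutSeries F i h0] at this
    have h := map_dvd (algebraMap R B) ((pow_dvd_pow (p : R) (show m ≤ m + n - i by omega)).trans this)
    rwa [map_pow, map_natCast, hm, zero_dvd_iff, map_sub, sub_eq_zero] at h
  · push Not at h0
    obtain ⟨s, hs⟩ := h0
    rw [prod_pow_eq_zero_of_ne_zero (coords_zero hu) hs, mul_zero, mul_zero]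

end JetRing

theorem kernelSeries_eq_cutSeries (p : ℕ) [Fact p.Prime] {R : Type u} [CommRing R] (φ : R →+* R)
    {d : ℕ} (F : Fin d → MvPowerSeries (Fin d ⊕ Fin d) R) (i : ℕ) (j : Fin d) :
    kernelSeries p φ F i j = JetRing.cutSeries p φ (F j) i := by
  funext e
  unfold kernelSeries JetRing.cutSeries
  congr


/-! ### The universal property of the algebra of jets -/

section Universal

variable {p : ℕ} {R : Type u} [CommRing R] {φ : R →+* R} {n : ℕ} {A : Type u} [CommRing A]
  {ι : R →+* A}

/-- The relation `r - x_{ι r}` of order zero lies in the ideal. This is why a condition on the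
order-zero coordinates alone forces `R`-linearity. -/
theorem mk_C_eq_jetCoord (r : R) :
    Ideal.Quotient.mk (jetIdeal p φ n ι (fun a : A => a)) (MvPolynomial.C r) =
      jetCoord p φ n ι 0 (ι r) := by
  rw [jetCoord, ← sub_eq_zero, ← map_sub, Ideal.Quotient.eq_zero_iff_mem]
  refine Ideal.subset_span ⟨0, Nat.zero_le _, MvPolynomial.C r - MvPolynomial.X (ι r), by simp, ?_⟩
  simp

theorem jetAlg_ringHom_ext {C : Type*} [CommRing C] {θ θ' : JetAlg p φ n ι →+* C}
    (h : ∀ i a, θ (jetCoord p φ n ι i a) = θ' (jetCoord p φ n ι i a)) : θ = θ' := by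
  refine Ideal.Quotient.ringHom_ext (MvPolynomial.ringHom_ext (fun r => ?_) fun v => h v.1 v.2)
  simpa [mk_C_eq_jetCoord] using h 0 (ι r)

variable {C : Type*} [CommRing C] [Algebra R C]

theorem aeval_coords_rename {σ : Type*} (u : σ → JetRing p φ n C)
    (g : MvPolynomial (Fin (n + 1) × σ) R) :
    MvPolynomial.aeval (JetRing.coords u)
        (MvPolynomial.rename (fun v : Fin (n + 1) × σ => ((v.1 : ℕ), v.2)) g) =
      MvPolynomial.aeval (fun v : Fin (n + 1) × σ => (u v.2).coord v.1) g := by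
  rw [MvPolynomial.aeval_rename]
  congr 1
  congr 1
  funext v
  simp [JetRing.coords, Nat.not_lt.mpr (Nat.le_of_lt_succ v.1.2), -not_lt]

variable [hφ : IsFrobeniusLift p φ]

/-- The homomorphism from the algebra of jets of `A` to `C` that corresponds to a homomorphism
from `A` to the ring of jets with coordinates in `C`. -/
def jetAlgLift (h : A →+* JetRing p φ n C) (hh : ∀ r, h (ι r) = algebraMap R _ r) :
    JetAlg p φ n ι →+* C :=
  Ideal.Quotient.lift _
    (MvPolynomial.aeval fun v : Fin (n + 1) × A => (h v.2).coord v.1).toRingHom <| by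
  change ∀ x ∈ jetIdeal p φ n ι (fun a : A => a), x ∈ RingHom.ker
    (MvPolynomial.aeval (R := R) fun v : Fin (n + 1) × A => (h v.2).coord v.1).toRingHom
  rw [← SetLike.le_def, jetIdeal, Ideal.span_le]
  rintro g ⟨i, hi, f, hf, hg⟩
  change MvPolynomial.aeval (fun v : Fin (n + 1) × A => (h v.2).coord v.1) g = 0
  rw [← aeval_coords_rename (fun a => h a), hg]
  have h1 := JetRing.coord_aeval (fun a => h a) f ⟨i, Nat.lt_succ_of_le hi⟩
  have h2 : MvPolynomial.aeval (fun a => h a) f = h (MvPolynomial.eval₂Hom ι (fun a : A => a) f) := by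
    have : (MvPolynomial.aeval (fun a => h a) : MvPolynomial A R →ₐ[R] _).toRingHom =
        h.comp (MvPolynomial.eval₂Hom ι (fun a : A => a)) := by
      refine MvPolynomial.ringHom_ext (fun r => ?_) fun a => ?_
      · simp [hh]
      · simp
    exact congrArg (fun k : MvPolynomial A R →+* JetRing p φ n C => k f) this
  rw [h2, hf, map_zero, JetRing.coord_zero] at h1
  exact h1.symm

@[simp]
theorem jetAlgLift_jetCoord (h : A →+* JetRing p φ n C) (hh : ∀ r, h (ι r) = algebraMap R _ r)
    (i : Fin (n + 1)) (a : A) : jetAlgLift h hh (jetCoord p φ n ι i a) = (h a).coord i := by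
  simp [jetAlgLift, jetCoord]

/-- The `i`-th coordinate of the value is the image under `θ` of the class of `δ^i f`, which is zero
in the algebra of jets. Thus all polynomial relations of `A` survive in the ring of jets; applied to
the relations for sums and products this yields `jetRingHom`. -/
theorem aeval_jetCoord_eq_zero (θ : JetAlg p φ n ι →+* C)
    (hθ : ∀ r, θ (jetCoord p φ n ι 0 (ι r)) = algebraMap R C r) {f : MvPolynomial A R}
    (hf : MvPolynomial.eval₂Hom ι (fun a : A => a) f = 0) :
    MvPolynomial.aeval (fun a => (⟨fun i => θ (jetCoord p φ n ι i a)⟩ : JetRing p φ n C)) f = 0 := by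
  ext i
  rw [JetRing.coord_aeval, JetRing.coord_zero]
  have hs := iterate_polyDelta_mem_supported (p := p) (φ := φ) i f
  rw [MvPolynomial.mem_supported] at hs
  -- Only orders at most `i ≤ n` occur in `δ^i f`, so it comes from the truncated polynomial ring in
  -- which `jetIdeal` lives.
  obtain ⟨g, hg⟩ := MvPolynomial.exists_rename_eq_of_vars_subset_range
    ((polyDelta p φ)^[i] (orderZero R f))
    (fun v : Fin (n + 1) × A => ((v.1 : ℕ), v.2))
    (fun v w h => Prod.ext (Fin.ext (Prod.ext_iff.mp h).1) (Prod.ext_iff.mp h).2)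
    (fun v hv => ⟨(⟨v.1, lt_of_le_of_lt (hs hv) i.2⟩, v.2), rfl⟩)
  rw [← hg, aeval_coords_rename]
  have hg' : Ideal.Quotient.mk (jetIdeal p φ n ι (fun a : A => a)) g = 0 :=
    Ideal.Quotient.eq_zero_iff_mem.mpr (Ideal.subset_span ⟨i, by omega, f, hf, hg⟩)
  have : (MvPolynomial.aeval fun v : Fin (n + 1) × A => θ (jetCoord p φ n ι v.1 v.2)).toRingHom =
      θ.comp (Ideal.Quotient.mk (jetIdeal p φ n ι (fun a : A => a))) := by
    refine MvPolynomial.ringHom_ext (fun r => ?_) fun a => ?_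
    · simp [mk_C_eq_jetCoord, hθ]
    · simp [jetCoord]
  have h := congrArg (fun k : MvPolynomial (Fin (n + 1) × A) R →+* C => k g) this
  refine h.trans ?_
  rw [RingHom.comp_apply, hg', map_zero]

/-- The homomorphism from `A` to the ring of jets with coordinates in `C` that corresponds to a
homomorphism from the algebra of jets of `A` to `C`. -/
def jetRingHom (θ : JetAlg p φ n ι →+* C)
    (hθ : ∀ r, θ (jetCoord p φ n ι 0 (ι r)) = algebraMap R C r) : A →+* JetRing p φ n C where
  toFun a := ⟨fun i => θ (jetCoord p φ n ι i a)⟩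
  map_one' := by
    have h := aeval_jetCoord_eq_zero θ hθ (f := MvPolynomial.X 1 - 1) (by simp)
    rwa [map_sub, map_one, MvPolynomial.aeval_X, sub_eq_zero] at h
  map_zero' := by
    have h := aeval_jetCoord_eq_zero θ hθ (f := MvPolynomial.X 0) (by simp)
    rwa [MvPolynomial.aeval_X] at h
  map_mul' a b := by
    have h := aeval_jetCoord_eq_zero θ hθ
      (f := MvPolynomial.X (a * b) - MvPolynomial.X a * MvPolynomial.X b) (by simp)
    rwa [map_sub, map_mul, MvPolynomial.aeval_X, MvPolynomial.aeval_X, MvPolynomial.aeval_X,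
      sub_eq_zero] at h
  map_add' a b := by
    have h := aeval_jetCoord_eq_zero θ hθ
      (f := MvPolynomial.X (a + b) - (MvPolynomial.X a + MvPolynomial.X b)) (by simp)
    rwa [map_sub, map_add, MvPolynomial.aeval_X, MvPolynomial.aeval_X, MvPolynomial.aeval_X,
      sub_eq_zero] at h

theorem jetRingHom_algebraMap (θ : JetAlg p φ n ι →+* C)
    (hθ : ∀ r, θ (jetCoord p φ n ι 0 (ι r)) = algebraMap R C r) (r : R) :
    jetRingHom θ hθ (ι r) = algebraMap R _ r := by
  have h := aeval_jetCoord_eq_zero θ hθ (f := MvPolynomial.X (ι r) - MvPolynomial.C r) (by simp)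
  rwa [map_sub, MvPolynomial.aeval_X, MvPolynomial.aeval_C, sub_eq_zero] at h

end Universal


/-! ### Étale coordinates and infinitesimal lifting -/

section EtaleLift

variable {R : Type u} [CommRing R] {A : Type u} [CommRing A] {ι : R →+* A} {d : ℕ}
  {g : MvPolynomial (Fin d) R →+* A}

/-- Prescribing the values `t` of the coordinates makes `B` and `C` algebras over the polynomial
ring. The lift then exists by formal smoothness of `A` over it and is unique by formal
unramifiedness. -/
theorem existsUnique_lift_of_etale (hg : g.comp MvPolynomial.C = ι) (he : g.Etale)
    {B C : Type u} [CommRing B] [CommRing C] [Algebra R B] [Algebra R C] (q : B →ₐ[R] C)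
    (hq : Function.Surjective q) (hq' : IsNilpotent (RingHom.ker q)) (α : A →+* C)
    (hα : ∀ r, α (ι r) = algebraMap R C r) (t : Fin d → B)
    (ht : ∀ j, q (t j) = α (g (MvPolynomial.X j))) :
    ∃! h : A →+* B, (∀ r, h (ι r) = algebraMap R B r) ∧ (∀ a, q (h a) = α a) ∧
      ∀ j, h (g (MvPolynomial.X j)) = t j := by
  have hgC : ∀ r, g (MvPolynomial.C r) = ι r := fun r => congrArg (fun k : R →+* A => k r) hg
  let := g.toAlgebra
  let : Algebra (MvPolynomial (Fin d) R) B := (MvPolynomial.aeval t).toRingHom.toAlgebra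
  let : Algebra (MvPolynomial (Fin d) R) C :=
    (q.toRingHom.comp (MvPolynomial.aeval t).toRingHom).toAlgebra
  have : Algebra.Etale (MvPolynomial (Fin d) R) A := he
  have hαg : α.comp g = q.toRingHom.comp (MvPolynomial.aeval t).toRingHom := by
    refine MvPolynomial.ringHom_ext (fun r => ?_) fun j => ?_
    · simp [hgC, hα]
    · simp [ht]
  let q' : B →ₐ[MvPolynomial (Fin d) R] C := ⟨q.toRingHom, fun _ => rfl⟩
  let α' : A →ₐ[MvPolynomial (Fin d) R] C :=
    ⟨α, fun s => congrArg (fun k : MvPolynomial (Fin d) R →+* C => k s) hαg⟩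
  have hq'' : IsNilpotent (RingHom.ker q'.toRingHom) := hq'
  refine ⟨(Algebra.FormallySmooth.liftOfSurjective α' q' hq hq'').toRingHom, ⟨fun r => ?_,
    fun a => ?_, fun j => ?_⟩, ?_⟩
  · have := (Algebra.FormallySmooth.liftOfSurjective α' q' hq hq'').commutes (MvPolynomial.C r)
    rw [← hgC]
    refine this.trans ?_
    exact MvPolynomial.aeval_C _ _
  · exact Algebra.FormallySmooth.liftOfSurjective_apply α' q' hq hq'' a
  · have := (Algebra.FormallySmooth.liftOfSurjective α' q' hq hq'').commutes (MvPolynomial.X j)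
    refine this.trans ?_
    exact MvPolynomial.aeval_X _ _
  · rintro h ⟨h1, h2, h3⟩
    have hh : h.comp g = (MvPolynomial.aeval t : MvPolynomial (Fin d) R →ₐ[R] B).toRingHom := by
      refine MvPolynomial.ringHom_ext (fun r => ?_) fun j => ?_
      · simp [hgC, h1]
      · simp [h3]
    let h' : A →ₐ[MvPolynomial (Fin d) R] B :=
      ⟨h, fun s => congrArg (fun k : MvPolynomial (Fin d) R →+* B => k s) hh⟩
    have : h' = Algebra.FormallySmooth.liftOfSurjective α' q' hq hq'' := by
      refine Algebra.FormallyUnramified.ext' (q' : B →+* C) hq'' _ _ fun a => ?_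
      exact (h2 a).trans (Algebra.FormallySmooth.liftOfSurjective_apply α' q' hq hq'' a).symm
    exact congrArg (fun k : A →ₐ[MvPolynomial (Fin d) R] B => k.toRingHom) this

theorem finiteType_of_etale (hg : g.comp MvPolynomial.C = ι) (he : g.Etale) : ι.FiniteType := by
  rw [← hg]
  refine RingHom.FiniteType.comp ?_ ?_
  · exact RingHom.FiniteType.of_finitePresentation
      (RingHom.Etale.iff_flat_and_formallyUnramified.mp he).2.2
  · exact RingHom.finiteType_algebraMap.mpr
      (inferInstance : Algebra.FiniteType R (MvPolynomial (Fin d) R))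

/-- The nilradical need not be nilpotent, so `existsUnique_lift_of_etale` is applied modulo suitable
finitely generated subideals, which are nilpotent. -/
theorem existsUnique_lift_nil_of_etale (hg : g.comp MvPolynomial.C = ι) (he : g.Etale)
    (ε : A →+* R) (hε : ∀ r, ε (ι r) = r) {B : Type u} [CommRing B] [Algebra R B]
    (t : Fin d → nilradical B) :
    ∃! h : A →+* B, (∀ r, h (ι r) = algebraMap R B r) ∧
      (∀ a, h a - algebraMap R B (ε a) ∈ nilradical B) ∧
      ∀ j, h (g (MvPolynomial.X j) - ι (ε (g (MvPolynomial.X j)))) = t j := by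
  let t' : Fin d → B := fun j => t j + algebraMap R B (ε (g (MvPolynomial.X j)))
  have lift : ∀ I : Ideal B, I.FG → I ≤ nilradical B → ∀ α : A →+* B ⧸ I,
      (∀ r, α (ι r) = algebraMap R (B ⧸ I) r) →
      (∀ j, Ideal.Quotient.mk I (t' j) = α (g (MvPolynomial.X j))) →
      ∃! h : A →+* B, (∀ r, h (ι r) = algebraMap R B r) ∧
        (∀ a, Ideal.Quotient.mkₐ R I (h a) = α a) ∧ ∀ j, h (g (MvPolynomial.X j)) = t' j := by
    intro I hI hI' α hα hα'
    refine existsUnique_lift_of_etale hg he (Ideal.Quotient.mkₐ R I)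
      (Ideal.Quotient.mkₐ_surjective R I) ?_ α hα t' hα'
    have : RingHom.ker (Ideal.Quotient.mkₐ R I) = I := Ideal.Quotient.mkₐ_ker R I
    rw [this]
    exact hI.isNilpotent_iff_le_nilradical.mpr hI'
  have ht' : ∀ (h : A →+* B) (_ : ∀ r, h (ι r) = algebraMap R B r) (j : Fin d),
      h (g (MvPolynomial.X j) - ι (ε (g (MvPolynomial.X j)))) = t j ↔
        h (g (MvPolynomial.X j)) = t' j := by
    intro h hh j
    rw [map_sub, hh, sub_eq_iff_eq_add]
  -- Existence: modulo the ideal generated by the finitely many `t j`, the required homomorphism is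
  -- the unit section `ε` followed by the structure map.
  obtain ⟨h, ⟨h1, h2, h3⟩, -⟩ := lift (Ideal.span (Set.range fun j => (t j : B)))
    ⟨(Set.finite_range fun j => (t j : B)).toFinset, by simp⟩ (Ideal.span_le.mpr (by
      rintro _ ⟨j, rfl⟩
      exact (t j).2)) ((Ideal.Quotient.mk _).comp ((algebraMap R B).comp ε)) (fun r => by
      simp only [RingHom.comp_apply, hε]
      rfl) (fun j => by
      simp only [t', RingHom.comp_apply, map_add]
      rw [add_eq_right]
      exact Ideal.Quotient.eq_zero_iff_mem.mpr (Ideal.subset_span ⟨j, rfl⟩))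
  refine ⟨h, ⟨h1, fun a => ?_, fun j => (ht' h h1 j).mpr (h3 j)⟩, ?_⟩
  · have h2a : Ideal.Quotient.mk _ (h a) = Ideal.Quotient.mk _ (algebraMap R B (ε a)) := h2 a
    have := Ideal.Quotient.eq.mp h2a
    refine Ideal.span_le.mpr ?_ this
    rintro _ ⟨j, rfl⟩
    exact (t j).2
  · rintro h' ⟨h1', h2', h3'⟩
    let := ι.toAlgebra
    have hft : Algebra.FiniteType R A := finiteType_of_etale hg he
    obtain ⟨S, hS⟩ := hft.out
    -- Uniqueness: two solutions agree modulo the ideal generated by their differences on finitely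
    -- many algebra generators of `A`. This ideal is finitely generated and nil, so unique lifting
    -- applies to it.
    let I : Ideal B := Ideal.span ((fun a => h' a - h a) '' S)
    have hI : I ≤ nilradical B := by
      refine Ideal.span_le.mpr ?_
      rintro _ ⟨a, -, rfl⟩
      have h2a : h a - algebraMap R B (ε a) ∈ nilradical B := by
        have h2a : Ideal.Quotient.mk _ (h a) = Ideal.Quotient.mk _ (algebraMap R B (ε a)) := h2 a
        have := Ideal.Quotient.eq.mp h2a
        refine Ideal.span_le.mpr ?_ this
        rintro _ ⟨j, rfl⟩
        exact (t j).2
      have := sub_mem (h2' a) h2a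
      rwa [sub_sub_sub_cancel_right] at this
    have hfg : I.FG := ⟨(S.finite_toSet.image fun a => h' a - h a).toFinset, by simp [I]⟩
    let k : A →ₐ[R] B ⧸ I := ⟨(Ideal.Quotient.mk I).comp h, fun r => by
      change Ideal.Quotient.mk I (h (ι r)) = _
      rw [h1]
      rfl⟩
    let k' : A →ₐ[R] B ⧸ I := ⟨(Ideal.Quotient.mk I).comp h', fun r => by
      change Ideal.Quotient.mk I (h' (ι r)) = _
      rw [h1']
      rfl⟩
    have hk : k' = k := by
      refine AlgHom.ext_of_adjoin_eq_top hS fun a ha => ?_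
      exact Ideal.Quotient.eq.mpr (Ideal.subset_span ⟨a, ha, rfl⟩)
    refine (lift I hfg hI k.toRingHom k.commutes fun j => ?_).unique ⟨h1', fun a => ?_, ?_⟩
      ⟨h1, fun a => rfl, h3⟩
    · rw [← h3 j]
      rfl
    · exact congrArg (fun f : A →ₐ[R] B ⧸ I => f a) hk
    · exact fun j => (ht' h' h1' j).mp (h3' j)

end EtaleLift

/-- Smoothness gives standard smooth charts over affine opens `V` of `Spec R`. Composing with the
étale map `R → Γ(V)`, standard smooth of relative dimension zero, makes the chart standard smooth of
dimension `d` over `R` itself. -/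
theorem exists_etale_coordinates {R : Type u} [CommRing R] {d : ℕ}
    (X : Over (Spec (CommRingCat.of R))) (hX : SmoothOfRelativeDimension d X.hom) (x : X.left) :
    ∃ U : X.left.affineOpens, x ∈ (U : X.left.Opens) ∧
      ∃ g : MvPolynomial (Fin d) R →+* Γ(X.left, U),
        g.comp MvPolynomial.C = structHom X U ∧ g.Etale := by
  obtain ⟨V, hV, U, hU, hx, e, h⟩ := hX.exists_isStandardSmoothOfRelativeDimension x
  refine ⟨⟨U, hU⟩, hx, ?_⟩
  have h1 : ((𝟙 (Spec (CommRingCat.of R)) : Spec (CommRingCat.of R) ⟶ _).appLE ⊤ V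
      le_top).hom.Etale :=
    Etale.etale_appLE _ (isAffineOpen_top _) hV _
  have h2 : ((Scheme.ΓSpecIso (CommRingCat.of R)).inv ≫
      (𝟙 (Spec (CommRingCat.of R)) : Spec (CommRingCat.of R) ⟶ _).appLE ⊤ V
        le_top).hom.Etale := by
    rw [CommRingCat.hom_comp]
    exact RingHom.Etale.respectsIso.2 _ (Scheme.ΓSpecIso (CommRingCat.of R)).symm.commRingCatIsoToRingEquiv h1
  have h3 := h.comp (RingHom.etale_iff_isStandardSmoothOfRelativeDimension_zero.mp h2)
  rw [add_zero] at h3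
  have h4 : structHom X U = (X.hom.appLE V U e).hom.comp ((Scheme.ΓSpecIso (CommRingCat.of R)).inv ≫
      (𝟙 (Spec (CommRingCat.of R)) : Spec (CommRingCat.of R) ⟶ _).appLE ⊤ V le_top).hom := by
    have h5 := Scheme.Hom.appLE_comp_appLE X.hom (𝟙 (Spec (CommRingCat.of R))) ⊤ V U le_top e
    rw [structHom, ← CommRingCat.hom_comp, Category.assoc]
    refine congrArg CommRingCat.Hom.hom (congrArg _ (Eq.trans ?_ h5.symm))
    congr 1
  rw [← h4] at h3
  exact h3.exists_etale_mvPolynomial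


/-! ### Points of schemes with values in algebras -/

section Points

variable {R : Type u} [CommRing R]

/-- The spectrum of an `R`-algebra, as a scheme over `R`. -/
abbrev specOver (B : CommAlgCat.{u} R) : Over (Spec (CommRingCat.of R)) :=
  (algSpec (CommRingCat.of R)).obj (op B)

/-- The morphism of spectra attached to a homomorphism of `R`-algebras. -/
abbrev specOverMap {B B' : CommAlgCat.{u} R} (k : B ⟶ B') : specOver B' ⟶ specOver B :=
  (algSpec (CommRingCat.of R)).map k.op

theorem specOver_hom (B : CommAlgCat.{u} R) :
    (specOver B).hom = Spec.map (CommRingCat.ofHom (algebraMap R B)) :=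
  rfl

variable {X Y : Over (Spec (CommRingCat.of R))} {B B' : CommAlgCat.{u} R}

/-- The homomorphism `Γ(X, U) → B` attached to a morphism `f : Spec B ⟶ X` with image in `U`. -/
def pointHom (f : specOver B ⟶ X) (U : X.left.Opens) (h : f.left ⁻¹ᵁ U = ⊤) :
    Γ(X.left, U) →+* B :=
  (f.left.appLE U ⊤ h.ge ≫ (Scheme.ΓSpecIso (CommRingCat.of B)).hom).hom

theorem pointHom_congr {f g : specOver B ⟶ X} (e : f = g) {U : X.left.Opens}
    (hf : f.left ⁻¹ᵁ U = ⊤) (hg : g.left ⁻¹ᵁ U = ⊤) : pointHom f U hf = pointHom g U hg := by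
  subst e
  rfl

theorem preimage_comp_eq_top {T T' : Over (Spec (CommRingCat.of R))} (t : T' ⟶ T) {f : T ⟶ X}
    {U : X.left.Opens} (h : f.left ⁻¹ᵁ U = ⊤) : (t ≫ f).left ⁻¹ᵁ U = ⊤ := by
  change t.left ⁻¹ᵁ (f.left ⁻¹ᵁ U) = ⊤
  rw [h]
  rfl

theorem pointHom_specOverMap_comp (k : B ⟶ B') (f : specOver B ⟶ X) {U : X.left.Opens}
    (h : f.left ⁻¹ᵁ U = ⊤) (h' : (specOverMap k ≫ f).left ⁻¹ᵁ U = ⊤) (a : Γ(X.left, U)) :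
    pointHom (specOverMap k ≫ f) U h' a = k.hom (pointHom f U h a) := by
  have h1 := Scheme.Hom.appLE_comp_appLE (specOverMap k).left f.left U ⊤ ⊤ h.ge le_rfl
  have h2 := Scheme.ΓSpecIso_naturality (CommRingCat.ofHom k.hom.toRingHom)
  have h3 : (specOverMap k).left.appLE ⊤ ⊤ le_rfl = (specOverMap k).left.appTop :=
    Scheme.Hom.appLE_eq_app _
  have h4 : (specOverMap k ≫ f).left.appLE U ⊤ h'.ge ≫ (Scheme.ΓSpecIso (CommRingCat.of B')).hom =
      (f.left.appLE U ⊤ h.ge ≫ (Scheme.ΓSpecIso (CommRingCat.of B)).hom) ≫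
        CommRingCat.ofHom k.hom.toRingHom := by
    refine (congrArg (· ≫ (Scheme.ΓSpecIso (CommRingCat.of B')).hom) h1.symm).trans ?_
    rw [h3]
    refine (Category.assoc _ _ _).trans ?_
    refine (congrArg (f.left.appLE U ⊤ h.ge ≫ ·) h2).trans ?_
    exact (Category.assoc _ _ _).symm
  exact congrArg (fun m : Γ(X.left, U) ⟶ CommRingCat.of B' => m.hom a) h4

theorem pointHom_res (f : specOver B ⟶ X) {U U' : X.left.Opens} (hU : U' ≤ U)
    (h : f.left ⁻¹ᵁ U = ⊤) (h' : f.left ⁻¹ᵁ U' = ⊤) (a : Γ(X.left, U)) :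
    pointHom f U' h' (X.left.presheaf.map (homOfLE hU).op a) = pointHom f U h a := by
  have h1 := Scheme.Hom.map_appLE f.left h'.ge (homOfLE hU).op
  exact congrArg (fun m : Γ(X.left, U) ⟶ Γ((specOver B).left, ⊤) =>
    (Scheme.ΓSpecIso (CommRingCat.of B)).hom.hom (m.hom a)) h1

theorem pointHom_comp (f : specOver B ⟶ X) (m : X ⟶ Y) {U : X.left.Opens} {V : Y.left.Opens}
    (hUV : U ≤ m.left ⁻¹ᵁ V) (h : f.left ⁻¹ᵁ U = ⊤) (h' : (f ≫ m).left ⁻¹ᵁ V = ⊤)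
    (a : Γ(Y.left, V)) :
    pointHom (f ≫ m) V h' a = pointHom f U h (m.left.appLE V U hUV a) := by
  have h1 := Scheme.Hom.appLE_comp_appLE f.left m.left V U ⊤ hUV h.ge
  exact congrArg (fun m : Γ(Y.left, V) ⟶ Γ((specOver B).left, ⊤) =>
    (Scheme.ΓSpecIso (CommRingCat.of B)).hom.hom (m.hom a)) h1.symm

theorem appLE_structHom {T : Over (Spec (CommRingCat.of R))} (f : T ⟶ X) (U : X.left.Opens)
    (V : T.left.Opens) (h : V ≤ f.left ⁻¹ᵁ U) (r : R) :
    f.left.appLE U V h (structHom X U r) = structHom T V r := by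
  have h1 := Scheme.Hom.appLE_comp_appLE f.left X.hom ⊤ U V le_top h
  have h2 : ∀ (q : T.left ⟶ Spec (CommRingCat.of R)) (_ : q = T.hom) (hq : V ≤ q ⁻¹ᵁ ⊤),
      q.appLE ⊤ V hq = T.hom.appLE ⊤ V le_top := by
    rintro _ rfl _
    rfl
  have h3 := h1.trans (h2 _ (Over.w f) _)
  exact congrArg (fun m : Γ(Spec (CommRingCat.of R), ⊤) ⟶ Γ(T.left, V) =>
    m.hom ((Scheme.ΓSpecIso (CommRingCat.of R)).inv.hom r)) h3

theorem structHom_specOver (B : CommAlgCat.{u} R) (r : R) :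
    (Scheme.ΓSpecIso (CommRingCat.of B)).hom.hom (structHom (specOver B) ⊤ r) =
      algebraMap R B r := by
  have h1 := Scheme.ΓSpecIso_inv_naturality (CommRingCat.ofHom (algebraMap R B))
  have h2 : (specOver B).hom.appLE ⊤ ⊤ le_top = (specOver B).hom.appTop :=
    Scheme.Hom.appLE_eq_app _
  have h3 : (Scheme.ΓSpecIso (CommRingCat.of R)).inv ≫ (specOver B).hom.appLE ⊤ ⊤ le_top =
      CommRingCat.ofHom (algebraMap R B) ≫ (Scheme.ΓSpecIso (CommRingCat.of B)).inv := by
    rw [h2]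
    exact h1.symm
  have h4 := congrArg (· ≫ (Scheme.ΓSpecIso (CommRingCat.of B)).hom) h3
  have h5 : (CommRingCat.ofHom (algebraMap R B) ≫ (Scheme.ΓSpecIso (CommRingCat.of B)).inv) ≫
      (Scheme.ΓSpecIso (CommRingCat.of B)).hom = CommRingCat.ofHom (algebraMap R B) := by
    rw [Category.assoc, Iso.inv_hom_id, Category.comp_id]
  exact congrArg (fun m : CommRingCat.of R ⟶ CommRingCat.of B => m.hom r) (h4.trans h5)

theorem pointHom_structHom (f : specOver B ⟶ X) {U : X.left.Opens} (h : f.left ⁻¹ᵁ U = ⊤) (r : R) :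
    pointHom f U h (structHom X U r) = algebraMap R B r :=
  (congrArg (Scheme.ΓSpecIso (CommRingCat.of B)).hom.hom
    (appLE_structHom f U ⊤ h.ge r)).trans (structHom_specOver B r)

theorem spec_map_pointHom (f : specOver B ⟶ X) {U : X.left.Opens} (hU : IsAffineOpen U)
    (h : f.left ⁻¹ᵁ U = ⊤) :
    Spec.map (CommRingCat.ofHom (pointHom f U h)) ≫ hU.fromSpec = f.left := by
  have h1 := IsAffineOpen.SpecMap_appLE_fromSpec f.left hU
    (isAffineOpen_top (Spec (CommRingCat.of B))) h.ge
  have h2 : (isAffineOpen_top (Spec (CommRingCat.of B))).fromSpec =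
      Spec.map (Scheme.ΓSpecIso (CommRingCat.of B)).inv := by
    rw [IsAffineOpen.fromSpec_top, Scheme.isoSpec_Spec_inv]
  have h3 : Spec.map (CommRingCat.ofHom (pointHom f U h)) =
      Spec.map (Scheme.ΓSpecIso (CommRingCat.of B)).hom ≫ Spec.map (f.left.appLE U ⊤ h.ge) :=
    Spec.map_comp _ _
  rw [h3]
  refine (Category.assoc _ _ _).trans ?_
  refine (congrArg (Spec.map (Scheme.ΓSpecIso (CommRingCat.of B)).hom ≫ ·)
    (h1.trans (congrArg (· ≫ f.left) h2))).trans ?_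
  refine (Category.assoc _ _ _).symm.trans ?_
  have h4 : Spec.map (Scheme.ΓSpecIso (CommRingCat.of B)).hom ≫
      Spec.map (Scheme.ΓSpecIso (CommRingCat.of B)).inv = 𝟙 _ := by
    rw [← Spec.map_comp, Iso.inv_hom_id, Spec.map_id]
  exact (congrArg (· ≫ f.left) h4).trans (Category.id_comp _)

theorem eq_of_pointHom_eq {f g : specOver B ⟶ X} {U : X.left.Opens} (hU : IsAffineOpen U)
    (hf : f.left ⁻¹ᵁ U = ⊤) (hg : g.left ⁻¹ᵁ U = ⊤)
    (h : ∀ a, pointHom f U hf a = pointHom g U hg a) : f = g := by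
  apply Over.OverMorphism.ext
  rw [← spec_map_pointHom f hU hf, ← spec_map_pointHom g hU hg, RingHom.ext h]

theorem fromSpec_appLE_top {Z : Scheme.{u}} {U : Z.Opens} (hU : IsAffineOpen U) :
    hU.fromSpec.appLE U ⊤ hU.fromSpec_preimage_self.ge = (Scheme.ΓSpecIso Γ(Z, U)).inv := by
  rw [Scheme.Hom.appLE, hU.fromSpec_app_self, Category.assoc, ← Functor.map_comp]
  refine (congrArg _ ?_).trans (Category.comp_id _)
  exact ((Spec Γ(Z, U)).presheaf.congr_map (Subsingleton.elim _ (𝟙 _))).trans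
    ((Spec Γ(Z, U)).presheaf.map_id _)

theorem exists_pointHom_eq {U : X.left.Opens} (hU : IsAffineOpen U) (α : Γ(X.left, U) →+* B)
    (hα : ∀ r, α (structHom X U r) = algebraMap R B r) :
    ∃ (f : specOver B ⟶ X) (h : f.left ⁻¹ᵁ U = ⊤), pointHom f U h = α := by
  have h1 := IsAffineOpen.SpecMap_appLE_fromSpec X.hom
    (isAffineOpen_top (Spec (CommRingCat.of R))) hU le_top
  have h2 : (isAffineOpen_top (Spec (CommRingCat.of R))).fromSpec =
      Spec.map (Scheme.ΓSpecIso (CommRingCat.of R)).inv := by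
    rw [IsAffineOpen.fromSpec_top, Scheme.isoSpec_Spec_inv]
  have h3 : hU.fromSpec ≫ X.hom = Spec.map (CommRingCat.ofHom (structHom X U)) := by
    rw [← h1, h2, ← Spec.map_comp]
    rfl
  have hw : (Spec.map (CommRingCat.ofHom α) ≫ hU.fromSpec) ≫ X.hom = (specOver B).hom := by
    rw [Category.assoc, h3, ← Spec.map_comp, specOver_hom]
    congr 1
    ext r
    exact hα r
  have hpre : (Spec.map (CommRingCat.ofHom α) ≫ hU.fromSpec) ⁻¹ᵁ U = ⊤ := by
    change Spec.map (CommRingCat.ofHom α) ⁻¹ᵁ (hU.fromSpec ⁻¹ᵁ U) = ⊤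
    rw [hU.fromSpec_preimage_self]
    rfl
  refine ⟨Over.homMk (Spec.map (CommRingCat.ofHom α) ≫ hU.fromSpec) hw, hpre, ?_⟩
  have h4 := fromSpec_appLE_top hU
  have h5 := Scheme.Hom.appLE_comp_appLE (Spec.map (CommRingCat.ofHom α)) hU.fromSpec U ⊤ ⊤
    hU.fromSpec_preimage_self.ge le_rfl
  have h6 : (Spec.map (CommRingCat.ofHom α)).appLE ⊤ ⊤ le_rfl =
    (Spec.map (CommRingCat.ofHom α)).appTop := Scheme.Hom.appLE_eq_app _
  have h7 := Scheme.ΓSpecIso_naturality (CommRingCat.ofHom α)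
  have h8 : (Spec.map (CommRingCat.ofHom α) ≫ hU.fromSpec).appLE U ⊤ hpre.ge ≫
      (Scheme.ΓSpecIso (CommRingCat.of B)).hom = CommRingCat.ofHom α := by
    rw [← h5, h4, h6, Category.assoc, h7]
    exact Iso.inv_hom_id_assoc _ _
  exact congrArg CommRingCat.Hom.hom h8

end Points


/-! ### Nilpotent thickenings and sections over open subsets of an affine scheme -/

section Sections

variable {R : Type u} [CommRing R] {X : Over (Spec (CommRingCat.of R))} {B B' : CommAlgCat.{u} R}

/-- A surjection with nil kernel is surjective on spectra, so whether a point of `X` factors through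
an open subset can be tested on the closed subscheme. -/
theorem preimage_eq_top_of_specOverMap_comp {k : B ⟶ B'} (hk : Function.Surjective k.hom)
    (hk' : RingHom.ker k.hom ≤ nilradical B) {f : specOver B ⟶ X} {U : X.left.Opens}
    (h : (specOverMap k ≫ f).left ⁻¹ᵁ U = ⊤) : f.left ⁻¹ᵁ U = ⊤ := by
  have hs : Function.Surjective (PrimeSpectrum.comap k.hom.toRingHom) := by
    rw [← Set.range_eq_univ, range_comap_of_surjective _ _ hk,
      PrimeSpectrum.zeroLocus_eq_univ_iff]
    intro x hx
    exact hk' hx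
  rw [eq_top_iff]
  intro x _
  obtain ⟨y, hy⟩ := hs x
  have hy' : y ∈ (specOverMap k ≫ f).left ⁻¹ᵁ U := h ▸ trivial
  have hy'' : PrimeSpectrum.comap k.hom.toRingHom y ∈ f.left ⁻¹ᵁ U := hy'
  rwa [hy] at hy''

/-- The sections of a scheme over `R`, as an `R`-algebra. -/
def sectionsAlg (T : Over (Spec (CommRingCat.of R))) (V : T.left.Opens) : CommAlgCat.{u} R :=
  letI : Algebra R Γ(T.left, V) := (structHom T V).toAlgebra
  CommAlgCat.of R Γ(T.left, V)

/-- The restriction of sections, as a homomorphism of `R`-algebras. -/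
def sectionsRes (T : Over (Spec (CommRingCat.of R))) {V V' : T.left.Opens} (h : V' ≤ V) :
    sectionsAlg T V ⟶ sectionsAlg T V' :=
  letI : Algebra R Γ(T.left, V) := (structHom T V).toAlgebra
  letI : Algebra R Γ(T.left, V') := (structHom T V').toAlgebra
  CommAlgCat.ofHom
    { (T.left.presheaf.map (homOfLE h).op).hom with
      commutes' := fun r => by
        have h1 := Scheme.Hom.appLE_map T.hom (U := ⊤) (V := V) le_top (homOfLE h).op
        exact congrArg (fun m : Γ(Spec (CommRingCat.of R), ⊤) ⟶ Γ(T.left, V') =>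
          m.hom ((Scheme.ΓSpecIso (CommRingCat.of R)).inv.hom r)) h1 }

/-- The isomorphism of `B` with the algebra of global sections of its spectrum. -/
def toGlobalSections (B : CommAlgCat.{u} R) : B ⟶ sectionsAlg (specOver B) ⊤ :=
  letI : Algebra R Γ((specOver B).left, ⊤) := (structHom (specOver B) ⊤).toAlgebra
  CommAlgCat.ofHom
    { (Scheme.ΓSpecIso (CommRingCat.of B)).inv.hom with
      commutes' := fun r => by
        have h := congrArg (Scheme.ΓSpecIso (CommRingCat.of B)).inv.hom (structHom_specOver B r)
        refine h.symm.trans ?_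
        exact congrArg (fun m : Γ((specOver B).left, ⊤) ⟶ Γ((specOver B).left, ⊤) =>
          m.hom (structHom (specOver B) ⊤ r)) (Iso.hom_inv_id (Scheme.ΓSpecIso (CommRingCat.of B))) }

/-- The homomorphism from `B` to the algebra of sections over an open subset of its spectrum. -/
def toSections (B : CommAlgCat.{u} R) (V : (specOver B).left.Opens) :
    B ⟶ sectionsAlg (specOver B) V :=
  toGlobalSections B ≫ sectionsRes (specOver B) le_top

theorem sectionsRes_comp (T : Over (Spec (CommRingCat.of R))) {V V' V'' : T.left.Opens}
    (h : V' ≤ V) (h' : V'' ≤ V') :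
    sectionsRes T h ≫ sectionsRes T h' = sectionsRes T (h'.trans h) := by
  refine CommAlgCat.hom_ext (AlgHom.ext fun x => ?_)
  have h1 := T.left.presheaf.map_comp (homOfLE h).op (homOfLE h').op
  exact congrArg (fun m : Γ(T.left, V) ⟶ Γ(T.left, V'') => m.hom x) h1.symm

theorem toSections_comp_sectionsRes (B : CommAlgCat.{u} R) {V V' : (specOver B).left.Opens}
    (h : V' ≤ V) : toSections B V ≫ sectionsRes (specOver B) h = toSections B V' := by
  rw [toSections, Category.assoc, sectionsRes_comp]
  rfl

theorem specOverMap_toSections_left (B : CommAlgCat.{u} R) {V : (specOver B).left.Opens}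
    (hV : IsAffineOpen V) : (specOverMap (toSections B V)).left = hV.fromSpec := by
  have h1 := (isAffineOpen_top (Spec (CommRingCat.of B))).map_fromSpec hV (homOfLE le_top).op
  have h2 : (isAffineOpen_top (Spec (CommRingCat.of B))).fromSpec =
      Spec.map (Scheme.ΓSpecIso (CommRingCat.of B)).inv := by
    rw [IsAffineOpen.fromSpec_top, Scheme.isoSpec_Spec_inv]
  rw [h2, ← Spec.map_comp] at h1
  exact h1

theorem preimage_specOverMap_toSections (f : specOver B ⟶ X) {U : X.left.Opens}
    {V : (specOver B).left.Opens} (hV : IsAffineOpen V) (h : V ≤ f.left ⁻¹ᵁ U) :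
    (specOverMap (toSections B V) ≫ f).left ⁻¹ᵁ U = ⊤ := by
  have h1 : (specOverMap (toSections B V)).left ⁻¹ᵁ V = ⊤ := by
    rw [specOverMap_toSections_left B hV]
    exact hV.fromSpec_preimage_self
  rw [eq_top_iff, ← h1]
  exact (specOverMap (toSections B V)).left.preimage_mono h

theorem pointHom_specOverMap_toSections (f : specOver B ⟶ X) {U : X.left.Opens}
    {V : (specOver B).left.Opens} (hV : IsAffineOpen V) (h : V ≤ f.left ⁻¹ᵁ U)
    (h' : (specOverMap (toSections B V) ≫ f).left ⁻¹ᵁ U = ⊤) (a : Γ(X.left, U)) :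
    pointHom (specOverMap (toSections B V) ≫ f) U h' a = f.left.appLE U V h a := by
  have key : ∀ (q : Spec Γ((specOver B).left, V) ⟶ (specOver B).left) (_ : q = hV.fromSpec)
      (hq : (q ≫ f.left) ⁻¹ᵁ U = ⊤),
      (q ≫ f.left).appLE U ⊤ hq.ge ≫ (Scheme.ΓSpecIso Γ((specOver B).left, V)).hom =
        f.left.appLE U V h := by
    rintro _ rfl hq
    have h1 := Scheme.Hom.appLE_comp_appLE hV.fromSpec f.left U V ⊤ h hV.fromSpec_preimage_self.ge
    rw [← h1, fromSpec_appLE_top, Category.assoc, Iso.inv_hom_id, Category.comp_id]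
  exact congrArg (fun m : Γ(X.left, U) ⟶ Γ((specOver B).left, V) => m.hom a)
    (key _ (specOverMap_toSections_left B hV) h')

theorem toSections_top_bijective (B : CommAlgCat.{u} R) {V : (specOver B).left.Opens}
    (hV : V = ⊤) : Function.Bijective (toSections B V).hom := by
  subst hV
  have h : toSections B ⊤ = toGlobalSections B := by
    refine CommAlgCat.hom_ext (AlgHom.ext fun x => ?_)
    have h1 := (specOver B).left.presheaf.map_id (op ⊤)
    exact congrArg (fun m : Γ((specOver B).left, ⊤) ⟶ Γ((specOver B).left, ⊤) =>
      m.hom ((toGlobalSections B).hom x)) h1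
  rw [h]
  exact (Scheme.ΓSpecIso (CommRingCat.of B)).symm.commRingCatIsoToRingEquiv.bijective

end Sections


/-! ### Points of jet spaces as points with values in rings of jets -/

section JetObj

variable (p : ℕ) {R : Type u} [CommRing R] (φ : R →+* R) (n : ℕ) [hφ : IsFrobeniusLift p φ]

/-- The ring of jets with coordinates in `B`, as an `R`-algebra. -/
abbrev jetObj (B : CommAlgCat.{u} R) : CommAlgCat.{u} R :=
  CommAlgCat.of R (JetRing p φ n B)

/-- The functoriality of the ring of jets. -/
def jetObjMap {B B' : CommAlgCat.{u} R} (k : B ⟶ B') : jetObj p φ n B ⟶ jetObj p φ n B' :=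
  CommAlgCat.ofHom (JetRing.map p φ n k.hom)

/-- The projection of the ring of jets to the coordinate of order zero. -/
def jetObjProj (B : CommAlgCat.{u} R) : jetObj p φ n B ⟶ B :=
  CommAlgCat.ofHom (JetRing.proj p φ n B)

theorem jetObjMap_coord {B B' : CommAlgCat.{u} R} (k : B ⟶ B') (u : JetRing p φ n B)
    (i : Fin (n + 1)) :
    JetRing.coord ((jetObjMap p φ n k).hom u) i = k.hom (u.coord i) :=
  JetRing.map_coord _ _ _

theorem jetObjProj_apply (B : CommAlgCat.{u} R) (u : JetRing p φ n B) :
    (jetObjProj p φ n B).hom u = u.coord 0 :=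
  JetRing.proj_apply _

theorem jetObjMap_comp {B B' B'' : CommAlgCat.{u} R} (k : B ⟶ B') (l : B' ⟶ B'') :
    jetObjMap p φ n (k ≫ l) = jetObjMap p φ n k ≫ jetObjMap p φ n l :=
  CommAlgCat.hom_ext (JetRing.map_comp k.hom l.hom)

theorem jetObjMap_comp_jetObjProj {B B' : CommAlgCat.{u} R} (k : B ⟶ B') :
    jetObjMap p φ n k ≫ jetObjProj p φ n B' = jetObjProj p φ n B ≫ k :=
  CommAlgCat.hom_ext (JetRing.proj_comp_map k.hom)

variable {p φ n} {X Y : Over (Spec (CommRingCat.of R))} {B B' : CommAlgCat.{u} R}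

theorem specOverMap_comp {B B' B'' : CommAlgCat.{u} R} (k : B ⟶ B') (l : B' ⟶ B'') :
    specOverMap (k ≫ l) = specOverMap l ≫ specOverMap k :=
  (algSpec (CommRingCat.of R)).map_comp l.op k.op

theorem specOverMap_jetObjMap_comp (k : B ⟶ B') (f : specOver (jetObj p φ n B) ⟶ X) :
    specOverMap (jetObjProj p φ n B') ≫ specOverMap (jetObjMap p φ n k) ≫ f =
      specOverMap k ≫ specOverMap (jetObjProj p φ n B) ≫ f := by
  rw [← Category.assoc, ← Category.assoc, ← specOverMap_comp, ← specOverMap_comp,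
    jetObjMap_comp_jetObjProj]

theorem preimage_eq_top_of_jetObjProj (hp : IsNilpotent (p : B))
    {f : specOver (jetObj p φ n B) ⟶ X} {U : X.left.Opens}
    (h : (specOverMap (jetObjProj p φ n B) ≫ f).left ⁻¹ᵁ U = ⊤) : f.left ⁻¹ᵁ U = ⊤ := by
  refine preimage_eq_top_of_specOverMap_comp (k := jetObjProj p φ n B) JetRing.proj_surjective
    ?_ h
  obtain ⟨N, hN⟩ := JetRing.isNilpotent_ker_proj (φ := φ) (n := n) hp
  intro x hx
  rw [mem_nilradical]
  refine ⟨N, ?_⟩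
  have := Ideal.pow_mem_pow (I := RingHom.ker (JetRing.proj p φ n B)) hx N
  rw [hN] at this
  exact this

theorem isNilpotent_sectionsAlg (hp : IsNilpotent (p : B)) (V : (specOver B).left.Opens) :
    IsNilpotent (p : sectionsAlg (specOver B) V) := by
  simpa using hp.map (toSections B V).hom

theorem preimage_specOverMap_jetObjMap_toSections (hp : IsNilpotent (p : B))
    (f : specOver (jetObj p φ n B) ⟶ X) {U : X.left.Opens} {V : (specOver B).left.Opens}
    (hV : IsAffineOpen V) (h : V ≤ (specOverMap (jetObjProj p φ n B) ≫ f).left ⁻¹ᵁ U) :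
    (specOverMap (jetObjMap p φ n (toSections B V)) ≫ f).left ⁻¹ᵁ U = ⊤ := by
  apply preimage_eq_top_of_jetObjProj (isNilpotent_sectionsAlg hp V)
  rw [specOverMap_jetObjMap_comp]
  exact preimage_specOverMap_toSections _ hV h

/-- The point of the jet space of `X` with values in `Spec B` that corresponds to a point of `X`
with values in the ring of jets with coordinates in `B`. -/
def JetPoint.ofMap (hp : IsNilpotent (p : B)) (f : specOver (jetObj p φ n B) ⟶ X)
    (hf : ∀ U : X.left.affineOpens,
      IsAffineOpen ((specOverMap (jetObjProj p φ n B) ≫ f).left ⁻¹ᵁ U)) :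
    JetPoint p φ n X (specOver B) where
  base := specOverMap (jetObjProj p φ n B) ≫ f
  -- Here `f` is restricted along the map of jet rings induced by `B → Γ(V)`, with `V` the preimage
  -- of `U`. Since `V` is affine, `Spec Γ(V)` is `V` and its base point lands in `U`; by nilpotence
  -- so does the point with values in jets.
  θ U := jetAlgLift (C := sectionsAlg (specOver B) _) (pointHom _ U
    (preimage_specOverMap_jetObjMap_toSections hp f (hf U) le_rfl)) (pointHom_structHom _ _)
  θ_base U a := by
    have h := preimage_specOverMap_jetObjMap_toSections hp f (hf U) le_rfl
    have h1 := pointHom_specOverMap_toSections (specOverMap (jetObjProj p φ n B) ≫ f) (hf U) le_rfl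
      (preimage_specOverMap_toSections _ (hf U) le_rfl) a
    have h2 := pointHom_specOverMap_comp (jetObjProj p φ n _) _ h (preimage_comp_eq_top _ h) a
    have h3 := pointHom_congr (specOverMap_jetObjMap_comp (toSections B _) f)
      (preimage_comp_eq_top _ h) (preimage_specOverMap_toSections _ (hf U) le_rfl)
    refine (jetAlgLift_jetCoord (C := sectionsAlg (specOver B) _) _ _ _ _).trans ?_
    refine (jetObjProj_apply p φ n _ _).symm.trans (h2.symm.trans ?_)
    refine (RingHom.congr_fun h3 a).trans (h1.trans ?_)
    exact congrArg (fun m : Γ(X.left, U) ⟶ _ => m.hom a) (Scheme.Hom.appLE_eq_app _)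
  θ_res U U' h i a := by
    have hU := preimage_specOverMap_jetObjMap_toSections hp f (hf U) le_rfl
    have hU' := preimage_specOverMap_jetObjMap_toSections hp f (hf U') le_rfl
    let b := specOverMap (jetObjProj p φ n B) ≫ f
    have hb : b.left ⁻¹ᵁ (U' : X.left.Opens) ≤ b.left ⁻¹ᵁ U := b.left.preimage_mono h
    have h1 := jetObjMap_coord p φ n (sectionsRes (specOver B) hb)
      (pointHom _ U (preimage_specOverMap_jetObjMap_toSections hp f (hf U) le_rfl) a) i
    have h2 := pointHom_specOverMap_comp (jetObjMap p φ n (sectionsRes (specOver B) hb)) _ hU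
      (preimage_comp_eq_top _ hU) a
    have h3 : specOverMap (jetObjMap p φ n (sectionsRes (specOver B) hb)) ≫
        specOverMap (jetObjMap p φ n (toSections B (b.left ⁻¹ᵁ U))) ≫ f =
        specOverMap (jetObjMap p φ n (toSections B (b.left ⁻¹ᵁ U'))) ≫ f := by
      rw [← Category.assoc, ← specOverMap_comp, ← jetObjMap_comp, toSections_comp_sectionsRes]
    have h4 := pointHom_congr h3 (preimage_comp_eq_top _ hU) (h3 ▸ preimage_comp_eq_top _ hU)
    have h5 := pointHom_res (specOverMap (jetObjMap p φ n (toSections B (b.left ⁻¹ᵁ U'))) ≫ f) h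
      (h3 ▸ preimage_comp_eq_top _ hU) hU' a
    refine (congrArg (sectionsRes (specOver B) hb).hom
      (jetAlgLift_jetCoord (C := sectionsAlg (specOver B) _) _ _ _ _)).trans
      (Eq.trans ?_ (jetAlgLift_jetCoord (C := sectionsAlg (specOver B) _) _ _ _ _).symm)
    exact h1.symm.trans (congrArg (fun u => JetRing.coord u i)
      (h2.symm.trans ((RingHom.congr_fun h4 a).trans h5.symm)))

end JetObj


/-! ### A jet point is determined on one chart containing its base -/

section Charts

/-- The inclusion of the affine open `W` is a monomorphism of schemes, so restriction of functions
from `U` to `W` is an epimorphism of rings. -/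
theorem ringHom_eq_of_comp_res_eq {Z : Scheme.{u}} {U W : Z.Opens} (hU : IsAffineOpen U)
    (hW : IsAffineOpen W) (h : W ≤ U) {S : Type u} [CommRing S] {α β : Γ(Z, W) →+* S}
    (hαβ : ∀ a, α (Z.presheaf.map (homOfLE h).op a) = β (Z.presheaf.map (homOfLE h).op a)) :
    α = β := by
  have h1 := hU.map_fromSpec hW (homOfLE h).op
  have h2 : Spec.map (CommRingCat.ofHom α) ≫ Spec.map (Z.presheaf.map (homOfLE h).op) =
      Spec.map (CommRingCat.ofHom β) ≫ Spec.map (Z.presheaf.map (homOfLE h).op) := by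
    rw [← Spec.map_comp, ← Spec.map_comp]
    congr 1
    ext a
    exact hαβ a
  have h3 : Spec.map (CommRingCat.ofHom α) ≫ hW.fromSpec =
      Spec.map (CommRingCat.ofHom β) ≫ hW.fromSpec := by
    rw [← h1, reassoc_of% h2]
  have h4 := Spec.map_injective ((cancel_mono hW.fromSpec).mp h3)
  exact congrArg CommRingCat.Hom.hom h4

variable {p : ℕ} {R : Type u} [CommRing R] {φ : R →+* R} {n : ℕ} [hφ : IsFrobeniusLift p φ]
  {X Y T : Over (Spec (CommRingCat.of R))}

/-- Translated into homomorphisms to the ring of jets, this is the epimorphism property of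
restriction; no localization formula for `JetAlg` is needed. -/
theorem jetAlg_ringHom_eq_of_le (b : T ⟶ X) {U W : X.left.affineOpens}
    (h : (W : X.left.Opens) ≤ U)
    {θ θ' : JetAlg p φ n (structHom X W) →+* Γ(T.left, b.left ⁻¹ᵁ W)}
    (hθ : ∀ a, θ (jetCoord p φ n (structHom X W) 0 a) = b.left.app W a)
    (hθ' : ∀ a, θ' (jetCoord p φ n (structHom X W) 0 a) = b.left.app W a)
    (hh : ∀ i a, θ (jetCoord p φ n (structHom X W) i (X.left.presheaf.map (homOfLE h).op a)) =
      θ' (jetCoord p φ n (structHom X W) i (X.left.presheaf.map (homOfLE h).op a))) : θ = θ' := by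
  have hr : ∀ r, b.left.app W (structHom X W r) =
      algebraMap R (sectionsAlg T (b.left ⁻¹ᵁ W)) r := fun r =>
    (congrArg (fun m : Γ(X.left, W) ⟶ Γ(T.left, b.left ⁻¹ᵁ W) => m.hom (structHom X W r))
      (Scheme.Hom.appLE_eq_app b.left).symm).trans (appLE_structHom b W _ le_rfl r)
  let α := jetRingHom (C := sectionsAlg T (b.left ⁻¹ᵁ W)) θ fun r => (hθ _).trans (hr r)
  let β := jetRingHom (C := sectionsAlg T (b.left ⁻¹ᵁ W)) θ' fun r => (hθ' _).trans (hr r)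
  have hαβ : α = β := ringHom_eq_of_comp_res_eq U.2 W.2 h fun a => JetRing.ext (funext fun i => hh i a)
  refine jetAlg_ringHom_ext fun i a => ?_
  exact congrArg (fun u => JetRing.coord u i) (RingHom.congr_fun hαβ a)

/-- For affine `W ⊆ U` the components at `W` are determined by those at `U`. For an arbitrary affine
`U'`, the preimages of the affine `W ⊆ U ⊓ U'` cover the preimage of `U'`, because the preimage of
`U` is everything, and the sheaf property concludes. -/
theorem JetPoint.ext_of_chart {P Q : JetPoint p φ n X T} (hb : P.base = Q.base)
    (U : X.left.affineOpens) (hU : P.base.left ⁻¹ᵁ (U : X.left.Opens) = ⊤)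
    (h : ∀ i a, P.θ U (jetCoord p φ n (structHom X U) i a) =
      T.left.presheaf.map (eqToHom (by rw [hb])).op
        (Q.θ U (jetCoord p φ n (structHom X U) i a))) : P = Q := by
  obtain ⟨b, θ, h1, h2⟩ := P
  obtain ⟨b', θ', h1', h2'⟩ := Q
  obtain rfl : b = b' := hb
  have h' : ∀ i a, θ U (jetCoord p φ n (structHom X U) i a) =
      θ' U (jetCoord p φ n (structHom X U) i a) := fun i a => by simpa using h i a
  congr
  funext U'
  refine RingHom.ext fun x => ?_
  have key : ∀ W : X.left.affineOpens, (W : X.left.Opens) ≤ U → θ W = θ' W := fun W hW => by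
    refine jetAlg_ringHom_eq_of_le b hW (h1 W) (h1' W) fun i a => ?_
    rw [← h2 U W hW, ← h2' U W hW, h']
  have hres : ∀ (W : X.left.affineOpens) (hW : (W : X.left.Opens) ≤ U')
      (κ : ∀ U : X.left.affineOpens, JetAlg p φ n (structHom X U) →+* Γ(T.left, b.left ⁻¹ᵁ U))
      (κ' : ∀ U : X.left.affineOpens, JetAlg p φ n (structHom X U) →+* Γ(T.left, b.left ⁻¹ᵁ U))
      (_ : κ W = κ' W)
      (_ : ∀ i a, T.left.presheaf.map (homOfLE (b.left.preimage_mono hW)).op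
        (κ U' (jetCoord p φ n (structHom X U') i a)) =
          κ W (jetCoord p φ n (structHom X W) i (X.left.presheaf.map (homOfLE hW).op a)))
      (_ : ∀ i a, T.left.presheaf.map (homOfLE (b.left.preimage_mono hW)).op
        (κ' U' (jetCoord p φ n (structHom X U') i a)) =
          κ' W (jetCoord p φ n (structHom X W) i (X.left.presheaf.map (homOfLE hW).op a))),
      T.left.presheaf.map (homOfLE (b.left.preimage_mono hW)).op (κ U' x) =
        T.left.presheaf.map (homOfLE (b.left.preimage_mono hW)).op (κ' U' x) := by
    intro W hW κ κ' he k1 k2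
    have : (T.left.presheaf.map (homOfLE (b.left.preimage_mono hW)).op).hom.comp (κ U') =
        (T.left.presheaf.map (homOfLE (b.left.preimage_mono hW)).op).hom.comp (κ' U') :=
      jetAlg_ringHom_ext fun i a => (k1 i a).trans ((RingHom.congr_fun he _).trans (k2 i a).symm)
    exact RingHom.congr_fun this x
  let ι := {W : X.left.affineOpens // (W : X.left.Opens) ≤ U ∧ (W : X.left.Opens) ≤ U'}
  refine TopCat.Sheaf.eq_of_locally_eq' T.left.sheaf (fun W : ι => b.left ⁻¹ᵁ (W.1 : X.left.Opens))
    (b.left ⁻¹ᵁ U') (fun W => homOfLE (b.left.preimage_mono W.2.2)) ?_ _ _ fun W =>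
      hres W.1 W.2.2 θ θ' (key W.1 W.2.1) (h2 U' W.1 W.2.2) (h2' U' W.1 W.2.2)
  intro t ht
  have ht' : b.left t ∈ (U : X.left.Opens) ⊓ U' := by
    refine ⟨?_, ht⟩
    change t ∈ b.left ⁻¹ᵁ (U : X.left.Opens)
    rw [hU]
    trivial
  obtain ⟨_, ⟨W, hW, rfl⟩, htW, hWU⟩ :=
    X.left.isBasis_affineOpens.exists_subset_of_mem_open ht' ((U : X.left.Opens) ⊓ U').2
  rw [TopologicalSpace.Opens.mem_iSup]
  exact ⟨⟨⟨W, hW⟩, fun y hy => (hWU hy).1, fun y hy => (hWU hy).2⟩, htW⟩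

end Charts

/-! ### Correspondence between jet points and points with values in jets -/

section Represents

variable {p : ℕ} {R : Type u} [CommRing R] {φ : R →+* R} {n : ℕ} [hφ : IsFrobeniusLift p φ]
  {X Y : Over (Spec (CommRingCat.of R))} {B B' : CommAlgCat.{u} R}

/-- The point `P` of the jet space of `X` lies in the jet space of the affine open `U`, and it
corresponds there to the point `f` of `U` with values in the ring of jets. -/
structure JetPoint.Represents (P : JetPoint p φ n X (specOver B)) (U : X.left.affineOpens)
    (f : specOver (jetObj p φ n B) ⟶ X) : Prop where
  base_eq : P.base = specOverMap (jetObjProj p φ n B) ≫ f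
  preimage_eq : f.left ⁻¹ᵁ (U : X.left.Opens) = ⊤
  coord_eq : ∀ i a, P.θ U (jetCoord p φ n (structHom X U) i a) =
    (toSections B (P.base.left ⁻¹ᵁ U)).hom ((pointHom f U preimage_eq a).coord i)

theorem toSections_pointHom (b : specOver B ⟶ X) {U : X.left.Opens} (h : b.left ⁻¹ᵁ U = ⊤)
    (a : Γ(X.left, U)) :
    (toSections B (b.left ⁻¹ᵁ U)).hom (pointHom b U h a) = b.left.app U a := by
  have hV : IsAffineOpen (b.left ⁻¹ᵁ U) := h ▸ isAffineOpen_top (Spec (CommRingCat.of B))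
  have h1 := preimage_specOverMap_toSections b hV le_rfl
  refine (pointHom_specOverMap_comp (toSections B (b.left ⁻¹ᵁ U)) b h h1 a).symm.trans ?_
  refine (pointHom_specOverMap_toSections b hV le_rfl h1 a).trans ?_
  exact congrArg (fun m : Γ(X.left, U) ⟶ _ => m.hom a) (Scheme.Hom.appLE_eq_app _)

theorem appLE_toSections (k : B ⟶ B') {V : (specOver B).left.Opens} {V' : (specOver B').left.Opens}
    (h : V' ≤ (specOverMap k).left ⁻¹ᵁ V) (b : B) :
    (specOverMap k).left.appLE V V' h ((toSections B V).hom b) =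
      (toSections B' V').hom (k.hom b) := by
  have h1 := Scheme.Hom.map_appLE (specOverMap k).left h (homOfLE le_top : V ⟶ ⊤).op
  have h2 := Scheme.ΓSpecIso_inv_naturality (CommRingCat.ofHom k.hom.toRingHom)
  refine (congrArg (fun m : Γ((specOver B).left, ⊤) ⟶ Γ((specOver B').left, V') =>
    m.hom ((Scheme.ΓSpecIso (CommRingCat.of B)).inv.hom b)) h1).trans ?_
  exact congrArg (fun m : CommRingCat.of B ⟶ Γ((specOver B').left, ⊤) =>
    (specOver B').left.presheaf.map (homOfLE le_top).op (m.hom b)) h2.symm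

namespace JetPoint

theorem Represents.preimage_base {P : JetPoint p φ n X (specOver B)} {U : X.left.affineOpens}
    {f : specOver (jetObj p φ n B) ⟶ X} (h : P.Represents U f) :
    P.base.left ⁻¹ᵁ (U : X.left.Opens) = ⊤ := by
  rw [h.base_eq]
  exact preimage_comp_eq_top _ h.preimage_eq

theorem represents_ofMap (hp : IsNilpotent (p : B)) {f : specOver (jetObj p φ n B) ⟶ X}
    (hf : ∀ U : X.left.affineOpens,
      IsAffineOpen ((specOverMap (jetObjProj p φ n B) ≫ f).left ⁻¹ᵁ U))
    {U : X.left.affineOpens} (hU : f.left ⁻¹ᵁ (U : X.left.Opens) = ⊤) :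
    (ofMap hp f hf).Represents U f where
  base_eq := rfl
  preimage_eq := hU
  coord_eq i a := by
    have h1 := pointHom_specOverMap_comp (jetObjMap p φ n (toSections B _)) f hU
      (preimage_specOverMap_jetObjMap_toSections hp f (hf U) le_rfl) a
    exact (jetAlgLift_jetCoord (C := sectionsAlg (specOver B) _) _ (pointHom_structHom _ _) _ _).trans
      ((congrArg (fun u => JetRing.coord u i) h1).trans (jetObjMap_coord p φ n _ _ i))

/-- As the preimage of `U` is all of `Spec B`, its sections are `B`, and the component of `P` at `U`
becomes a homomorphism from `Γ(X, U)` to the jets over `B`, that is, a point of `U`. -/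
theorem exists_represents (P : JetPoint p φ n X (specOver B)) {U : X.left.affineOpens}
    (hU : P.base.left ⁻¹ᵁ (U : X.left.Opens) = ⊤) :
    ∃ f, P.Represents U f := by
  let e : B ≃ₐ[R] sectionsAlg (specOver B) (P.base.left ⁻¹ᵁ U) :=
    AlgEquiv.ofBijective (toSections B (P.base.left ⁻¹ᵁ U)).hom (toSections_top_bijective B hU)
  have hr : ∀ r, P.base.left.app U (structHom X U r) =
      algebraMap R (sectionsAlg (specOver B) (P.base.left ⁻¹ᵁ U)) r := fun r =>
    (congrArg (fun m : Γ(X.left, U) ⟶ Γ((specOver B).left, P.base.left ⁻¹ᵁ U) =>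
      m.hom (structHom X U r)) (Scheme.Hom.appLE_eq_app P.base.left).symm).trans
        (appLE_structHom P.base U _ le_rfl r)
  let α := jetRingHom (C := sectionsAlg (specOver B) (P.base.left ⁻¹ᵁ U)) (P.θ U)
    fun r => (P.θ_base U _).trans (hr r)
  let β : Γ(X.left, U) →+* JetRing p φ n B :=
    (JetRing.map p φ n e.symm.toAlgHom).toRingHom.comp α
  have hβ : ∀ r, β (structHom X U r) = algebraMap R _ r := fun r =>
    (congrArg (JetRing.map p φ n e.symm.toAlgHom) (jetRingHom_algebraMap
      (C := sectionsAlg (specOver B) (P.base.left ⁻¹ᵁ U)) (P.θ U) _ r)).trans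
      (AlgHom.commutes _ r)
  obtain ⟨f, hf, hfβ⟩ := exists_pointHom_eq (B := jetObj p φ n B) U.2 β hβ
  have hc : ∀ i a, P.θ U (jetCoord p φ n (structHom X U) i a) =
      (toSections B (P.base.left ⁻¹ᵁ U)).hom ((pointHom f U hf a).coord i) := fun i a => by
    have h1 : (pointHom f U hf a).coord i = e.symm (P.θ U (jetCoord p φ n (structHom X U) i a)) := by
      rw [hfβ]
      exact JetRing.map_coord _ _ _
    rw [h1]
    exact (e.apply_symm_apply _).symm
  refine ⟨f, ?_, hf, hc⟩
  have hb := preimage_comp_eq_top (specOverMap (jetObjProj p φ n B)) hf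
  refine eq_of_pointHom_eq U.2 hU hb fun a => ?_
  rw [pointHom_specOverMap_comp (jetObjProj p φ n B) f hf hb a]
  refine Eq.trans ?_ (jetObjProj_apply p φ n B _).symm
  refine (toSections_top_bijective B hU).1 ?_
  exact (toSections_pointHom P.base hU a).trans ((P.θ_base U a).symm.trans (hc 0 a))

theorem Represents.map_unique {P : JetPoint p φ n X (specOver B)} {U : X.left.affineOpens}
    {f g : specOver (jetObj p φ n B) ⟶ X} (h : P.Represents U f) (h' : P.Represents U g) :
    f = g :=
  eq_of_pointHom_eq U.2 h.preimage_eq h'.preimage_eq fun a => JetRing.ext <| funext fun i =>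
    (toSections_top_bijective B h.preimage_base).1 ((h.coord_eq i a).symm.trans (h'.coord_eq i a))

theorem Represents.point_unique {P Q : JetPoint p φ n X (specOver B)} {U : X.left.affineOpens}
    {f : specOver (jetObj p φ n B) ⟶ X} (h : P.Represents U f) (h' : Q.Represents U f) :
    P = Q := by
  have hb : P.base = Q.base := h.base_eq.trans h'.base_eq.symm
  refine ext_of_chart hb U h.preimage_base fun i a => ?_
  have hle : P.base.left ⁻¹ᵁ (U : X.left.Opens) ≤ Q.base.left ⁻¹ᵁ U := by rw [hb]
  have h1 := congrArg (fun m => m.hom ((pointHom f U h.preimage_eq a).coord i))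
    (toSections_comp_sectionsRes B hle)
  exact (h.coord_eq i a).trans (h1.symm.trans
    (congrArg (sectionsRes (specOver B) hle).hom (h'.coord_eq i a).symm))

theorem Represents.pullback {P : JetPoint p φ n X (specOver B)} {U : X.left.affineOpens}
    {f : specOver (jetObj p φ n B) ⟶ X} (h : P.Represents U f) (k : B ⟶ B') :
    (P.pullback (specOverMap k)).Represents U (specOverMap (jetObjMap p φ n k) ≫ f) where
  base_eq := by
    rw [specOverMap_jetObjMap_comp, ← h.base_eq]
    rfl
  preimage_eq := preimage_comp_eq_top _ h.preimage_eq
  coord_eq i a := by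
    have h1 := pointHom_specOverMap_comp (jetObjMap p φ n k) f h.preimage_eq
      (preimage_comp_eq_top _ h.preimage_eq) a
    have hV : (P.pullback (specOverMap k)).base.left ⁻¹ᵁ (U : X.left.Opens) ≤
      (specOverMap k).left ⁻¹ᵁ (P.base.left ⁻¹ᵁ U) := le_rfl
    refine (congrArg ((specOverMap k).left.appLE _ _ hV) (h.coord_eq i a)).trans ?_
    refine (appLE_toSections k hV _).trans (congrArg (toSections B' _).hom ?_)
    exact (jetObjMap_coord p φ n k _ i).symm.trans (congrArg (fun u => JetRing.coord u i) h1.symm)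

theorem Represents.comp_eq_of_isImage {h : X ⟶ Y} {M : JetPoint p φ n X (specOver B)}
    {Q : JetPoint p φ n Y (specOver B)} {U : X.left.affineOpens} {V : Y.left.affineOpens}
    {m : specOver (jetObj p φ n B) ⟶ X} {f : specOver (jetObj p φ n B) ⟶ Y}
    (hM : M.Represents U m) (hQ : Q.Represents V f) (hUV : (U : X.left.Opens) ≤ h.left ⁻¹ᵁ V)
    (hi : M.IsImage h Q) : m ≫ h = f := by
  have hV : (m ≫ h).left ⁻¹ᵁ (V : Y.left.Opens) = ⊤ := by
    rw [eq_top_iff, ← hM.preimage_eq]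
    exact m.left.preimage_mono hUV
  refine eq_of_pointHom_eq V.2 hV hQ.preimage_eq fun a => JetRing.ext <| funext fun i => ?_
  obtain ⟨hb, hi⟩ := hi
  have hle : M.base.left ⁻¹ᵁ (U : X.left.Opens) ≤ Q.base.left ⁻¹ᵁ V := by
    rw [← hb]
    exact M.base.left.preimage_mono hUV
  have h1 := congrArg (fun k => k.hom ((pointHom f V hQ.preimage_eq a).coord i))
    (toSections_comp_sectionsRes B hle)
  rw [pointHom_comp m h hUV hM.preimage_eq hV]
  refine (toSections_top_bijective B hM.preimage_base).1 ?_
  refine (hM.coord_eq i _).symm.trans ((hi V U hUV i a).symm.trans ?_)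
  exact (congrArg (sectionsRes (specOver B) hle).hom (hQ.coord_eq i a)).trans h1

theorem isImage_ofMap (hp : IsNilpotent (p : B)) (h : X ⟶ Y)
    {m : specOver (jetObj p φ n B) ⟶ X} {f : specOver (jetObj p φ n B) ⟶ Y} (e : m ≫ h = f)
    (hm : ∀ U : X.left.affineOpens,
      IsAffineOpen ((specOverMap (jetObjProj p φ n B) ≫ m).left ⁻¹ᵁ U))
    (hf : ∀ U : Y.left.affineOpens,
      IsAffineOpen ((specOverMap (jetObjProj p φ n B) ≫ f).left ⁻¹ᵁ U)) :
    (ofMap hp m hm).IsImage h (ofMap hp f hf) := by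
  subst e
  refine ⟨Category.assoc _ _ _, fun V U hUV i a => ?_⟩
  have hV := preimage_specOverMap_jetObjMap_toSections hp (m ≫ h) (hf V) le_rfl
  have hU := preimage_specOverMap_jetObjMap_toSections hp m (hm U) le_rfl
  let b := specOverMap (jetObjProj p φ n B) ≫ m
  let b' := specOverMap (jetObjProj p φ n B) ≫ m ≫ h
  have hb : b.left ⁻¹ᵁ (U : X.left.Opens) ≤ b'.left ⁻¹ᵁ V := b.left.preimage_mono hUV
  have h1 := jetObjMap_coord p φ n (sectionsRes (specOver B) hb)
    (pointHom _ V (preimage_specOverMap_jetObjMap_toSections hp (m ≫ h) (hf V) le_rfl) a) i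
  have h2 := pointHom_specOverMap_comp (jetObjMap p φ n (sectionsRes (specOver B) hb)) _ hV
    (preimage_comp_eq_top _ hV) a
  have h3 : specOverMap (jetObjMap p φ n (sectionsRes (specOver B) hb)) ≫
      specOverMap (jetObjMap p φ n (toSections B (b'.left ⁻¹ᵁ V))) ≫ m ≫ h =
      (specOverMap (jetObjMap p φ n (toSections B (b.left ⁻¹ᵁ U))) ≫ m) ≫ h := by
    rw [← Category.assoc, ← specOverMap_comp, ← jetObjMap_comp, toSections_comp_sectionsRes,
      Category.assoc]
  have h4 := pointHom_congr h3 (preimage_comp_eq_top _ hV) (h3 ▸ preimage_comp_eq_top _ hV)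
  have h5 := pointHom_comp (specOverMap (jetObjMap p φ n (toSections B (b.left ⁻¹ᵁ U))) ≫ m) h hUV
    hU (h3 ▸ preimage_comp_eq_top _ hV) a
  refine (congrArg (sectionsRes (specOver B) hb).hom
    (jetAlgLift_jetCoord (C := sectionsAlg (specOver B) _) _ (pointHom_structHom _ _) _ _)).trans
    (Eq.trans ?_ (jetAlgLift_jetCoord (C := sectionsAlg (specOver B) _) _
      (pointHom_structHom _ _) _ _).symm)
  exact h1.symm.trans (congrArg (fun u => JetRing.coord u i)
    (h2.symm.trans ((RingHom.congr_fun h4 a).trans h5)))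

end JetPoint

end Represents

/-! ### Jet spaces of affine schemes with étale coordinates -/

section LocalStructure

variable {p : ℕ} {R : Type u} [CommRing R] {φ : R →+* R} {n d : ℕ} [hφ : IsFrobeniusLift p φ]
  {X : Over (Spec (CommRingCat.of R))} {B B' : CommAlgCat.{u} R}

theorem isAffineOpen_preimage_of_isAffineOpen_top (hX : IsAffineOpen (⊤ : X.left.Opens))
    (b : specOver B ⟶ X) (U : X.left.affineOpens) :
    IsAffineOpen (b.left ⁻¹ᵁ (U : X.left.Opens)) := by
  have : IsAffine X.left := by
    have : IsAffine (⊤ : X.left.Opens) := hX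
    exact IsAffine.of_isIso X.left.topIso.inv
  have : IsAffine (specOver B).left := inferInstanceAs (IsAffine (Spec (CommRingCat.of B)))
  exact U.2.preimage b.left

variable (n) in
theorem JetPoint.existsUnique_of_etale (hX : IsAffineOpen (⊤ : X.left.Opens))
    {g : MvPolynomial (Fin d) R →+* Γ(X.left, ⊤)}
    (hg : g.comp MvPolynomial.C = structHom X ⊤) (he : g.Etale) (hp : IsNilpotent (p : B))
    (b : specOver B ⟶ X) (t : Fin n × Fin d → B) :
    ∃! f : specOver (jetObj p φ n B) ⟶ X, specOverMap (jetObjProj p φ n B) ≫ f = b ∧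
      ∀ i j, (pointHom f ⊤ rfl (g (MvPolynomial.X j))).coord (Fin.succ i) = t (i, j) := by
  have key := existsUnique_lift_of_etale hg he (JetRing.proj p φ n B) JetRing.proj_surjective
    (JetRing.isNilpotent_ker_proj hp) (pointHom b ⊤ rfl) (pointHom_structHom b rfl)
    -- The order-zero component of each coordinate is dictated by `b`; the components of orders `1,
    -- …, n` are the free parameters `t`.
    (fun j => ⟨Fin.cons (pointHom b ⊤ rfl (g (MvPolynomial.X j))) fun i => t (i, j)⟩)
    (fun j => JetRing.proj_apply _)
  obtain ⟨h, ⟨h1, h2, h3⟩, h4⟩ := key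
  obtain ⟨f, hf, rfl⟩ := exists_pointHom_eq (B := jetObj p φ n B) hX h h1
  refine ⟨f, ⟨?_, fun i j => ?_⟩, fun f' hf' => ?_⟩
  · refine eq_of_pointHom_eq hX rfl rfl fun a => ?_
    exact (pointHom_specOverMap_comp (jetObjProj p φ n B) f rfl rfl a).trans (h2 a)
  · exact congrArg (fun u => JetRing.coord u i.succ) (h3 j)
  · refine eq_of_pointHom_eq hX rfl rfl fun a => ?_
    have h5 : ∀ a, (jetObjProj p φ n B).hom (pointHom f' ⊤ rfl a) = pointHom b ⊤ rfl a := fun a =>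
      (pointHom_specOverMap_comp (jetObjProj p φ n B) f' rfl rfl a).symm.trans
        (RingHom.congr_fun (pointHom_congr hf'.1 rfl rfl) a)
    refine RingHom.congr_fun (h4 _ ⟨pointHom_structHom f' rfl, h5, fun j => ?_⟩) a
    refine JetRing.ext (funext fun i => ?_)
    refine Fin.cases ?_ (fun i => ?_) i
    · exact (jetObjProj_apply p φ n B _).symm.trans (h5 _)
    · exact hf'.2 i j

theorem JetPoint.exists_represents_top (hX : IsAffineOpen (⊤ : X.left.Opens))
    (P : JetPoint p φ n X (specOver B)) : ∃ f, P.Represents ⟨⊤, hX⟩ f :=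
  P.exists_represents rfl

/-- The coordinates of positive order of a point of the jet space of an affine scheme. -/
def JetPoint.etaleCoord (hX : IsAffineOpen (⊤ : X.left.Opens))
    (g : MvPolynomial (Fin d) R →+* Γ(X.left, ⊤)) (P : JetPoint p φ n X (specOver B))
    (v : Fin n × Fin d) : B :=
  (pointHom (P.exists_represents_top hX).choose ⊤ rfl (g (MvPolynomial.X v.2))).coord v.1.succ

theorem JetPoint.Represents.etaleCoord_eq {hX : IsAffineOpen (⊤ : X.left.Opens)}
    (g : MvPolynomial (Fin d) R →+* Γ(X.left, ⊤)) {P : JetPoint p φ n X (specOver B)}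
    {f : specOver (jetObj p φ n B) ⟶ X} (h : P.Represents ⟨⊤, hX⟩ f) (v : Fin n × Fin d) :
    P.etaleCoord hX g v = (pointHom f ⊤ rfl (g (MvPolynomial.X v.2))).coord v.1.succ := by
  obtain rfl := h.map_unique (P.exists_represents_top hX).choose_spec
  rfl

theorem JetPoint.etaleCoord_pullback (hX : IsAffineOpen (⊤ : X.left.Opens))
    (g : MvPolynomial (Fin d) R →+* Γ(X.left, ⊤)) (P : JetPoint p φ n X (specOver B)) (k : B ⟶ B')
    (v : Fin n × Fin d) :
    (P.pullback (specOverMap k)).etaleCoord hX g v = k.hom (P.etaleCoord hX g v) := by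
  obtain ⟨f, hf⟩ := P.exists_represents_top hX
  rw [(hf.pullback k).etaleCoord_eq g, hf.etaleCoord_eq g]
  exact (congrArg (fun u => JetRing.coord u v.1.succ)
    (pointHom_specOverMap_comp (jetObjMap p φ n k) f rfl rfl _)).trans (jetObjMap_coord p φ n k _ _)

theorem JetPoint.bijective_etaleCoord (hX : IsAffineOpen (⊤ : X.left.Opens))
    {g : MvPolynomial (Fin d) R →+* Γ(X.left, ⊤)}
    (hg : g.comp MvPolynomial.C = structHom X ⊤) (he : g.Etale) (hp : IsNilpotent (p : B)) :
    Function.Bijective fun P : JetPoint p φ n X (specOver B) => (P.base, P.etaleCoord hX g) := by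
  refine ⟨fun P Q hPQ => ?_, fun ⟨b, t⟩ => ?_⟩
  · obtain ⟨f, hf⟩ := P.exists_represents_top hX
    obtain ⟨f', hf'⟩ := Q.exists_represents_top hX
    have h1 : P.base = Q.base := congrArg Prod.fst hPQ
    have h2 : P.etaleCoord hX g = Q.etaleCoord hX g := congrArg Prod.snd hPQ
    obtain rfl : f = f' := by
      refine (existsUnique_of_etale (φ := φ) n hX hg he hp P.base (P.etaleCoord hX g)).unique
        ⟨hf.base_eq.symm, fun i j => (hf.etaleCoord_eq g (i, j)).symm⟩
        ⟨hf'.base_eq.symm.trans h1.symm, fun i j => ?_⟩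
      rw [h2]
      exact (hf'.etaleCoord_eq g (i, j)).symm
    exact hf.point_unique hf'
  · obtain ⟨f, ⟨h1, h2⟩, -⟩ := existsUnique_of_etale (φ := φ) n hX hg he hp b t
    have hf := represents_ofMap hp (f := f)
      (isAffineOpen_preimage_of_isAffineOpen_top hX _) (U := ⟨⊤, hX⟩) rfl
    refine ⟨JetPoint.ofMap hp f (isAffineOpen_preimage_of_isAffineOpen_top hX _), Prod.ext h1 (funext fun v => ?_)⟩
    exact (hf.etaleCoord_eq g v).trans (h2 v.1 v.2)

theorem exists_jetSpace_iso_of_etale (n : ℕ) (hX : IsAffineOpen (⊤ : X.left.Opens))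
    {g : MvPolynomial (Fin d) R →+* Γ(X.left, ⊤)}
    (hg : g.comp MvPolynomial.C = structHom X ⊤) (he : g.Etale) :
    ∃ e : jetSpace p φ n X ≅ FunctorToTypes.prod (completion p X) (affineSpace p R (Fin n × Fin d)),
      e.hom ≫ FunctorToTypes.prod.fst = jetProj p φ n X := by
  let τ : jetSpace p φ n X ⟶ affineSpace p R (Fin n × Fin d) :=
    { app := fun B => TypeCat.ofHom fun P : JetPoint p φ n X (specOver B.obj) =>
        P.etaleCoord hX g
      naturality := fun B B' k => by
        ext P
        exact funext fun v => JetPoint.etaleCoord_pullback hX g P k.hom v }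
  let σ := FunctorToTypes.prod.lift (jetProj p φ n X) τ
  have : ∀ B, IsIso (σ.app B) := fun B => (isIso_iff_bijective _).mpr
    (JetPoint.bijective_etaleCoord hX hg he B.property)
  have : IsIso σ := NatIso.isIso_of_isIso_app σ
  exact ⟨asIso σ, FunctorToTypes.prod.lift_fst _ _⟩

theorem exists_iSup_eq_top_and_etale (hX : SmoothOfRelativeDimension d X.hom) :
    ∃ (I : Type u) (U : I → X.left.affineOpens), (⨆ i, (U i : X.left.Opens)) = ⊤ ∧
      ∀ i, ∃ g : MvPolynomial (Fin d) R →+* Γ((U i : X.left.Opens).toScheme, ⊤),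
        g.comp MvPolynomial.C = structHom (Over.mk ((U i : X.left.Opens).ι ≫ X.hom)) ⊤ ∧
          g.Etale := by
  choose U hU g hg he using exists_etale_coordinates X hX
  refine ⟨X.left, U, ?_, fun x => ?_⟩
  · rw [eq_top_iff]
    intro x _
    exact TopologicalSpace.Opens.mem_iSup.mpr ⟨x, hU x⟩
  · have hle : (⊤ : (U x : X.left.Opens).toScheme.Opens) ≤ (U x : X.left.Opens).ι ⁻¹ᵁ (U x) := by
      simp
    have hiso : IsIso ((U x : X.left.Opens).ι.appLE (U x) ⊤ hle) := by
      have h : (U x : X.left.Opens).ι ''ᵁ ⊤ = U x := by simp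
      rw [Scheme.Opens.ι_appLE]
      exact inferInstanceAs (IsIso (X.left.presheaf.map (eqToHom h).op))
    refine ⟨((U x : X.left.Opens).ι.appLE (U x) ⊤ hle).hom.comp (g x), ?_, ?_⟩
    · rw [RingHom.comp_assoc, hg]
      ext r
      exact appLE_structHom (Over.homMk (U x : X.left.Opens).ι :
        Over.mk ((U x : X.left.Opens).ι ≫ X.hom) ⟶ X) _ _ hle r
    · exact RingHom.Etale.respectsIso.1 _
        (asIso ((U x : X.left.Opens).ι.appLE (U x) ⊤ hle)).commRingCatIsoToRingEquiv (he x)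

end LocalStructure

/-! ### Formal group laws from natural operations on nilpotent elements -/

section NaturalOperations

variable {R : Type u} [CommRing R] {τ : Type}

theorem aeval_eq_zero_of_mem_pow_idealOfVars {B : Type*} [CommRing B] [Algebra R B] {y : τ → B}
    {N : ℕ} (hN : Ideal.span (Set.range y) ^ N = ⊥) {f : MvPolynomial τ R}
    (hf : f ∈ MvPolynomial.idealOfVars τ R ^ N) : MvPolynomial.aeval y f = 0 := by
  have h1 : (MvPolynomial.idealOfVars τ R ^ N).map (MvPolynomial.aeval y) ≤ ⊥ := by
    rw [Ideal.map_pow, MvPolynomial.idealOfVars, Ideal.map_span, ← hN]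
    refine Ideal.pow_right_mono (Ideal.span_mono ?_) N
    rintro _ ⟨_, ⟨s, rfl⟩, rfl⟩
    exact ⟨s, (MvPolynomial.aeval_X y s).symm⟩
  exact h1 (Ideal.mem_map_of_mem _ hf)

/-- A Yoneda argument for the pro-representable functor of nilpotent tuples: the operation is
determined by its values on the universal tuples in `R[τ] / (τ)^k`, and these values fit together to
a power series. -/
theorem exists_eq_evalSeries_of_natural [Finite τ]
    (m : ∀ B : CommAlgCat.{u} R, (τ → nilradical B) → nilradical B)
    (hm : ∀ {B B' : CommAlgCat.{u} R} (k : B ⟶ B') (t : τ → nilradical B)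
      (t' : τ → nilradical B'), (∀ s, (t' s : B') = k.hom (t s)) → (m B' t' : B') = k.hom (m B t)) :
    ∃ F : MvPowerSeries τ R, ∀ (B : CommAlgCat.{u} R) (t : τ → nilradical B),
      (m B t : B) = evalSeries F fun s => (t s : B) := by
  let A : ℕ → CommAlgCat.{u} R := fun k =>
    CommAlgCat.of R (MvPolynomial τ R ⧸ MvPolynomial.idealOfVars τ R ^ k)
  let q : ∀ k, MvPolynomial τ R →ₐ[R] A k := fun k => Ideal.Quotient.mkₐ R _
  have hq0 : ∀ k f, q k f = 0 ↔ f ∈ MvPolynomial.idealOfVars τ R ^ k := fun k f =>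
    Ideal.Quotient.eq_zero_iff_mem
  have hx : ∀ k s, q k (MvPolynomial.X s) ∈ nilradical (A k) := fun k s => by
    refine mem_nilradical.mpr ⟨k, ?_⟩
    rw [← map_pow, hq0]
    exact Ideal.pow_mem_pow (Ideal.subset_span (Set.mem_range_self s)) k
  let x : ∀ k, τ → nilradical (A k) := fun k s => ⟨q k (MvPolynomial.X s), hx k s⟩
  have hP : ∀ k, ∃ f, q k f = m (A k) (x k) := fun k => Ideal.Quotient.mk_surjective _
  choose P hP using hP
  have key : ∀ (B : CommAlgCat.{u} R) (t : τ → nilradical B) (N : ℕ),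
      Ideal.span (Set.range fun s => (t s : B)) ^ N = ⊥ →
      (m B t : B) = MvPolynomial.aeval (fun s => (t s : B)) (P N) := by
    intro B t N hN
    let k : A N ⟶ B := CommAlgCat.ofHom (Ideal.Quotient.liftₐ _
      (MvPolynomial.aeval fun s => (t s : B)) fun f hf =>
        aeval_eq_zero_of_mem_pow_idealOfVars hN hf)
    have hk : ∀ f, k.hom (q N f) = MvPolynomial.aeval (fun s => (t s : B)) f := fun f => rfl
    rw [hm k (x N) t fun s => ?_, ← hP, hk]
    exact ((hk _).trans (MvPolynomial.aeval_X _ s)).symm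
  have hcomp : ∀ k N, k ≤ N → P k - P N ∈ MvPolynomial.idealOfVars τ R ^ k := by
    intro k N hkN
    rw [← hq0, map_sub, sub_eq_zero, hP]
    have h1 : Ideal.span (Set.range fun s => ((x k s : nilradical (A k)) : A k)) ^ N = ⊥ := by
      have h2 : Ideal.span (Set.range fun s => ((x k s : nilradical (A k)) : A k)) =
          (MvPolynomial.idealOfVars τ R).map (q k) := by
        refine Eq.trans ?_ (Ideal.map_span (q k) (Set.range MvPolynomial.X)).symm
        rw [← Set.range_comp]
        rfl
      rw [h2, ← Ideal.map_pow, eq_bot_iff, Ideal.map_le_iff_le_comap]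
      intro f hf
      exact (hq0 k f).mpr (Ideal.pow_le_pow_right hkN hf)
    rw [key _ _ N h1]
    have h3 : MvPolynomial.aeval (fun s => ((x k s : nilradical (A k)) : A k)) = q k :=
      MvPolynomial.algHom_ext fun s => MvPolynomial.aeval_X _ s
    rw [h3]
  -- The quotient by the power `e.degree + 1` is the first one in which the coefficient at `e` is
  -- well defined.
  let F : MvPowerSeries τ R := fun e => (P (e.degree + 1)).coeff e
  have hF : ∀ e N, e.degree < N → MvPowerSeries.coeff e F = (P N).coeff e := by
    intro e N he
    have h1 := (MvPolynomial.mem_pow_idealOfVars_iff' (e.degree + 1) _).mp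
      (hcomp (e.degree + 1) N he) e (Nat.lt_succ_self _)
    rw [MvPolynomial.coeff_sub, sub_eq_zero] at h1
    exact h1
  refine ⟨F, fun B t => ?_⟩
  have hfg : (Ideal.span (Set.range fun s => (t s : B))).FG :=
    ⟨(Set.finite_range fun s => (t s : B)).toFinset, by simp⟩
  have hle : Ideal.span (Set.range fun s => (t s : B)) ≤ nilradical B := by
    rw [Ideal.span_le]
    rintro _ ⟨s, rfl⟩
    exact (t s).2
  obtain ⟨N, hN⟩ := (Ideal.FG.isNilpotent_iff_le_nilradical hfg).mpr hle
  rw [key B t N hN, evalSeries_eq_aeval_truncTotal hN F fun s => Ideal.subset_span (Set.mem_range_self s),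
    ← sub_eq_zero, ← map_sub]
  refine aeval_eq_zero_of_mem_pow_idealOfVars hN
    ((MvPolynomial.mem_pow_idealOfVars_iff' N _).mpr fun e he => ?_)
  rw [MvPolynomial.coeff_sub, MvPowerSeries.coeff_truncTotal _ he, hF e N he, sub_self]

end NaturalOperations

/-! ### The formal completion along the unit section -/

section FormalCompletion

variable {R : Type u} [CommRing R] {d : ℕ} {G : Over (Spec (CommRingCat.of R))} [GrpObj G]
  {B B' : CommAlgCat.{u} R}

variable (G B) in
/-- The unit of the group of points of `G` with values in `B`. -/
abbrev unitPoint : specOver B ⟶ G :=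
  toUnit _ ≫ MonObj.one (X := G)

theorem comp_unitPoint (k : B ⟶ B') : specOverMap k ≫ unitPoint G B = unitPoint G B' := by
  rw [unitPoint, ← Category.assoc]
  congr 1
  exact toUnit_unique _ _

/-- The structure homomorphism of an `R`-algebra. -/
def algebraMapHom (B : CommAlgCat.{u} R) : CommAlgCat.of R R ⟶ B :=
  CommAlgCat.ofHom (Algebra.ofId R B)

theorem lift_unitPoint_comp_mul : lift (unitPoint G B) (unitPoint G B) ≫ MonObj.mul (X := G) =
    unitPoint G B :=
  MonObj.lift_comp_one_left _ _

variable (R) in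
/-- The closed point of the spectrum of a local ring. -/
def specClosedPoint [IsLocalRing R] : (specOver (CommAlgCat.of R R)).left :=
  let x : PrimeSpectrum R := IsLocalRing.closedPoint R
  x

/-- Over a local base the only open neighbourhood of the closed point is everything, so a section
lies in any chart that contains its closed point. -/
theorem preimage_eq_top_of_specClosedPoint_mem [IsLocalRing R] {X : Over (Spec (CommRingCat.of R))}
    (s : specOver (CommAlgCat.of R R) ⟶ X) {V : X.left.Opens}
    (h : s.left (specClosedPoint R) ∈ V) : s.left ⁻¹ᵁ V = ⊤ :=
  let W : TopologicalSpace.Opens (PrimeSpectrum R) := s.left ⁻¹ᵁ V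
  (IsLocalRing.closedPoint_mem_iff W).mp h

/-- An affine neighbourhood of the unit section of a group scheme. -/
structure UnitChart (G : Over (Spec (CommRingCat.of R))) [GrpObj G] (d : ℕ) where
  U : G.left.affineOpens
  preimage_eq : (unitPoint G (CommAlgCat.of R R)).left ⁻¹ᵁ (U : G.left.Opens) = ⊤
  g : MvPolynomial (Fin d) R →+* Γ(G.left, U)
  comp_C : g.comp MvPolynomial.C = structHom G U
  etale : g.Etale

theorem exists_unitChart [IsLocalRing R] (hG : SmoothOfRelativeDimension d G.hom) :
    Nonempty (UnitChart G d) := by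
  obtain ⟨U, hU, g, hg, he⟩ := exists_etale_coordinates G hG
    ((unitPoint G (CommAlgCat.of R R)).left (specClosedPoint R))
  exact ⟨⟨U, preimage_eq_top_of_specClosedPoint_mem _ hU, g, hg, he⟩⟩

namespace UnitChart

variable (𝓒 : UnitChart G d)

/-- The restriction of functions to the unit section. -/
def ε : Γ(G.left, 𝓒.U) →+* R :=
  pointHom (unitPoint G (CommAlgCat.of R R)) 𝓒.U 𝓒.preimage_eq

theorem preimage_unitPoint (B : CommAlgCat.{u} R) :
    (unitPoint G B).left ⁻¹ᵁ (𝓒.U : G.left.Opens) = ⊤ := by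
  rw [← comp_unitPoint (algebraMapHom B)]
  exact preimage_comp_eq_top _ 𝓒.preimage_eq

theorem pointHom_unitPoint (a : Γ(G.left, 𝓒.U)) :
    pointHom (unitPoint G B) 𝓒.U (𝓒.preimage_unitPoint B) a = algebraMap R B (𝓒.ε a) := by
  have h := pointHom_specOverMap_comp (algebraMapHom B) _ 𝓒.preimage_eq
    (preimage_comp_eq_top _ 𝓒.preimage_eq) a
  exact (RingHom.congr_fun (pointHom_congr (comp_unitPoint (algebraMapHom B)) _ _) a).symm.trans h

/-- Being the unit over the reduced spectrum forces `f` into the chart topologically. There it says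
that functions of the chart agree at `f` and at the unit modulo nilpotents. -/
theorem mem_formalCompletion_iff (f : specOver B ⟶ G) :
    f ∈ (formalCompletion G).obj B ↔ ∃ h : f.left ⁻¹ᵁ (𝓒.U : G.left.Opens) = ⊤,
      ∀ a, pointHom f 𝓒.U h a - algebraMap R B (𝓒.ε a) ∈ nilradical B := by
  let q : B ⟶ CommAlgCat.of R (B ⧸ nilradical B) :=
    CommAlgCat.ofHom (Ideal.Quotient.mkₐ R (nilradical B))
  have hq : ∀ x, q.hom x = 0 ↔ x ∈ nilradical B := fun x => Ideal.Quotient.eq_zero_iff_mem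
  have hiff : ∀ h : f.left ⁻¹ᵁ (𝓒.U : G.left.Opens) = ⊤, ∀ a,
      pointHom (specOverMap q ≫ f) 𝓒.U (preimage_comp_eq_top _ h) a =
        pointHom (unitPoint G _) 𝓒.U (𝓒.preimage_unitPoint _) a ↔
      pointHom f 𝓒.U h a - algebraMap R B (𝓒.ε a) ∈ nilradical B := by
    intro h a
    rw [← hq, map_sub, sub_eq_zero, 𝓒.pointHom_unitPoint, AlgHom.commutes,
      pointHom_specOverMap_comp q f h]
  constructor
  · intro hf
    have hf' : specOverMap q ≫ f = unitPoint G _ := hf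
    have h : f.left ⁻¹ᵁ (𝓒.U : G.left.Opens) = ⊤ := by
      refine preimage_eq_top_of_specOverMap_comp (k := q) (Ideal.Quotient.mk_surjective)
        (fun x hx => (hq x).mp hx) ?_
      rw [hf']
      exact 𝓒.preimage_unitPoint _
    exact ⟨h, fun a => (hiff h a).mp (RingHom.congr_fun (pointHom_congr hf' _ _) a)⟩
  · rintro ⟨h, ha⟩
    exact eq_of_pointHom_eq 𝓒.U.2 (preimage_comp_eq_top _ h) (𝓒.preimage_unitPoint _)
      fun a => (hiff h a).mpr (ha a)

/-- The formal coordinates of a point of the formal completion. -/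
def coord (f : (formalCompletion G).obj B) (j : Fin d) : nilradical B :=
  ⟨pointHom f.1 𝓒.U ((𝓒.mem_formalCompletion_iff f.1).mp f.2).choose
    (𝓒.g (MvPolynomial.X j) - structHom G 𝓒.U (𝓒.ε (𝓒.g (MvPolynomial.X j)))), by
      rw [map_sub, pointHom_structHom]
      exact ((𝓒.mem_formalCompletion_iff f.1).mp f.2).choose_spec _⟩

theorem ε_structHom (r : R) : 𝓒.ε (structHom G 𝓒.U r) = r :=
  pointHom_structHom (unitPoint G (CommAlgCat.of R R)) 𝓒.preimage_eq r

theorem bijective_coord : Function.Bijective (𝓒.coord : (formalCompletion G).obj B → _) := by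
  refine ⟨fun f f' hff' => ?_, fun t => ?_⟩
  · obtain ⟨h, ha⟩ := (𝓒.mem_formalCompletion_iff f.1).mp f.2
    obtain ⟨h', ha'⟩ := (𝓒.mem_formalCompletion_iff f'.1).mp f'.2
    refine Subtype.ext (eq_of_pointHom_eq 𝓒.U.2 h h' (RingHom.congr_fun ?_))
    refine (existsUnique_lift_nil_of_etale 𝓒.comp_C 𝓒.etale 𝓒.ε 𝓒.ε_structHom (𝓒.coord f)).unique
      ⟨pointHom_structHom _ _, ha, fun j => rfl⟩ ⟨pointHom_structHom _ _, ha', fun j => ?_⟩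
    rw [hff']
    rfl
  · obtain ⟨h, ⟨h1, h2, h3⟩, -⟩ :=
      existsUnique_lift_nil_of_etale 𝓒.comp_C 𝓒.etale 𝓒.ε 𝓒.ε_structHom t
    obtain ⟨f, hf, rfl⟩ := exists_pointHom_eq 𝓒.U.2 h h1
    exact ⟨⟨f, (𝓒.mem_formalCompletion_iff f).mpr ⟨hf, h2⟩⟩,
      funext fun j => Subtype.ext (h3 j)⟩

/-- The formal coordinates attached to étale coordinates near the unit section. -/
theorem nonempty_iso_formalAffineSpace (𝓒 : UnitChart G d) :
    Nonempty ((formalCompletion G).toFunctor ≅ formalAffineSpace R d) := by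
  let σ : (formalCompletion G).toFunctor ⟶ formalAffineSpace R d :=
    { app := fun B => TypeCat.ofHom fun f : (formalCompletion G).obj B => 𝓒.coord f
      naturality := fun B B' k => by
        ext f
        refine funext fun j => Subtype.ext ?_
        exact pointHom_specOverMap_comp k f.1 ((𝓒.mem_formalCompletion_iff f.1).mp f.2).choose _ _ }
  have : ∀ B, IsIso (σ.app B) := fun B => (isIso_iff_bijective _).mpr 𝓒.bijective_coord
  have : IsIso σ := NatIso.isIso_of_isIso_app σ
  exact ⟨asIso σ⟩

end UnitChart

end FormalCompletion

/-! ### The group law on the formal completion as a tuple of power series -/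

section GroupLaw

variable {R : Type u} [CommRing R] {d : ℕ} {G : Over (Spec (CommRingCat.of R))} [GrpObj G]
  {B B' : CommAlgCat.{u} R}

theorem lift_comp_mul_mem_formalCompletion {g h : specOver B ⟶ G}
    (hg : g ∈ (formalCompletion G).obj B) (hh : h ∈ (formalCompletion G).obj B) :
    lift g h ≫ MonObj.mul (X := G) ∈ (formalCompletion G).obj B := by
  let q : B ⟶ CommAlgCat.of R (B ⧸ nilradical B) :=
    CommAlgCat.ofHom (Ideal.Quotient.mkₐ R (nilradical B))
  have hg' : specOverMap q ≫ g = unitPoint G _ := hg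
  have hh' : specOverMap q ≫ h = unitPoint G _ := hh
  change specOverMap q ≫ lift g h ≫ MonObj.mul (X := G) = unitPoint G _
  rw [← Category.assoc, comp_lift, hg', hh', lift_unitPoint_comp_mul]

/-- The product of two points of the formal completion. -/
def formalMul (g h : (formalCompletion G).toFunctor.obj B) :
    (formalCompletion G).toFunctor.obj B :=
  ⟨lift g.1 h.1 ≫ MonObj.mul (X := G), lift_comp_mul_mem_formalCompletion g.2 h.2⟩

theorem formalMul_map (k : B ⟶ B') (g h : (formalCompletion G).toFunctor.obj B) :
    formalMul ((formalCompletion G).toFunctor.map k g) ((formalCompletion G).toFunctor.map k h) =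
      (formalCompletion G).toFunctor.map k (formalMul g h) := by
  refine Subtype.ext ?_
  change lift (specOverMap k ≫ g.1) (specOverMap k ≫ h.1) ≫ MonObj.mul (X := G) =
    specOverMap k ≫ lift g.1 h.1 ≫ MonObj.mul (X := G)
  rw [← comp_lift, Category.assoc]

variable (c : (formalCompletion G).toFunctor ≅ formalAffineSpace R d)

theorem formalCoord_map (k : B ⟶ B') (g : (formalCompletion G).toFunctor.obj B) (j : Fin d) :
    (c.hom.app B' ((formalCompletion G).toFunctor.map k g) j : B') = k.hom (c.hom.app B g j) := by
  have h := ConcreteCategory.congr_hom (c.hom.naturality k) g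
  exact congrArg Subtype.val (congrFun h j)

theorem formalCoord_inv (t : Fin d → nilradical B) : c.hom.app B (c.inv.app B t) = t :=
  ConcreteCategory.congr_hom (c.inv_hom_id_app B) t

theorem formalCoord_injective : Function.Injective (c.hom.app B) := fun g h hgh => by
  have h1 : ∀ g, c.inv.app B (c.hom.app B g) = g :=
    ConcreteCategory.congr_hom (c.hom_inv_id_app B)
  rw [← h1 g, hgh, h1 h]

theorem exists_isFormalGroupLaw (c : (formalCompletion G).toFunctor ≅ formalAffineSpace R d) :
    ∃ F : Fin d → MvPowerSeries (Fin d ⊕ Fin d) R, IsFormalGroupLaw G F := by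
  let m : Fin d → ∀ B : CommAlgCat.{u} R, (Fin d ⊕ Fin d → nilradical B) → nilradical B :=
    fun j B t => c.hom.app B (formalMul (c.inv.app B fun a => t (.inl a))
      (c.inv.app B fun a => t (.inr a))) j
  have hinv : ∀ {B B' : CommAlgCat.{u} R} (k : B ⟶ B') (t : Fin d → nilradical B)
      (t' : Fin d → nilradical B') (_ : ∀ a, (t' a : B') = k.hom (t a)),
      c.inv.app B' t' = (formalCompletion G).toFunctor.map k (c.inv.app B t) := by
    intro B B' k t t' h
    apply formalCoord_injective c
    rw [formalCoord_inv]
    refine funext fun a => Subtype.ext ?_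
    rw [formalCoord_map, formalCoord_inv, h]
  have hm : ∀ (j : Fin d) {B B' : CommAlgCat.{u} R} (k : B ⟶ B') (t : Fin d ⊕ Fin d → nilradical B)
      (t' : Fin d ⊕ Fin d → nilradical B'), (∀ s, (t' s : B') = k.hom (t s)) →
      (m j B' t' : B') = k.hom (m j B t) := by
    intro j B B' k t t' h
    have h1 := hinv k (fun a => t (.inl a)) (fun a => t' (.inl a)) fun a => h _
    have h2 := hinv k (fun a => t (.inr a)) (fun a => t' (.inr a)) fun a => h _
    change (c.hom.app B' (formalMul (c.inv.app B' fun a => t' (.inl a))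
      (c.inv.app B' fun a => t' (.inr a))) j : B') = _
    rw [h1, h2, formalMul_map, formalCoord_map]
  choose F hF using fun j => exists_eq_evalSeries_of_natural (m j) (hm j)
  refine ⟨F, c, fun B g h k hk j => ?_⟩
  have h1 : ∀ g, c.inv.app B (c.hom.app B g) = g :=
    ConcreteCategory.congr_hom (c.hom_inv_id_app B)
  have hk' : k = formalMul g h := Subtype.ext hk
  have h2 := hF j B (Sum.elim (c.hom.app B g) (c.hom.app B h))
  have h3 : m j B (Sum.elim (c.hom.app B g) (c.hom.app B h)) = c.hom.app B k j := by
    change c.hom.app B (formalMul (c.inv.app B (c.hom.app B g)) (c.inv.app B (c.hom.app B h))) j = _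
    rw [h1, h1, hk']
  rw [h3] at h2
  refine h2.trans (congrArg (evalSeries (F j)) (funext fun s => ?_))
  cases s <;> rfl

end GroupLaw

/-! ### The kernel of the projection from the jet space of a group -/

section Kernel

variable {p : ℕ} {R : Type u} [CommRing R] {φ : R →+* R} {n d : ℕ}
  {G X : Over (Spec (CommRingCat.of R))} [GrpObj G] {B B' : CommAlgCat.{u} R}

theorem comap_algebraMap_eq_closedPoint {B : Type*} [CommRing B] [Algebra R B] [IsLocalRing R]
    (hR : IsLocalRing.maximalIdeal R = Ideal.span {(p : R)}) (hp : IsNilpotent (p : B))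
    (x : PrimeSpectrum B) :
    PrimeSpectrum.comap (algebraMap R B) x = IsLocalRing.closedPoint R := by
  refine PrimeSpectrum.ext ((IsLocalRing.maximalIdeal.isMaximal R).eq_of_le
    (PrimeSpectrum.isPrime _).ne_top ?_).symm
  rw [hR, Ideal.span_singleton_le_iff_mem, PrimeSpectrum.comap_asIdeal, Ideal.mem_comap,
    map_natCast]
  obtain ⟨N, hN⟩ := hp
  refine x.2.mem_of_pow_mem N ?_
  rw [hN]
  exact Ideal.zero_mem _

/-- As `p` is nilpotent in `B`, all of `Spec B` maps to the closed point, so the preimage is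
everything or empty. This provides the affineness asked by `JetPoint.ofMap` for points over a
section, with no separatedness assumption on the group. -/
theorem isAffineOpen_preimage_algebraMapHom [IsLocalRing R]
    (hR : IsLocalRing.maximalIdeal R = Ideal.span {(p : R)}) (hp : IsNilpotent (p : B))
    (W : (specOver (CommAlgCat.of R R)).left.Opens) :
    IsAffineOpen ((specOverMap (algebraMapHom B)).left ⁻¹ᵁ W) := by
  by_cases h : specClosedPoint R ∈ W
  · let W' : TopologicalSpace.Opens (PrimeSpectrum R) := W
    have hW : W = ⊤ := (IsLocalRing.closedPoint_mem_iff W').mp h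
    rw [hW]
    exact isAffineOpen_top (Spec (CommRingCat.of B))
  · have hbot : (specOverMap (algebraMapHom B)).left ⁻¹ᵁ W = ⊥ := by
      rw [eq_bot_iff]
      intro x hx
      have hx' : PrimeSpectrum.comap (algebraMap R B) x ∈ W := hx
      have heq := comap_algebraMap_eq_closedPoint hR hp x
      rw [heq] at hx'
      exact absurd hx' h
    rw [hbot]
    exact isAffineOpen_bot _

theorem isAffineOpen_preimage_section [IsLocalRing R]
    (hR : IsLocalRing.maximalIdeal R = Ideal.span {(p : R)}) (hp : IsNilpotent (p : B))
    (s : specOver (CommAlgCat.of R R) ⟶ X) {b : specOver B ⟶ X}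
    (hb : b = specOverMap (algebraMapHom B) ≫ s) (U : X.left.Opens) :
    IsAffineOpen (b.left ⁻¹ᵁ U) := by
  subst hb
  exact isAffineOpen_preimage_algebraMapHom hR hp (s.left ⁻¹ᵁ U)

/-- Arbitrary formal coordinates are automatically centred: at the unit over `R` they are nilpotent
elements of a reduced ring, and the unit over `B` is its base change. -/
theorem formalCoord_unitPoint [IsReduced R]
    (c : (formalCompletion G).toFunctor ≅ formalAffineSpace R d)
    (f : (formalCompletion G).toFunctor.obj B) (hf : f.1 = unitPoint G B) (j : Fin d) :
    (c.hom.app B f j : B) = 0 := by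
  have hmem : ∀ B : CommAlgCat.{u} R, unitPoint G B ∈ (formalCompletion G).obj B := fun B =>
    comp_unitPoint _
  let e : (formalCompletion G).toFunctor.obj (CommAlgCat.of R R) := ⟨_, hmem _⟩
  have he : f = (formalCompletion G).toFunctor.map (algebraMapHom B) e :=
    Subtype.ext (hf.trans (comp_unitPoint (algebraMapHom B)).symm)
  have h0 : (c.hom.app _ e j : R) = 0 := by
    have h := (c.hom.app _ e j).2
    exact (mem_nilradical.mp h).eq_zero
  rw [he, formalCoord_map]
  exact (congrArg (algebraMapHom B).hom h0).trans (map_zero _)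

variable [hφ : IsFrobeniusLift p φ]

theorem comp_eq_unitPoint_iff [IsReduced R]
    (c : (formalCompletion G).toFunctor ≅ formalAffineSpace R d)
    (f : (formalCompletion G).toFunctor.obj (jetObj p φ n B)) :
    specOverMap (jetObjProj p φ n B) ≫ f.1 = unitPoint G B ↔
      ∀ j, JetRing.coord (c.hom.app _ f j : JetRing p φ n B) 0 = 0 := by
  let f' := (formalCompletion G).toFunctor.map (jetObjProj p φ n B) f
  have h : ∀ j, (c.hom.app B f' j : B) = JetRing.coord (c.hom.app _ f j : JetRing p φ n B) 0 :=
    fun j => (formalCoord_map c (jetObjProj p φ n B) f j).trans (jetObjProj_apply p φ n B _)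
  constructor
  · intro hf j
    rw [← h]
    exact formalCoord_unitPoint c f' hf j
  · intro hf
    let e : (formalCompletion G).toFunctor.obj B := ⟨unitPoint G B, comp_unitPoint _⟩
    have : f' = e := formalCoord_injective c <| funext fun j => Subtype.ext <| by
      rw [h, hf, formalCoord_unitPoint c e rfl]
    exact congrArg Subtype.val this

namespace UnitChart

variable (𝓒 : UnitChart G d)

/-- Functions at the representing point differ from their unit values by elements of the nilpotent
kernel of the projection of jets, so that point lies in the formal completion. -/
theorem exists_represents (hp : IsNilpotent (p : B)) {P : JetPoint p φ n G (specOver B)}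
    (hP : P.base = unitPoint G B) :
    ∃ f : (formalCompletion G).toFunctor.obj (jetObj p φ n B), P.Represents 𝓒.U f.1 := by
  have hU : P.base.left ⁻¹ᵁ (𝓒.U : G.left.Opens) = ⊤ := by
    rw [hP]
    exact 𝓒.preimage_unitPoint B
  obtain ⟨f, hf⟩ := P.exists_represents hU
  refine ⟨⟨f, (𝓒.mem_formalCompletion_iff f).mpr ⟨hf.preimage_eq, fun a => ?_⟩⟩, hf⟩
  have h1 := pointHom_specOverMap_comp (jetObjProj p φ n B) f hf.preimage_eq
    (preimage_comp_eq_top _ hf.preimage_eq) a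
  have h2 := RingHom.congr_fun (pointHom_congr (hf.base_eq.symm.trans hP)
    (preimage_comp_eq_top _ hf.preimage_eq) (𝓒.preimage_unitPoint B)) a
  have h3 := h1.symm.trans (h2.trans (𝓒.pointHom_unitPoint a))
  obtain ⟨N, hN⟩ := JetRing.isNilpotent_ker_proj (φ := φ) (n := n) hp
  have h4 : pointHom f 𝓒.U hf.preimage_eq a - algebraMap R (JetRing p φ n B) (𝓒.ε a) ∈
      RingHom.ker (JetRing.proj p φ n B) := by
    rw [RingHom.mem_ker, map_sub, AlgHom.commutes, sub_eq_zero]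
    exact h3
  have h5 := Ideal.pow_mem_pow h4 N
  rw [hN] at h5
  exact mem_nilradical.mpr ⟨N, h5⟩

/-- The point of the formal completion, with values in the ring of jets, that corresponds to a
point of the kernel of the projection of the jet space. -/
def kernelMap (hp : IsNilpotent (p : B)) {P : JetPoint p φ n G (specOver B)}
    (hP : P.base = unitPoint G B) : (formalCompletion G).toFunctor.obj (jetObj p φ n B) :=
  (𝓒.exists_represents hp hP).choose

theorem represents_kernelMap (hp : IsNilpotent (p : B)) {P : JetPoint p φ n G (specOver B)}
    (hP : P.base = unitPoint G B) : P.Represents 𝓒.U (𝓒.kernelMap hp hP).1 :=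
  (𝓒.exists_represents hp hP).choose_spec

theorem comp_kernelMap (hp : IsNilpotent (p : B)) {P : JetPoint p φ n G (specOver B)}
    (hP : P.base = unitPoint G B) :
    specOverMap (jetObjProj p φ n B) ≫ (𝓒.kernelMap hp hP).1 = unitPoint G B :=
  (𝓒.represents_kernelMap hp hP).base_eq.symm.trans hP

theorem kernelMap_pullback (hp : IsNilpotent (p : B)) (hp' : IsNilpotent (p : B'))
    {P : JetPoint p φ n G (specOver B)} (hP : P.base = unitPoint G B) (k : B ⟶ B')
    (hP' : (P.pullback (specOverMap k)).base = unitPoint G B') :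
    𝓒.kernelMap hp' hP' =
      (formalCompletion G).toFunctor.map (jetObjMap p φ n k) (𝓒.kernelMap hp hP) :=
  Subtype.ext ((𝓒.represents_kernelMap hp' hP').map_unique
    ((𝓒.represents_kernelMap hp hP).pullback k))

theorem isAffineOpen_preimage [IsLocalRing R]
    (hR : IsLocalRing.maximalIdeal R = Ideal.span {(p : R)}) (hp : IsNilpotent (p : B))
    {b : specOver B ⟶ G} (hb : b = unitPoint G B) (U : G.left.Opens) :
    IsAffineOpen (b.left ⁻¹ᵁ U) :=
  isAffineOpen_preimage_section hR hp (unitPoint G (CommAlgCat.of R R))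
    (hb.trans (comp_unitPoint (algebraMapHom B)).symm) U

theorem eq_ofMap_kernelMap [IsLocalRing R]
    (hR : IsLocalRing.maximalIdeal R = Ideal.span {(p : R)}) (hp : IsNilpotent (p : B))
    {P : JetPoint p φ n G (specOver B)} (hP : P.base = unitPoint G B) :
    P = JetPoint.ofMap hp (𝓒.kernelMap hp hP).1
      (fun U => isAffineOpen_preimage hR hp (𝓒.comp_kernelMap hp hP) U) :=
  (𝓒.represents_kernelMap hp hP).point_unique
    (JetPoint.represents_ofMap hp _ (𝓒.represents_kernelMap hp hP).preimage_eq)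

theorem exists_kernelMap_eq [IsLocalRing R]
    (hR : IsLocalRing.maximalIdeal R = Ideal.span {(p : R)}) (hp : IsNilpotent (p : B))
    (f : (formalCompletion G).toFunctor.obj (jetObj p φ n B))
    (hf : specOverMap (jetObjProj p φ n B) ≫ f.1 = unitPoint G B) :
    ∃ (P : JetPoint p φ n G (specOver B)) (hP : P.base = unitPoint G B),
      𝓒.kernelMap hp hP = f := by
  obtain ⟨h, -⟩ := (𝓒.mem_formalCompletion_iff f.1).mp f.2
  have h1 := JetPoint.represents_ofMap hp (fun U => isAffineOpen_preimage hR hp hf U) h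
  exact ⟨_, hf, Subtype.ext ((𝓒.represents_kernelMap hp hf).map_unique h1)⟩

end UnitChart

end Kernel

/-! ### Coordinates on the kernel and its composition law -/

section KernelCoordinates

variable {p : ℕ} {R : Type u} [CommRing R] {φ : R →+* R} {n d : ℕ} [hφ : IsFrobeniusLift p φ]
  {G : Over (Spec (CommRingCat.of R))} [GrpObj G] {B B' : CommAlgCat.{u} R}

theorem exists_affineOpens_le [IsLocalRing R] {X : Over (Spec (CommRingCat.of R))}
    (s : specOver (CommAlgCat.of R R) ⟶ X) {V : X.left.Opens} (hV : s.left ⁻¹ᵁ V = ⊤) :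
    ∃ W : X.left.affineOpens, (W : X.left.Opens) ≤ V ∧ s.left ⁻¹ᵁ (W : X.left.Opens) = ⊤ := by
  have hs : specClosedPoint R ∈ s.left ⁻¹ᵁ V := by
    rw [hV]
    trivial
  obtain ⟨_, ⟨W, hW, rfl⟩, hsW, hWV⟩ :=
    X.left.isBasis_affineOpens.exists_subset_of_mem_open hs V.2
  exact ⟨⟨W, hW⟩, hWV, preimage_eq_top_of_specClosedPoint_mem s hsW⟩

theorem comp_lift_unitPoint (k : B ⟶ B') :
    specOverMap k ≫ lift (unitPoint G B) (unitPoint G B) =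
      lift (unitPoint G B') (unitPoint G B') := by
  rw [comp_lift, comp_unitPoint]

namespace UnitChart

variable (𝓒 : UnitChart G d)

theorem isMul_iff [IsLocalRing R]
    (hR : IsLocalRing.maximalIdeal R = Ideal.span {(p : R)}) (hp : IsNilpotent (p : B))
    {P Q S : JetPoint p φ n G (specOver B)} (hP : P.base = unitPoint G B)
    (hQ : Q.base = unitPoint G B) (hS : S.base = unitPoint G B) :
    JetPoint.IsMul P Q S ↔
      𝓒.kernelMap hp hS = formalMul (𝓒.kernelMap hp hP) (𝓒.kernelMap hp hQ) := by
  constructor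
  · rintro ⟨M, h1, h2, h3⟩
    let s : specOver (CommAlgCat.of R R) ⟶ G ⊗ G := lift (unitPoint G _) (unitPoint G _)
    have hM : M.base = specOverMap (algebraMapHom B) ≫ s := by
      rw [comp_lift_unitPoint]
      refine hom_ext _ _ ?_ ?_
      · rw [lift_fst, ← hP]
        exact h1.1
      · rw [lift_snd, ← hQ]
        exact h2.1
    have hs : ∀ m : G ⊗ G ⟶ G, s ≫ m = unitPoint G _ →
        s.left ⁻¹ᵁ (m.left ⁻¹ᵁ (𝓒.U : G.left.Opens)) = ⊤ := fun m hm => by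
      change (s ≫ m).left ⁻¹ᵁ (𝓒.U : G.left.Opens) = ⊤
      rw [hm]
      exact 𝓒.preimage_eq
    -- A common affine chart of `G ⊗ G` around the unit, mapped into the chart of `G` by both
    -- projections and by the multiplication. On it the three image conditions on `M` become
    -- equations between morphisms to `G`.
    obtain ⟨W, hW, hsW⟩ := exists_affineOpens_le s
      (V := (fst G G).left ⁻¹ᵁ (𝓒.U : G.left.Opens) ⊓ ((snd G G).left ⁻¹ᵁ (𝓒.U : G.left.Opens) ⊓
        (MonObj.mul (X := G)).left ⁻¹ᵁ (𝓒.U : G.left.Opens))) <| by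
      rw [eq_top_iff]
      intro x hx
      exact ⟨(hs _ (lift_fst _ _)).ge hx, (hs _ (lift_snd _ _)).ge hx,
        (hs _ lift_unitPoint_comp_mul).ge hx⟩
    have hMW : M.base.left ⁻¹ᵁ (W : (G ⊗ G).left.Opens) = ⊤ := by
      rw [hM]
      exact preimage_comp_eq_top _ hsW
    obtain ⟨m, hm⟩ := M.exists_represents hMW
    have e1 := hm.comp_eq_of_isImage (𝓒.represents_kernelMap hp hP) (fun x hx => (hW hx).1) h1
    have e2 := hm.comp_eq_of_isImage (𝓒.represents_kernelMap hp hQ) (fun x hx => (hW hx).2.1) h2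
    have e3 := hm.comp_eq_of_isImage (𝓒.represents_kernelMap hp hS) (fun x hx => (hW hx).2.2) h3
    refine Subtype.ext ?_
    change (𝓒.kernelMap hp hS).1 =
      lift (𝓒.kernelMap hp hP).1 (𝓒.kernelMap hp hQ).1 ≫ MonObj.mul (X := G)
    rw [← e3, ← e1, ← e2, ← comp_lift, lift_fst_snd, Category.comp_id]
  · intro h
    -- Conversely, the pair of the two points with values in jets gives the required jet point of `G
    -- ⊗ G`, since its base is the base change of a section over `R`.
    let m := lift (𝓒.kernelMap hp hP).1 (𝓒.kernelMap hp hQ).1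
    have hm : specOverMap (jetObjProj p φ n B) ≫ m = specOverMap (algebraMapHom B) ≫
        lift (unitPoint G (CommAlgCat.of R R)) (unitPoint G (CommAlgCat.of R R)) := by
      rw [comp_lift_unitPoint, comp_lift, comp_kernelMap, comp_kernelMap]
    have hm' := isAffineOpen_preimage_section hR hp _ hm
    refine ⟨JetPoint.ofMap hp m fun U => hm' U, ?_, ?_, ?_⟩
    · rw [𝓒.eq_ofMap_kernelMap hR hp hP]
      exact JetPoint.isImage_ofMap hp (fst G G) (lift_fst _ _) _ _
    · rw [𝓒.eq_ofMap_kernelMap hR hp hQ]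
      exact JetPoint.isImage_ofMap hp (snd G G) (lift_snd _ _) _ _
    · rw [𝓒.eq_ofMap_kernelMap hR hp hS]
      exact JetPoint.isImage_ofMap hp MonObj.mul (congrArg Subtype.val h).symm _ _

variable (c : (formalCompletion G).toFunctor ≅ formalAffineSpace R d)

/-- The coordinates of a point of the kernel of the projection of the jet space. -/
def kernelCoord (hp : IsNilpotent (p : B)) {P : JetPoint p φ n G (specOver B)}
    (hP : P.base = unitPoint G B) (v : Fin n × Fin d) : B :=
  JetRing.coord (c.hom.app _ (𝓒.kernelMap hp hP) v.2 : JetRing p φ n B) v.1.succ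

theorem coord_zero_kernelMap [IsReduced R] (hp : IsNilpotent (p : B))
    {P : JetPoint p φ n G (specOver B)} (hP : P.base = unitPoint G B) (j : Fin d) :
    JetRing.coord (c.hom.app _ (𝓒.kernelMap hp hP) j : JetRing p φ n B) 0 = 0 :=
  (comp_eq_unitPoint_iff c _).mp (𝓒.comp_kernelMap hp hP) j

theorem kernelCoord_injective [IsReduced R] (hp : IsNilpotent (p : B))
    {P Q : JetPoint p φ n G (specOver B)} (hP : P.base = unitPoint G B)
    (hQ : Q.base = unitPoint G B) (h : 𝓒.kernelCoord c hp hP = 𝓒.kernelCoord c hp hQ) :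
    P = Q := by
  have h1 : 𝓒.kernelMap hp hP = 𝓒.kernelMap hp hQ := by
    refine formalCoord_injective c (funext fun j => Subtype.ext (JetRing.ext (funext fun i => ?_)))
    refine Fin.cases ?_ (fun i => ?_) i
    · exact (𝓒.coord_zero_kernelMap c hp hP j).trans (𝓒.coord_zero_kernelMap c hp hQ j).symm
    · exact congrFun h (i, j)
  refine (𝓒.represents_kernelMap hp hP).point_unique ?_
  rw [h1]
  exact 𝓒.represents_kernelMap hp hQ

/-- The jets with order-zero component `0` and remaining components `t` are nilpotent, hence are the
formal coordinates of some point; it projects to the unit because its coordinates do. -/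
theorem kernelCoord_surjective [IsReduced R] [IsLocalRing R]
    (hR : IsLocalRing.maximalIdeal R = Ideal.span {(p : R)}) (hp : IsNilpotent (p : B))
    (t : Fin n × Fin d → B) : ∃ (P : JetPoint p φ n G (specOver B)) (hP : P.base = unitPoint G B),
      𝓒.kernelCoord c hp hP = t := by
  let u : Fin d → JetRing p φ n B := fun j => ⟨Fin.cons 0 fun i => t (i, j)⟩
  have hu : ∀ j, u j ∈ nilradical (jetObj p φ n B) := fun j => by
    obtain ⟨N, hN⟩ := JetRing.isNilpotent_ker_proj (φ := φ) (n := n) hp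
    have h : u j ∈ RingHom.ker (JetRing.proj p φ n B) := JetRing.proj_apply _
    have h1 := Ideal.pow_mem_pow h N
    rw [hN] at h1
    exact mem_nilradical.mpr ⟨N, h1⟩
  let f := c.inv.app (jetObj p φ n B) fun j => ⟨u j, hu j⟩
  have hf : ∀ j, (c.hom.app _ f j : JetRing p φ n B) = u j := fun j => by
    rw [formalCoord_inv]
  obtain ⟨P, hP, hPf⟩ := 𝓒.exists_kernelMap_eq hR hp f <|
    (comp_eq_unitPoint_iff c f).mpr fun j => congrArg (fun u => JetRing.coord u 0) (hf j)
  refine ⟨P, hP, funext fun v => ?_⟩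
  rw [kernelCoord, hPf]
  exact congrArg (fun u => JetRing.coord u v.1.succ) (hf v.2)

theorem kernelCoord_pullback (hp : IsNilpotent (p : B)) (hp' : IsNilpotent (p : B'))
    {P : JetPoint p φ n G (specOver B)} (hP : P.base = unitPoint G B) (k : B ⟶ B')
    (hP' : (P.pullback (specOverMap k)).base = unitPoint G B') (v : Fin n × Fin d) :
    𝓒.kernelCoord c hp' hP' v = k.hom (𝓒.kernelCoord c hp hP v) := by
  rw [kernelCoord, 𝓒.kernelMap_pullback hp hp' hP k hP', kernelCoord]
  exact (congrArg (fun u => JetRing.coord u v.1.succ)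
    (formalCoord_map c (jetObjMap p φ n k) _ v.2)).trans (jetObjMap_coord p φ n k _ _)

/-- The law `F` is applied over the ring of jets, where it computes the product; `coord_evalSeries`
then reads off the component of each order. -/
theorem isMul_iff_kernelCoord [Fact p.Prime] [IsReduced R] [IsLocalRing R]
    (hR : IsLocalRing.maximalIdeal R = Ideal.span {(p : R)}) (hp : IsNilpotent (p : B))
    {F : Fin d → MvPowerSeries (Fin d ⊕ Fin d) R}
    (hF : ∀ (B : CommAlgCat.{u} R) (g h k : (formalCompletion G).toFunctor.obj B),
      k.1 = lift g.1 h.1 ≫ MonObj.mul (X := G) → ∀ j, (c.hom.app B k j : B) =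
        evalSeries (F j) (Sum.elim (fun a => (c.hom.app B g a : B)) fun a => (c.hom.app B h a : B)))
    {P Q S : JetPoint p φ n G (specOver B)} (hP : P.base = unitPoint G B)
    (hQ : Q.base = unitPoint G B) (hS : S.base = unitPoint G B) :
    JetPoint.IsMul P Q S ↔ ∀ (i : Fin n) (j : Fin d), 𝓒.kernelCoord c hp hS (i, j) =
      evalSeries (kernelSeries p φ F (i + 1) j)
        (kernelPoint (𝓒.kernelCoord c hp hP) (𝓒.kernelCoord c hp hQ)) := by
  let f := 𝓒.kernelMap hp hP
  let g := 𝓒.kernelMap hp hQ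
  let u : Fin d ⊕ Fin d → JetRing p φ n B :=
    Sum.elim (fun a => (c.hom.app _ f a : JetRing p φ n B)) fun a => c.hom.app _ g a
  have hu : ∀ s, JetRing.proj p φ n B (u s) = 0 := by
    rintro (a | a)
    · exact (JetRing.proj_apply _).trans (𝓒.coord_zero_kernelMap c hp hP a)
    · exact (JetRing.proj_apply _).trans (𝓒.coord_zero_kernelMap c hp hQ a)
  have hcoords : JetRing.coords u =
      kernelPoint (𝓒.kernelCoord c hp hP) (𝓒.kernelCoord c hp hQ) := by
    funext ⟨r, s⟩
    cases r with
    | zero =>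
      rw [JetRing.coords_zero hu]
      rfl
    | succ r =>
      by_cases h : r < n
      · rcases s with a | a
        · simp [JetRing.coords, kernelPoint, h, u, kernelCoord, f]
        · simp [JetRing.coords, kernelPoint, h, u, kernelCoord, g]
      · rcases s with a | a <;> simp [JetRing.coords, kernelPoint, h]
  have hmul : ∀ i j, JetRing.coord (c.hom.app _ (formalMul f g) j : JetRing p φ n B) i =
      evalSeries (kernelSeries p φ F i j)
        (kernelPoint (𝓒.kernelCoord c hp hP) (𝓒.kernelCoord c hp hQ)) := by
    intro i j
    have h1 := hF (jetObj p φ n B) f g (formalMul f g) rfl j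
    have h2 := JetRing.coord_evalSeries hp (F j) hu i
    rw [kernelSeries_eq_cutSeries, ← hcoords, ← h2]
    exact congrArg (fun u => JetRing.coord u i) h1
  rw [𝓒.isMul_iff hR hp hP hQ hS]
  constructor
  · intro h i j
    rw [kernelCoord, h]
    exact hmul i.succ j
  · intro h
    refine formalCoord_injective c (funext fun j => Subtype.ext (JetRing.ext (funext fun i => ?_)))
    refine Fin.cases ?_ (fun i => ?_) i
    -- The order-zero component is not recorded by `kernelCoord`; it vanishes on both sides because
    -- the product also projects to the unit.
    · refine (𝓒.coord_zero_kernelMap c hp hS j).trans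
        ((comp_eq_unitPoint_iff c (formalMul f g)).mp ?_ j).symm
      change specOverMap (jetObjProj p φ n B) ≫ lift f.1 g.1 ≫ MonObj.mul (X := G) = _
      rw [← Category.assoc, comp_lift, comp_kernelMap, comp_kernelMap, lift_unitPoint_comp_mul]
    · exact (h i j).trans (hmul i.succ j).symm

end UnitChart

end KernelCoordinates

/-! ### Specialization to discrete valuation rings and assembly -/

theorem isFrobeniusLift_of_isDiscreteValuationRing {p : ℕ} [hp : Fact p.Prime] {R : Type u}
    [CommRing R] [IsDomain R] [IsDiscreteValuationRing R]
    (hR : IsLocalRing.maximalIdeal R = Ideal.span {(p : R)}) {φ : R →+* R}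
    (hφ : ∀ x : R, (p : R) ∣ φ x - x ^ p) : IsFrobeniusLift p φ where
  prime := hp.out
  dvd := hφ
  regular x y h := by
    have h0 : (p : R) ≠ 0 := fun h0 => IsDiscreteValuationRing.not_a_field R (by simp [hR, h0])
    exact mul_left_cancel₀ h0 h

theorem exists_jetKernel_iso {p : ℕ} [Fact p.Prime] {R : Type u} [CommRing R] [IsReduced R]
    [IsLocalRing R] (hR : IsLocalRing.maximalIdeal R = Ideal.span {(p : R)}) {φ : R →+* R}
    [IsFrobeniusLift p φ] {d : ℕ} {G : Over (Spec (CommRingCat.of R))} [GrpObj G]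
    (𝓒 : UnitChart G d) {F : Fin d → MvPowerSeries (Fin d ⊕ Fin d) R} (hF : IsFormalGroupLaw G F)
    (n : ℕ) :
    ∃ ψ : (jetKernel p φ n G).toFunctor ≅ affineSpace p R (Fin n × Fin d),
      ∀ (B : PNilAlg p R) (P Q S : (jetKernel p φ n G).toFunctor.obj B),
        JetPoint.IsMul P.1 Q.1 S.1 ↔ ∀ (i : Fin n) (j : Fin d),
          ψ.hom.app B S (i, j) = evalSeries (kernelSeries p φ F (i + 1) j)
            (kernelPoint (ψ.hom.app B P) (ψ.hom.app B Q)) := by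
  obtain ⟨c, hc⟩ := hF
  let σ : (jetKernel p φ n G).toFunctor ⟶ affineSpace p R (Fin n × Fin d) :=
    { app := fun B => TypeCat.ofHom fun P : (jetKernel p φ n G).obj B =>
        𝓒.kernelCoord c (B := B.obj) B.property (P := P.1) P.2
      naturality := fun B B' k => by
        ext P
        exact funext fun v => 𝓒.kernelCoord_pullback c B.property B'.property P.2 k.hom _ v }
  have : ∀ B, IsIso (σ.app B) := fun B => (isIso_iff_bijective _).mpr
    ⟨fun P Q h => Subtype.ext (𝓒.kernelCoord_injective c B.property P.2 Q.2 h), fun t => by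
      obtain ⟨P, hP, h⟩ := 𝓒.kernelCoord_surjective (φ := φ) (n := n) c (B := B.obj) hR B.property t
      exact ⟨⟨P, hP⟩, h⟩⟩
  have : IsIso σ := NatIso.isIso_of_isIso_app σ
  exact ⟨asIso σ, fun B P Q S => 𝓒.isMul_iff_kernelCoord c hR B.property hc P.2 Q.2 S.2⟩

theorem isAffineOpen_top_toScheme {X : Scheme.{u}} (U : X.affineOpens) :
    IsAffineOpen (⊤ : (U : X.Opens).toScheme.Opens) := by
  have : IsAffine (U : X.Opens) := U.2
  exact isAffineOpen_top _

end PJet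

end

theorem mainTheorem1 (p : ℕ) [Fact p.Prime] {R : Type u} [CommRing R] [IsDomain R]
    [IsDiscreteValuationRing R] (hR : IsLocalRing.maximalIdeal R = Ideal.span {(p : R)})
    [IsAdicComplete (Ideal.span {(p : R)}) R]
    (φ : R →+* R) (hφ : ∀ x : R, (p : R) ∣ φ x - x ^ p) (d : ℕ) :
    (∀ X : Over (Spec (CommRingCat.of R)), SmoothOfRelativeDimension d X.hom →
      ∃ (I : Type u) (U : I → X.left.affineOpens),
        (⨆ i, (U i : X.left.Opens)) = ⊤ ∧
        ∀ (n : ℕ) (i : I),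
          ∃ e : PJet.jetSpace p φ n (Over.mk ((U i : X.left.Opens).ι ≫ X.hom)) ≅
              FunctorToTypes.prod
                (PJet.completion p (Over.mk ((U i : X.left.Opens).ι ≫ X.hom)))
                (PJet.affineSpace p R (Fin n × Fin d)),
            e.hom ≫ FunctorToTypes.prod.fst = PJet.jetProj p φ n _) ∧
    (∀ (G : Over (Spec (CommRingCat.of R))) [GrpObj G], SmoothOfRelativeDimension d G.hom →
      (∃ F : Fin d → MvPowerSeries (Fin d ⊕ Fin d) R, PJet.IsFormalGroupLaw G F) ∧
      ∀ F : Fin d → MvPowerSeries (Fin d ⊕ Fin d) R, PJet.IsFormalGroupLaw G F →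
        (∀ (i : ℕ) (j : Fin d), PJet.IsRestricted p (PJet.kernelSeries p φ F i j)) ∧
        ∀ n : ℕ,
          ∃ ψ : (PJet.jetKernel p φ n G).toFunctor ≅ PJet.affineSpace p R (Fin n × Fin d),
            ∀ (B : PJet.PNilAlg p R) (P Q S : (PJet.jetKernel p φ n G).toFunctor.obj B),
              PJet.JetPoint.IsMul P.1 Q.1 S.1 ↔
                ∀ (i : Fin n) (j : Fin d),
                  ψ.hom.app B S (i, j) =
                    PJet.evalSeries (PJet.kernelSeries p φ F (i + 1) j)
                      (PJet.kernelPoint (ψ.hom.app B P) (ψ.hom.app B Q))) := by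
  have := PJet.isFrobeniusLift_of_isDiscreteValuationRing hR hφ
  refine ⟨fun X hX => ?_, fun G _ hG => ?_⟩
  · obtain ⟨I, U, hU, hI⟩ := PJet.exists_iSup_eq_top_and_etale hX
    refine ⟨I, U, hU, fun n i => ?_⟩
    obtain ⟨g, hg, he⟩ := hI i
    exact PJet.exists_jetSpace_iso_of_etale n
      (X := Over.mk ((U i : X.left.Opens).ι ≫ X.hom)) (PJet.isAffineOpen_top_toScheme (U i)) hg he
  · obtain ⟨𝓒⟩ := PJet.exists_unitChart hG
    obtain ⟨c⟩ := 𝓒.nonempty_iso_formalAffineSpace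
    refine ⟨PJet.exists_isFormalGroupLaw c, fun F hF => ⟨fun i j => ?_, fun n => ?_⟩⟩
    · rw [PJet.kernelSeries_eq_cutSeries]
      exact PJet.JetRing.isRestricted_cutSeries (F j) i
    · exact PJet.exists_jetKernel_iso hR 𝓒 hF n
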